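/- Let $\mathbb F$ be a field of characteristic $0$. The Schrödinger–Virasoro conformal algebra $\mathcal{SV}$ is the free $\mathbb F[\partial]$-module with basis $L, M, Y$ and the conformally sesquilinear $\lambda$-bracket whose non-zero values on the generators are $$[L_\lambda L]=(\partial+2\lambda)L,\quad [L_\lambda M]=(\partial+\lambda)M,\quad [L_\lambda Y]=(\partial+\tfrac32\lambda)Y,$$ $$[M_\lambda L]=\lambda M,\quad [Y_\lambda L]=(\tfrac12\partial+\tfrac32\lambda)Y,\quad [Y_\lambda Y]=(\partial+2\lambda)M.$$ A $q$-cochain ($q\ge 0$) of $\mathcal{SV}$ with coefficients in its adjoint module is an $\mathbb F$-linear map $f:\mathcal{SV}^{\otimes q}\to \mathcal{SV}[\lambda_1,\dots,\lambda_q]$ with $f_{\lambda_1,\dots,\lambda_q}(a_1,\dots,\partial a_i,\dots,a_q)=-\lambda_i f_{\lambda_1,\dots,\lambda_q}(a_1,\dots,a_q)$ and $f_{\lambda_{\sigma(1)},\dots,\lambda_{\sigma(q)}}(a_{\sigma(1)},\dots,a_{\sigma(q)})=\mathrm{sign}(\sigma)f_{\lambda_1,\dots,\lambda_q}(a_1,\dots,a_q)$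 for all $\sigma\in S_q$. The cochains form the basic complex $\widetilde C^\bullet$ with the differential $$(\mathbf df)_{\lambda_1,\dots,\lambda_{q+1}}(a_1,\dots,a_{q+1})=\sum_{k}(-1)^{k+1}[a_{k\,\lambda_k}f_{\dots,\hat\lambda_k,\dots}(\dots,\hat a_k,\dots)]+\sum_{k<l}(-1)^{k+l}f_{\lambda_k+\lambda_l,\dots,\hat\lambda_k,\dots,\hat\lambda_l,\dots}([a_{k\,\lambda_k}a_l],\dots,\hat a_k,\dots,\hat a_l,\dots).$$ The operator $(\partial f)_{\lambda_1,\dots,\lambda_q}=(\partial+\lambda_1+\dots+\lambda_q)f_{\lambda_1,\dots,\lambda_q}$ commutes with $\mathbf d$, and $\widetilde C^\bullet/\partial\widetilde C^\bullet$ is the reduced complex. Let $\widetilde{\mathrm H}^q(\mathcal{SV},\mathcal{SV})$ and $\mathrm H^q(\mathcal{SV},\mathcal{SV})$ be the $q$-th cohomology of the basic and of the reduced complex. Then $$\dim\widetilde{\mathrm H}^q(\mathcal{SV},\mathcal{SV})=\begin{cases}1,& q=1,3,\\ 2,& q=2,\\ 0,&\text{otherwise,}\end{cases}\qquad \dim\mathrm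 H^q(\mathcal{SV},\mathcal{SV})=\begin{cases}1,& q=0,3,\\ 3,& q=1,2,\\ 0,&\text{otherwise.}\end{cases}$$ Explicit bases are as follows, where each cochain is given by its non-zero values on tuples of generators, up to skew-symmetry: - $f_{01}=M$ ($q=0$); - $f_{11}:L\mapsto M$; - $f_{12}:Y\mapsto \frac12Y,\ M\mapsto M$; - $f_{13}:L\mapsto\partial M$; - $f_{21}:L\otimes Y\mapsto\frac12Y,\ L\otimes M\mapsto M$; - $f_{22}:L\otimes L\mapsto(\lambda_1-\lambda_2)M$; - $f_{23}:L\otimes Y\mapsto\frac12(\partial+\lambda_2)Y,\ L\otimes M\mapsto(\partial+\lambda_2)M$; - $f_{31}:L\otimes L\otimes Y\mapsto\frac12(\lambda_1-\lambda_2)Y,\ L\otimes L\otimes M\mapsto(\lambda_1-\lambda_2)M$. The classes of $f_{11}$; of $f_{21},f_{22}$; and of $f_{31}$ form bases of $\widetilde{\mathrm H}^1$, $\widetilde{\mathrm H}^2$, $\widetilde{\mathrm H}^3$. The classes modulo $\partial\widetilde C^\bullet$ of $f_{01}$; of $f_{11},f_{12},f_{13}$; of $f_{21},f_{22},f_{23}$;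 and of $f_{31}$ form bases of $\mathrm H^0$, $\mathrm H^1$, $\mathrm H^2$, $\mathrm H^3$. -/

import Mathlib

open scoped TensorProduct Polynomial

noncomputable section

/-- Substitution of an operator for `λ`: the map `V[λ] = F[λ] ⊗ V → N` that sends
`∑ λ ^ j v_j` to `∑ T ^ j (g v_j)`. -/
def substOp {F V N : Type*} [Field F] [AddCommGroup V] [Module F V] [AddCommGroup N] [Module F N]
    (T : Module.End F N) (g : V →ₗ[F] N) : F[X] ⊗[F] V →ₗ[F] N :=
  TensorProduct.lift ((LinearMap.lcomp F N g) ∘ₗ (Polynomial.aeval T).toLinearMap)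

theorem substOp_tmul {F V N : Type*} [Field F] [AddCommGroup V] [Module F V] [AddCommGroup N]
    [Module F N] (T : Module.End F N) (g : V →ₗ[F] N) (p : F[X]) (v : V) :
    substOp T g (p ⊗ₜ v) = Polynomial.aeval T p (g v) := rfl

theorem substOp_add {F V N : Type*} [Field F] [AddCommGroup V] [Module F V] [AddCommGroup N]
    [Module F N] (T : Module.End F N) (g h : V →ₗ[F] N) :
    substOp T (g + h) = substOp T g + substOp T h := by
  ext; simp [substOp]

theorem substOp_smul {F V N : Type*} [Field F] [AddCommGroup V] [Module F V] [AddCommGroup N]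
    [Module F N] (T : Module.End F N) (c : F) (g : V →ₗ[F] N) :
    substOp T (c • g) = c • substOp T g := by
  ext; simp [substOp]

/-- Multiplication by an element `t` of a polynomial ring, as an `F`-linear operator. -/
def mulOp (F : Type*) {R N : Type*} [Field F] [CommRing R] [Algebra F R] [AddCommGroup N]
    [Module F N] [Module R N] [IsScalarTower F R N] (t : R) : Module.End F N :=
  Algebra.lsmul F F N t

/-- The space `M[λ_i : i ∈ σ] = F[λ_i : i ∈ σ] ⊗ M` of polynomials in variables `λ_i` with
coefficients in `M`. -/
def PolyMod (σ F M : Type*) [Field F] [AddCommGroup M] [Module F M] : Type _ :=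
  MvPolynomial σ F ⊗[F] M

namespace PolyMod

variable {σ τ F A M : Type*} [Field F] [AddCommGroup A] [Module F A] [AddCommGroup M] [Module F M]

instance : AddCommGroup (PolyMod σ F M) :=
  inferInstanceAs (AddCommGroup (MvPolynomial σ F ⊗[F] M))

instance : Module F (PolyMod σ F M) :=
  inferInstanceAs (Module F (MvPolynomial σ F ⊗[F] M))

instance : Module (MvPolynomial σ F) (PolyMod σ F M) :=
  inferInstanceAs (Module (MvPolynomial σ F) (MvPolynomial σ F ⊗[F] M))

instance : IsScalarTower F (MvPolynomial σ F) (PolyMod σ F M) :=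
  inferInstanceAs (IsScalarTower F (MvPolynomial σ F) (MvPolynomial σ F ⊗[F] M))

/-- The identification with the tensor product. -/
def tensorEquiv (σ F M : Type*) [Field F] [AddCommGroup M] [Module F M] :
    MvPolynomial σ F ⊗[F] M ≃ₗ[MvPolynomial σ F] PolyMod σ F M :=
  LinearEquiv.refl (MvPolynomial σ F) (MvPolynomial σ F ⊗[F] M)

/-- The element `p · m` of `M[λ_i : i ∈ σ]`. -/
def tmul (p : MvPolynomial σ F) (m : M) : PolyMod σ F M := tensorEquiv σ F M (p ⊗ₜ m)

/-- The operator of `M[λ_i : i ∈ σ]` that applies an operator of `M` to the coefficients. -/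
def mapCoeff (σ : Type*) (g : Module.End F M) : Module.End F (PolyMod σ F M) :=
  g.lTensor (MvPolynomial σ F)

/-- The substitution `λ_i ↦ t i` in `M[λ_i : i ∈ σ]`. -/
def substVars (M : Type*) [AddCommGroup M] [Module F M] (t : σ → MvPolynomial τ F) :
    PolyMod σ F M →ₗ[F] PolyMod τ F M :=
  (MvPolynomial.aeval t).toLinearMap.rTensor M

/-- The substitution `λ ↦ t` as a map `M[λ] → M[λ_i : i ∈ σ]`. -/
def substVar (t : MvPolynomial σ F) : F[X] ⊗[F] M →ₗ[F] PolyMod σ F M :=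
  (Polynomial.aeval t).toLinearMap.rTensor M

/-- For a `λ`-action `a ⊗ m ↦ a_λ m ∈ M[λ]` of `A` on `M` and a polynomial `t` in variables
`λ_i` (`i ∈ σ`), this is the operation `m ↦ a_t m`, extended from `M` to `M[λ_i : i ∈ σ]` by
linearity over `F[λ_i : i ∈ σ]`. -/
def actAt (act : A →ₗ[F] M →ₗ[F] F[X] ⊗[F] M) (t : MvPolynomial σ F) :
    A →ₗ[F] PolyMod σ F M →ₗ[F] PolyMod σ F M where
  toFun a := (LinearMap.liftBaseChange (MvPolynomial σ F) (substVar t ∘ₗ act a) :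
    MvPolynomial σ F ⊗[F] M →ₗ[MvPolynomial σ F] PolyMod σ F M).restrictScalars F
  map_add' a b := by
    apply TensorProduct.ext'
    intro p m
    change p • substVar t (act (a + b) m) = p • substVar t (act a m) + p • substVar t (act b m)
    simp
  map_smul' c a := by
    apply TensorProduct.ext'
    intro p m
    change p • substVar t (act (c • a) m) = c • p • substVar t (act a m)
    simp [smul_comm c]

theorem induction_on {P : PolyMod σ F M → Prop} (z : PolyMod σ F M) (zero : P 0)
    (tmul : ∀ p m, P (tmul p m)) (add : ∀ x y, P x → P y → P (x + y)) : P z :=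
  TensorProduct.induction_on z zero tmul add

@[simp] theorem smul_tmul (p r : MvPolynomial σ F) (m : M) : p • tmul r m = tmul (p * r) m := rfl

@[simp] theorem mapCoeff_tmul (g : Module.End F M) (r : MvPolynomial σ F) (m : M) :
    mapCoeff σ g (tmul r m) = tmul r (g m) := rfl

@[simp] theorem substVars_tmul (t : σ → MvPolynomial τ F) (r : MvPolynomial σ F) (m : M) :
    substVars M t (tmul r m) = tmul (MvPolynomial.aeval t r) m := rfl

@[simp] theorem substVar_tmul (t : MvPolynomial σ F) (p : F[X]) (m : M) :
    substVar t (p ⊗ₜ[F] m) = tmul (Polynomial.aeval t p) m := rfl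

@[simp] theorem actAt_tmul (act : A →ₗ[F] M →ₗ[F] F[X] ⊗[F] M) (t : MvPolynomial σ F) (a : A)
    (r : MvPolynomial σ F) (m : M) :
    actAt act t a (tmul r m) = r • substVar t (act a m) := rfl

end PolyMod

open PolyMod

/-- A Lie conformal algebra structure on the vector space `A`. The operator `D` is the action of
`∂`, which makes `A` an `F[∂]`-module, and `bracket a b` is the `λ`-bracket
`[a_λ b] ∈ A[λ] = F[λ] ⊗ A`. -/
structure LieConformalAlgebra (F A : Type*) [Field F] [AddCommGroup A] [Module F A] where
  D : A →ₗ[F] A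
  bracket : A →ₗ[F] A →ₗ[F] F[X] ⊗[F] A
  /-- `[∂a_λ b] = -λ [a_λ b]` -/
  bracket_D_left : ∀ a b, bracket (D a) b = -((Polynomial.X : F[X]) • bracket a b)
  /-- `[a_λ ∂b] = (∂ + λ) [a_λ b]` -/
  bracket_D_right : ∀ a b,
    bracket a (D b) = D.lTensor F[X] (bracket a b) + (Polynomial.X : F[X]) • bracket a b
  /-- `[a_λ b] = -[b_{-λ-∂} a]` -/
  skew : ∀ a b, bracket a b =
    -substOp (-mulOp F (Polynomial.X : F[X]) - D.lTensor F[X])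
      (TensorProduct.mk F F[X] A 1) (bracket b a)
  /-- `[a_λ [b_μ c]] = [[a_λ b]_{λ+μ} c] + [b_μ [a_λ c]]` in `A[λ, μ]`, with
  `λ = X 0` and `μ = X 1` -/
  jacobi : ∀ a b c,
    actAt bracket (.X 0 : MvPolynomial (Fin 2) F) a (actAt bracket (.X 1) b (PolyMod.tmul 1 c)) =
      substOp (mulOp F (.X 0 : MvPolynomial (Fin 2) F))
        ((actAt bracket (.X 0 + .X 1)).flip (PolyMod.tmul 1 c)) (bracket a b) +
      actAt bracket (.X 1) b (actAt bracket (.X 0) a (PolyMod.tmul 1 c))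

/-- A module over a Lie conformal algebra: `D` is the action of `∂` on `M`, and `act a m` is
`a_λ m ∈ M[λ] = F[λ] ⊗ M`. -/
structure ConformalModule {F A : Type*} [Field F] [AddCommGroup A] [Module F A]
    (𝒜 : LieConformalAlgebra F A) (M : Type*) [AddCommGroup M] [Module F M] where
  D : M →ₗ[F] M
  act : A →ₗ[F] M →ₗ[F] F[X] ⊗[F] M
  /-- `(∂a)_λ m = -λ a_λ m` -/
  act_D_left : ∀ a m, act (𝒜.D a) m = -((Polynomial.X : F[X]) • act a m)
  /-- `a_λ (∂m) = (∂ + λ) a_λ m` -/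
  act_D_right : ∀ a m,
    act a (D m) = D.lTensor F[X] (act a m) + (Polynomial.X : F[X]) • act a m
  /-- `a_λ (b_μ m) - b_μ (a_λ m) = [a_λ b]_{λ+μ} m` -/
  act_act : ∀ a b m,
    actAt act (.X 0 : MvPolynomial (Fin 2) F) a (actAt act (.X 1) b (PolyMod.tmul 1 m)) -
      actAt act (.X 1) b (actAt act (.X 0) a (PolyMod.tmul 1 m)) =
      substOp (mulOp F (.X 0 : MvPolynomial (Fin 2) F))
        ((actAt act (.X 0 + .X 1)).flip (PolyMod.tmul 1 m)) (𝒜.bracket a b)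

/-- The adjoint module of a Lie conformal algebra. -/
def LieConformalAlgebra.adjoint {F A : Type*} [Field F] [AddCommGroup A] [Module F A]
    (𝒜 : LieConformalAlgebra F A) : ConformalModule 𝒜 A where
  D := 𝒜.D
  act := 𝒜.bracket
  act_D_left := 𝒜.bracket_D_left
  act_D_right := 𝒜.bracket_D_right
  act_act a b m := by rw [𝒜.jacobi, add_sub_cancel_right]

namespace ConformalModule

variable {F A M : Type*} [Field F] [AddCommGroup A] [Module F A] [AddCommGroup M] [Module F M]
  {𝒜 : LieConformalAlgebra F A} (V : ConformalModule 𝒜 M)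

/-- The space of all `F`-linear maps `A^{⊗ q} → M[λ_1, …, λ_q]`. -/
abbrev Maps (F A M : Type*) [Field F] [AddCommGroup A] [Module F A] [AddCommGroup M] [Module F M]
    (q : ℕ) : Type _ :=
  MultilinearMap F (fun _ : Fin q => A) (PolyMod (Fin q) F M)

/-- The space of `q`-cochains of the basic complex: the linear maps
`f : A^{⊗ q} → M[λ_1, …, λ_q]` with
`f_{λ_1, …, λ_q}(a_1, …, ∂ a_i, …, a_q) = -λ_i f_{λ_1, …, λ_q}(a_1, …, a_q)` and
`f_{λ_σ(1), …, λ_σ(q)}(a_σ(1), …, a_σ(q)) = sign(σ) f_{λ_1, …, λ_q}(a_1, …, a_q)`. -/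
def cochains (_V : ConformalModule 𝒜 M) (q : ℕ) : Submodule F (Maps F A M q) where
  carrier := {f |
    (∀ (a : Fin q → A) (i : Fin q), f (Function.update a i (𝒜.D (a i))) =
      -((.X i : MvPolynomial (Fin q) F) • f a)) ∧
    ∀ (σ : Equiv.Perm (Fin q)) (a : Fin q → A),
      substVars M (fun i => .X (σ i)) (f (fun i => a (σ i))) = (σ.sign : ℤ) • f a}
  zero_mem' := by simp
  add_mem' {f g} hf hg := by
    refine ⟨fun a i => ?_, fun σ a => ?_⟩
    · simp only [add_apply, hf.1, hg.1, smul_add]; abel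
    · simp only [add_apply, map_add, hf.2, hg.2, smul_add]
  smul_mem' c f hf := by
    refine ⟨fun a i => ?_, fun σ a => ?_⟩
    · simp only [smul_apply, hf.1, smul_neg, smul_comm c]
    · rw [smul_apply, map_smul, hf.2, smul_apply, smul_comm]

/-- The term `a_k_{λ_k} f_{λ_1, …, λ̂_k, …, λ_{q+1}}(a_1, …, â_k, …, a_{q+1})` of the differential. -/
def dAct {q : ℕ} (k : Fin (q + 1)) : Maps F A M q →ₗ[F] Maps F A M (q + 1) where
  toFun f := LinearMap.uncurryMid (M := fun _ => A) k
    { toFun a := (actAt V.act (.X k : MvPolynomial (Fin (q + 1)) F) a ∘ₗ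
        substVars M (fun i => .X (k.succAbove i))).compMultilinearMap f
      map_add' a b := by ext; simp
      map_smul' c a := by ext; simp }
  map_add' f g := by ext; simp
  map_smul' c f := by ext; simp

/-- The map `e ↦ f_{λ_k + λ_l, λ_1, …, λ̂_k, …, λ̂_l, …}(e, …)`; see `dBracket`. -/
def insertLeft {q : ℕ} (k : Fin (q + 1)) (l : Fin (q + 2)) (f : Maps F A M (q + 1)) :
    A →ₗ[F] MultilinearMap F (fun _ : Fin q => A) (PolyMod (Fin (q + 2)) F M) :=
  (substVars M (Fin.cons (.X (l.succAbove k) + .X l)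
    (fun i => .X (l.succAbove (k.succAbove i))))).compMultilinearMapₗ F ∘ₗ f.curryLeft

/-- The term `f_{λ_k + λ_l, λ_1, …, λ̂_k, …, λ̂_l, …}([a_k_{λ_k} a_l], a_1, …, â_k, …, â_l, …)` of
the differential, for `k < l`. As `k < l`, the index `k` is given as an element of `Fin (q + 1)`;
it is `l.succAbove k = k.castSucc` in `Fin (q + 2)`, and the remaining indices are
`l.succAbove (k.succAbove i)` for `i : Fin q`. -/
def dBracket (𝒜 : LieConformalAlgebra F A) {q : ℕ} (k : Fin (q + 1)) (l : Fin (q + 2)) :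
    Maps F A M (q + 1) →ₗ[F] Maps F A M (q + 2) where
  toFun f := LinearMap.uncurryMid (M := fun _ => A) l
    { toFun b := LinearMap.uncurryMid (M := fun _ => A) k
        (substOp ((mulOp F (.X (l.succAbove k) :
          MvPolynomial (Fin (q + 2)) F)).compMultilinearMapₗ F) (insertLeft k l f) ∘ₗ
            𝒜.bracket.flip b)
      map_add' a b := by ext; simp
      map_smul' c a := by ext; simp }
  map_add' f g := by
    ext a
    have : insertLeft k l (f + g) = insertLeft k l f + insertLeft k l g := by
      ext; simp [insertLeft]
    simp [this, substOp_add]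
  map_smul' c f := by
    ext a
    have : insertLeft k l (c • f) = c • insertLeft k l f := by
      ext; simp [insertLeft]
    simp [this, substOp_smul]

/-- The differential on multilinear maps. As the indices `k`, `l` start at `0` here, the signs are
`(-1) ^ k` in the first sum and `(-1) ^ (k + l)` in the second. -/
def d : (q : ℕ) → Maps F A M q →ₗ[F] Maps F A M (q + 1)
  | 0 => V.dAct 0
  | q + 1 => ∑ k : Fin (q + 2), (-1 : F) ^ (k : ℕ) • V.dAct k +
      ∑ l : Fin (q + 2), ∑ k : Fin (q + 1) with k.castSucc < l,
        (-1 : F) ^ ((k : ℕ) + (l : ℕ)) • dBracket 𝒜 k l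

/-- The action of `∂` on cochains: multiplication of the values by `∂ + λ_1 + ⋯ + λ_q`. -/
def partialOp (q : ℕ) : Maps F A M q →ₗ[F] Maps F A M q :=
  (mapCoeff (Fin q) V.D +
    mulOp F (∑ i, .X i : MvPolynomial (Fin q) F)).compMultilinearMapₗ F

/-- The cocycles of the basic complex. -/
def basicCocycles (q : ℕ) : Submodule F (Maps F A M q) :=
  V.cochains q ⊓ LinearMap.ker (V.d q)

/-- The coboundaries of the basic complex. -/
def basicCoboundaries : (q : ℕ) → Submodule F (Maps F A M q)
  | 0 => ⊥
  | q + 1 => (V.cochains q).map (V.d q)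

/-- The basic cohomology in degree `q`. -/
abbrev BasicCohomology (q : ℕ) : Type _ :=
  V.basicCocycles q ⧸ (V.basicCoboundaries q).submoduleOf (V.basicCocycles q)

/-- The subspace `∂C̃^q` of the space `C̃^q` of `q`-cochains of the basic complex. -/
def partialCochains (q : ℕ) : Submodule F (Maps F A M q) :=
  (V.cochains q).map (V.partialOp q)

/-- The cochains of the basic complex that represent a cocycle of the reduced complex
`C̃^• / ∂C̃^•`. -/
def reducedCocycles (q : ℕ) : Submodule F (Maps F A M q) :=
  V.cochains q ⊓ (V.partialCochains (q + 1)).comap (V.d q)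

/-- The cochains of the basic complex that represent a coboundary of the reduced complex
`C̃^• / ∂C̃^•`. -/
def reducedCoboundaries (q : ℕ) : Submodule F (Maps F A M q) :=
  V.basicCoboundaries q ⊔ V.partialCochains q

/-- The (reduced) cohomology in degree `q`: the cohomology of `C̃^• / ∂C̃^•`. -/
abbrev ReducedCohomology (q : ℕ) : Type _ :=
  V.reducedCocycles q ⧸ (V.reducedCoboundaries q).submoduleOf (V.reducedCocycles q)

/-- Values of the terms of the differential. -/
theorem dAct_apply {q : ℕ} (k : Fin (q + 1)) (f : Maps F A M q) (a : Fin (q + 1) → A) :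
    V.dAct k f a = actAt V.act (.X k) (a k)
      (substVars M (fun i => .X (k.succAbove i)) (f fun i => a (k.succAbove i))) := rfl

theorem dBracket_apply (𝒜 : LieConformalAlgebra F A) {q : ℕ} (k : Fin (q + 1)) (l : Fin (q + 2))
    (f : Maps F A M (q + 1)) (a : Fin (q + 2) → A) :
    dBracket 𝒜 k l f a =
      substOp (mulOp F (.X (l.succAbove k) : MvPolynomial (Fin (q + 2)) F))
        (substVars M (Fin.cons (.X (l.succAbove k) + .X l)
            (fun i => .X (l.succAbove (k.succAbove i)))) ∘ₗ
          f.toLinearMap (Fin.cons 0 fun i => a (l.succAbove (k.succAbove i))) 0)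
        (𝒜.bracket (a (l.succAbove k)) (a l)) := by
  change substOp _ (insertLeft k l f) (𝒜.bracket (a (l.succAbove k)) (a l))
    (fun i => a (l.succAbove (k.succAbove i))) = _
  induction 𝒜.bracket (a (l.succAbove k)) (a l) using TensorProduct.induction_on with
  | zero => simp
  | add x y hx hy => simp [hx, hy]
  | tmul p e =>
    simp only [substOp_tmul]
    induction p using Polynomial.induction_on' with
    | add p r hp hr => simp [hp, hr]
    | monomial n c =>
      have key : ∀ (n : ℕ) (t : MvPolynomial (Fin (q + 2)) F)
          (g : MultilinearMap F (fun _ : Fin q => A) (PolyMod (Fin (q + 2)) F M)) (r : Fin q → A),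
          (((mulOp F t).compMultilinearMapₗ F ^ n : Module.End F _) g) r =
            (mulOp F t ^ n) (g r) := by
        intro n t g r
        induction n with
        | zero => rfl
        | succ n ih => rw [pow_succ', pow_succ', Module.End.mul_apply, Module.End.mul_apply, ← ih]; rfl
      simp [Polynomial.aeval_monomial, insertLeft, key]

end ConformalModule

namespace SchrodingerVirasoro

variable (F : Type*) [Field F]

/-- The underlying `F[∂]`-module `F[∂] L ⊕ F[∂] Y ⊕ F[∂] M` of the Schrödinger–Virasoro conformal
algebra. The variable `X` of `F[X]` stands for `∂`. -/
abbrev SV : Type _ := Fin 3 → F[X]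

/-- The generators, with indices `0`, `1`, `2` for `L`, `Y`, `M`. -/
def gen (i : Fin 3) : SV F := Pi.single i 1

/-- The generator `L`. -/
abbrev L : SV F := gen F 0

/-- The generator `Y`. -/
abbrev Y : SV F := gen F 1

/-- The generator `M`. -/
abbrev M : SV F := gen F 2

/-- The action of `∂`. -/
def D : Module.End F (SV F) := mulOp F (Polynomial.X : F[X])

variable {F} in
/-- The element `(α ∂ + β λ) v` of `F[λ] ⊗ SV`. -/
def lin (α β : F) (v : SV F) : F[X] ⊗[F] SV F :=
  1 ⊗ₜ (α • D F v) + Polynomial.X ⊗ₜ (β • v)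

/-- The `λ`-brackets of the generators:
`[L_λ L] = (∂ + 2λ) L`, `[L_λ Y] = (∂ + 3/2 λ) Y`, `[L_λ M] = (∂ + λ) M`,
`[Y_λ L] = (1/2 ∂ + 3/2 λ) Y`, `[Y_λ Y] = (∂ + 2λ) M`, `[M_λ L] = λ M`,
and all others are zero. -/
def bracketGen : Fin 3 → Fin 3 → F[X] ⊗[F] SV F
  | 0, 0 => lin 1 2 (L F)
  | 0, 1 => lin 1 (3 / 2) (Y F)
  | 0, 2 => lin 1 1 (M F)
  | 1, 0 => lin (1 / 2) (3 / 2) (Y F)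
  | 1, 1 => lin 1 2 (M F)
  | 2, 0 => lin 0 1 (M F)
  | _, _ => 0

/-- The operator `∂ + λ` on `F[λ] ⊗ SV`. -/
def shift : Module.End F (F[X] ⊗[F] SV F) := (D F).lTensor F[X] + mulOp F (Polynomial.X : F[X])

/-- The `λ`-bracket, determined by the brackets of the generators and sesquilinearity:
`[p(∂) u_λ r(∂) v] = p(-λ) r(∂ + λ) [u_λ v]`. -/
def bracket : SV F →ₗ[F] SV F →ₗ[F] F[X] ⊗[F] SV F :=
  LinearMap.mk₂ F
    (fun a b => ∑ i, ∑ j, (a i).comp (-Polynomial.X) •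
      Polynomial.aeval (shift F) (b j) (bracketGen F i j))
    (by intros; simp only [Pi.add_apply, Polynomial.add_comp, add_smul, Finset.sum_add_distrib])
    (by intros; simp only [Pi.smul_apply, Polynomial.smul_comp, smul_assoc, Finset.smul_sum])
    (by
      intros
      simp only [Pi.add_apply, map_add, LinearMap.add_apply, smul_add, Finset.sum_add_distrib])
    (by
      intro c _ _
      simp only [Pi.smul_apply, map_smul, LinearMap.smul_apply, Finset.smul_sum, smul_comm c])

theorem bracket_apply (a b : SV F) : bracket F a b = ∑ i, ∑ j, (a i).comp (-Polynomial.X) •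
      Polynomial.aeval (shift F) (b j) (bracketGen F i j) := rfl

theorem bracket_gen (i j : Fin 3) : bracket F (gen F i) (gen F j) = bracketGen F i j := by
  rw [bracket_apply, Finset.sum_eq_single i, Finset.sum_eq_single j]
  · simp [gen]
  · intro k _ hk; simp [gen, hk]
  · simp
  · intro k _ hk; simp [gen, hk]
  · simp

theorem bracket_D_left (a b : SV F) :
    bracket F (D F a) b = -((Polynomial.X : F[X]) • bracket F a b) := by
  have h2 : ∀ j, (D F a) j = Polynomial.X * a j := fun j => rfl
  have h3 : ∀ (p r : F[X]) (z : F[X] ⊗[F] SV F), (-p * r) • z = (-p) • r • z := fun p r z =>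
    mul_smul (-p) r z
  have h4 : ∀ z : F[X] ⊗[F] SV F,
    -((Polynomial.X : F[X]) • z) = (-Polynomial.X : F[X]) • z := fun z => (neg_smul _ z).symm
  rw [h4]
  simp only [bracket_apply, h2, Polynomial.mul_comp, Polynomial.X_comp, h3, Finset.smul_sum]

theorem bracket_D_right (a b : SV F) :
    bracket F a (D F b) =
      (D F).lTensor F[X] (bracket F a b) + (Polynomial.X : F[X]) • bracket F a b := by
  have h : ∀ (p : F[X]) (z : F[X] ⊗[F] SV F),
      (D F).lTensor F[X] (p • z) = p • (D F).lTensor F[X] z := by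
    intro p z
    induction z using TensorProduct.induction_on with
    | zero => simp
    | add x y hx hy => simp only [smul_add, map_add, hx, hy]
    | tmul r m => simp [TensorProduct.smul_tmul']
  have h2 : ∀ j, (D F b) j = Polynomial.X * b j := fun j => rfl
  simp only [bracket_apply, h2, map_sum, Finset.smul_sum, h, ← Finset.sum_add_distrib, map_mul,
    Polynomial.aeval_X, Module.End.mul_apply, shift, LinearMap.add_apply, smul_add, mulOp,
    Algebra.lsmul_coe]
  simp only [smul_comm (Polynomial.X : F[X])]

variable {F} in
/-- Induction on elements of the free `F[∂]`-module. -/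
theorem induction {P : SV F → Prop} (hgen : ∀ i, P (gen F i)) (hD : ∀ a, P a → P (D F a))
    (hadd : ∀ a b, P a → P b → P (a + b)) (hsmul : ∀ (c : F) a, P a → P (c • a)) (a : SV F) :
    P a := by
  have h0 : P 0 := by simpa using hsmul 0 _ (hgen 0)
  have hmon : ∀ (n : ℕ) i, P ((Polynomial.X ^ n : F[X]) • gen F i) := by
    intro n i
    induction n with
    | zero => simpa using hgen i
    | succ n ih => rw [pow_succ', mul_smul]; exact hD _ ih
  have hp : ∀ (p : F[X]) i, P (p • gen F i) := by
    intro p i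
    induction p using Polynomial.induction_on' with
    | add p r hp hr => rw [add_smul]; exact hadd _ _ hp hr
    | monomial n c =>
      rw [← Polynomial.smul_X_eq_monomial, smul_assoc]; exact hsmul _ _ (hmon n i)
  have : a = ∑ i, a i • gen F i := by
    ext i : 1
    simp [gen, Pi.single_apply, Finset.sum_apply]
  rw [this, Fin.sum_univ_three]
  exact hadd _ _ (hadd _ _ (hp _ _) (hp _ _)) (hp _ _)

theorem substOp_comp {V N : Type*} [AddCommGroup V] [Module F V] [AddCommGroup N]
    [Module F N] (T h : Module.End F N) (hT : Commute T h) (g : V →ₗ[F] N) (z : F[X] ⊗[F] V) :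
    substOp T (h ∘ₗ g) z = h (substOp T g z) := by
  induction z using TensorProduct.induction_on with
  | zero => simp
  | add x y hx hy => simp only [map_add, hx, hy]
  | tmul p v =>
    have hc : Commute (Polynomial.aeval T p : Module.End F N) h := by
      induction p using Polynomial.induction_on' with
      | add p r hp hr => rw [map_add]; exact hp.add_left hr
      | monomial n c =>
        rw [Polynomial.aeval_monomial]
        exact (Algebra.commute_algebraMap_left (A := Module.End F N) c h).mul_left (hT.pow_left n)
    rw [substOp_tmul, substOp_tmul]
    exact congrArg (fun φ : Module.End F N => φ (g v)) hc.eq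

theorem substOp_X_smul {V N : Type*} [AddCommGroup V] [Module F V] [AddCommGroup N]
    [Module F N] (T : Module.End F N) (g : V →ₗ[F] N) (z : F[X] ⊗[F] V) :
    substOp T g ((Polynomial.X : F[X]) • z) = T (substOp T g z) := by
  induction z using TensorProduct.induction_on with
  | zero => simp
  | add x y hx hy => simp only [smul_add, map_add, hx, hy]
  | tmul p v => simp [TensorProduct.smul_tmul', substOp_tmul]

theorem substOp_lTensor {V N : Type*} [AddCommGroup V] [Module F V] [AddCommGroup N]
    [Module F N] (T : Module.End F N) (g : V →ₗ[F] N) (h : Module.End F V) (z : F[X] ⊗[F] V) :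
    substOp T g (h.lTensor F[X] z) = substOp T (g ∘ₗ h) z := by
  induction z using TensorProduct.induction_on with
  | zero => simp
  | add x y hx hy => simp only [map_add, hx, hy]
  | tmul p v => simp [substOp_tmul]

theorem skew [CharZero F] (a b : SV F) : bracket F a b =
    -substOp (-mulOp F (Polynomial.X : F[X]) - (D F).lTensor F[X])
      (TensorProduct.mk F F[X] (SV F) 1) (bracket F b a) := by
  set T := -mulOp F (Polynomial.X : F[X]) - (D F).lTensor F[X] with hT
  have hD : ∀ z, substOp T (TensorProduct.mk F F[X] (SV F) 1) ((D F).lTensor F[X] z) =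
      (D F).lTensor F[X] (substOp T (TensorProduct.mk F F[X] (SV F) 1) z) := by
    intro z
    rw [substOp_lTensor, ← substOp_comp]
    · rfl
    · refine TensorProduct.ext' fun p v => ?_
      simp [hT, mulOp, TensorProduct.smul_tmul']
  induction a using induction with
  | hadd a c ha hc => simp only [map_add, LinearMap.add_apply, ha, hc, neg_add]
  | hsmul c a ha => simp only [map_smul, LinearMap.smul_apply, ha, smul_neg]
  | hD a ha =>
    rw [bracket_D_left, bracket_D_right, map_add, hD, substOp_X_smul, ha, hT]
    simp [mulOp]
  | hgen i =>
    induction b using induction with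
    | hadd a c ha hc => simp only [map_add, LinearMap.add_apply, ha, hc, neg_add]
    | hsmul c a ha => simp only [map_smul, LinearMap.smul_apply, ha, smul_neg]
    | hD a ha =>
      rw [bracket_D_left, bracket_D_right, map_neg, substOp_X_smul, ha, hT]
      simp [mulOp]
      abel
    | hgen j =>
      rw [bracket_gen, bracket_gen]
      have hlin : ∀ (x y : F) (v : SV F),
          -substOp T (TensorProduct.mk F F[X] (SV F) 1) (lin x y v) = lin (y - x) y v := by
        intro x y v
        have h2 : (Polynomial.X : F[X]) • ((1 : F[X]) ⊗ₜ[F] v) = Polynomial.X ⊗ₜ v := by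
          simp [TensorProduct.smul_tmul']
        simp only [lin, TensorProduct.tmul_smul, map_add, map_smul, substOp_tmul, map_one,
          Polynomial.aeval_X, Module.End.one_apply, TensorProduct.mk_apply, hT, LinearMap.sub_apply,
          LinearMap.neg_apply, mulOp, Algebra.lsmul_coe, LinearMap.lTensor_tmul, h2]
        module
      fin_cases i <;> fin_cases j <;> simp only [bracketGen, hlin, map_zero, neg_zero,
        Fin.zero_eta, Fin.mk_one, Fin.reduceFinMk] <;> norm_num

set_option maxHeartbeats 1600000 in
theorem jacobi [CharZero F] (a b c : SV F) :
    actAt (bracket F) (.X 0 : MvPolynomial (Fin 2) F) a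
        (actAt (bracket F) (.X 1) b (PolyMod.tmul 1 c)) =
      substOp (mulOp F (.X 0 : MvPolynomial (Fin 2) F))
        ((actAt (bracket F) (.X 0 + .X 1)).flip (PolyMod.tmul 1 c)) (bracket F a b) +
      actAt (bracket F) (.X 1) b (actAt (bracket F) (.X 0) a (PolyMod.tmul 1 c)) := by
  have hs : ∀ (t : MvPolynomial (Fin 2) F) z,
      substVar t ((Polynomial.X : F[X]) • z) = t • substVar (M := SV F) t z := by
    intro t z
    induction z using TensorProduct.induction_on with
    | zero => simp
    | add x y hx hy => simp only [smul_add, map_add, hx, hy]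
    | tmul p v => simp [TensorProduct.smul_tmul']
  have hsD : ∀ (t : MvPolynomial (Fin 2) F) (z : F[X] ⊗[F] SV F),
      substVar t ((D F).lTensor F[X] z) = mapCoeff _ (D F) (substVar t z) := by
    intro t z
    induction z using TensorProduct.induction_on with
    | zero => simp
    | add x y hx hy => simp only [map_add, hx, hy]
    | tmul p v => simp
  have hm : ∀ (t : MvPolynomial (Fin 2) F) (z : PolyMod (Fin 2) F (SV F)),
      mapCoeff _ (D F) (t • z) = t • mapCoeff _ (D F) z := by
    intro t z
    induction z using PolyMod.induction_on with
    | zero => simp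
    | add x y hx hy => simp only [smul_add, map_add, hx, hy]
    | tmul p v => simp
  have hl : ∀ (t : MvPolynomial (Fin 2) F) a z,
      actAt (bracket F) t (D F a) z = -(t • actAt (bracket F) t a z) := by
    intro t a z
    induction z using PolyMod.induction_on with
    | zero => simp
    | add x y hx hy => simp only [smul_add, map_add, hx, hy, neg_add]
    | tmul p v => simp [bracket_D_left, hs, smul_comm t]
  have hr : ∀ (t : MvPolynomial (Fin 2) F) a z,
      actAt (bracket F) t a (mapCoeff _ (D F) z) =
        mapCoeff _ (D F) (actAt (bracket F) t a z) + t • actAt (bracket F) t a z := by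
    intro t a z
    induction z using PolyMod.induction_on with
    | zero => simp
    | add x y hx hy => simp only [smul_add, map_add, hx, hy]; abel
    | tmul p v => simp [bracket_D_right, hs, hsD, hm, smul_comm t]
  have hp : ∀ (t s : MvPolynomial (Fin 2) F) a z,
      actAt (bracket F) t a (s • z) = s • actAt (bracket F) t a z := by
    intro t s a z
    induction z using PolyMod.induction_on with
    | zero => simp
    | add x y hx hy => simp only [smul_add, map_add, hx, hy]
    | tmul p v => simp [mul_smul]
  have hadd : ∀ v w : SV F, PolyMod.tmul (1 : MvPolynomial (Fin 2) F) (v + w) =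
      PolyMod.tmul 1 v + PolyMod.tmul 1 w := fun v w => TensorProduct.tmul_add _ _ _
  have hsm : ∀ (r : F) (v : SV F), PolyMod.tmul (1 : MvPolynomial (Fin 2) F) (r • v) =
      r • PolyMod.tmul 1 v := fun r v => TensorProduct.tmul_smul _ _ _
  have hcomm : ∀ s t : MvPolynomial (Fin 2) F,
      Commute (mulOp F s : Module.End F (PolyMod (Fin 2) F (SV F))) (mulOp F t) := by
    intro s t
    refine LinearMap.ext fun z => ?_
    exact smul_comm s t z
  have hcommD : ∀ s : MvPolynomial (Fin 2) F,
      Commute (mulOp F s : Module.End F (PolyMod (Fin 2) F (SV F))) (mapCoeff _ (D F)) := by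
    intro s
    refine LinearMap.ext fun z => ?_
    exact (hm s z).symm
  induction a using induction with
  | hadd a d ha hd => simp only [map_add, LinearMap.add_apply, ha, hd]; abel
  | hsmul r a ha => simp only [map_smul, LinearMap.smul_apply, ha, smul_add]
  | hD a ha =>
    rw [hl, ha, hl, bracket_D_left, map_neg, substOp_X_smul, map_neg, hp, smul_add, neg_add]
    rfl
  | hgen i =>
  induction b using induction with
  | hadd a d ha hd => simp only [map_add, LinearMap.add_apply, ha, hd]; abel
  | hsmul r a ha => simp only [map_smul, LinearMap.smul_apply, ha, smul_add]
  | hD b hb =>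
    have e : ((actAt (bracket F) (.X 0 + .X 1 : MvPolynomial (Fin 2) F)).flip
        (PolyMod.tmul 1 c)) ∘ₗ D F = mulOp F (-(.X 0 + .X 1) : MvPolynomial (Fin 2) F) ∘ₗ
          (actAt (bracket F) (.X 0 + .X 1)).flip (PolyMod.tmul 1 c) := by
      refine LinearMap.ext fun v => ?_
      simp only [LinearMap.comp_apply, LinearMap.flip_apply, hl, mulOp, Algebra.lsmul_coe, neg_smul]
    rw [hl, map_neg, hp, hb, hl, bracket_D_right, map_add, substOp_X_smul, substOp_lTensor, e,
      substOp_comp _ _ _ (hcomm _ _)]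
    simp only [mulOp, Algebra.lsmul_coe]
    module
  | hgen j =>
  induction c using induction with
  | hadd a d ha hd =>
    simp only [hadd, map_add, LinearMap.add_apply, ha, hd, substOp_add]; abel
  | hsmul r a ha =>
    simp only [hsm, map_smul, LinearMap.smul_apply, ha, smul_add, substOp_smul]
  | hD c hc =>
    have e : ((actAt (bracket F) (.X 0 + .X 1 : MvPolynomial (Fin 2) F)).flip
        (mapCoeff _ (D F) (PolyMod.tmul 1 c))) =
        (mapCoeff _ (D F) + mulOp F (.X 0 + .X 1 : MvPolynomial (Fin 2) F)) ∘ₗ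
          (actAt (bracket F) (.X 0 + .X 1)).flip (PolyMod.tmul 1 c) := by
      refine LinearMap.ext fun v => ?_
      simp only [LinearMap.comp_apply, LinearMap.flip_apply, LinearMap.add_apply, hr, mulOp,
        Algebra.lsmul_coe]
    rw [← mapCoeff_tmul]
    simp only [hr, map_add, hp, hc]
    rw [e, substOp_comp _ _ _ ((hcommD _).add_right (hcomm _ _))]
    simp only [mulOp, Algebra.lsmul_coe, map_add, LinearMap.add_apply]
    module
  | hgen k =>
    have hC : ∀ (r : F) (z : PolyMod (Fin 2) F (SV F)),
        r • z = (MvPolynomial.C r : MvPolynomial (Fin 2) F) • z :=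
      fun r z => (algebraMap_smul (MvPolynomial (Fin 2) F) r z).symm
    obtain ⟨h, hh⟩ : ∃ h : MvPolynomial (Fin 2) F, h = .C (1 / 2) := ⟨_, rfl⟩
    have h2 : 2 * h = 1 := by
      rw [hh, ← map_ofNat (MvPolynomial.C : F →+* MvPolynomial (Fin 2) F), ← map_mul]
      norm_num
    have h3 : (MvPolynomial.C (3 / 2) : MvPolynomial (Fin 2) F) = 3 * h := by
      rw [hh, ← map_ofNat (MvPolynomial.C : F →+* MvPolynomial (Fin 2) F), ← map_mul]
      norm_num
    have hlin : ∀ (t : MvPolynomial (Fin 2) F) (x y : F) v, substVar t (lin x y v) =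
        (.C x : MvPolynomial (Fin 2) F) • mapCoeff _ (D F) (PolyMod.tmul 1 v) +
          (.C y * t : MvPolynomial (Fin 2) F) • PolyMod.tmul 1 v := by
      intro t x y v
      simp only [lin, map_add, substVar_tmul, map_one, Polynomial.aeval_X, mul_smul, mapCoeff_tmul]
      rw [← hC, ← hC]
      congr 1
      · exact hsm x _
      · rw [smul_tmul, mul_one]
        exact TensorProduct.tmul_smul y t v
    have hsub : ∀ (x y : F) v (g : SV F →ₗ[F] PolyMod (Fin 2) F (SV F)),
        substOp (mulOp F (.X 0 : MvPolynomial (Fin 2) F)) g (lin x y v) =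
          (.C x : MvPolynomial (Fin 2) F) • g (D F v) +
            (.C y * .X 0 : MvPolynomial (Fin 2) F) • g v := by
      intro x y v g
      simp only [lin, map_add, substOp_tmul, map_one, Polynomial.aeval_X, map_smul, hC, mul_smul,
        Module.End.one_apply, mulOp, Algebra.lsmul_coe]
      rw [smul_comm (MvPolynomial.X 0 : MvPolynomial (Fin 2) F)]
    have hbase : ∀ (t : MvPolynomial (Fin 2) F) i j,
        actAt (bracket F) t (gen F i) (PolyMod.tmul 1 (gen F j)) =
          substVar t (bracketGen F i j) := by
      intro t i j
      rw [actAt_tmul, one_smul, bracket_gen]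
    rw [bracket_gen, hbase, hbase]
    generalize (MvPolynomial.X 0 : MvPolynomial (Fin 2) F) = x at *
    generalize (MvPolynomial.X 1 : MvPolynomial (Fin 2) F) = y at *
    fin_cases i <;> fin_cases j <;> fin_cases k <;>
      simp only [bracketGen, hlin, hsub, map_zero, LinearMap.flip_apply, hl, hr, hp, hm, map_add, hbase,
        Fin.zero_eta, Fin.mk_one, Fin.reduceFinMk, L, Y, M, zero_add, add_zero, ← hh, h3, map_one,
        map_ofNat, smul_zero, neg_zero, zero_smul] <;>
      clear hbase hsub hlin hh h3 hC hcommD hcomm hsm hadd hp hr hl hm hsD hs <;>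
      generalize PolyMod.tmul (1 : MvPolynomial (Fin 2) F) (gen F 0) = u <;>
      generalize PolyMod.tmul (1 : MvPolynomial (Fin 2) F) (gen F 1) = v <;>
      generalize PolyMod.tmul (1 : MvPolynomial (Fin 2) F) (gen F 2) = w <;>
      generalize mapCoeff (Fin 2) (D F) = δ <;>
      match_scalars <;> grind

/-- The cochain `f` has the values `v` on the tuples of generators: as `f` is conformally
antilinear and skew-symmetric, it is determined by its values on the tuples of generators that are
ordered as `L, …, L, Y, …, Y, M, …, M`. -/
def HasValues {q : ℕ} (f : ConformalModule.Maps F (SV F) (SV F) q)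
    (v : (Fin q → Fin 3) → PolyMod (Fin q) F (SV F)) : Prop :=
  ∀ g : Fin q → Fin 3, Monotone g → f (fun i => gen F (g i)) = v g

/-- The space of cocycles `Z` modulo coboundaries `B` has a basis consisting of the classes of the
cocycles with the values `v 0, …, v (n - 1)` on generators. -/
def HasBasis {q n : ℕ} (Z B : Submodule F (ConformalModule.Maps F (SV F) (SV F) q))
    (v : Fin n → (Fin q → Fin 3) → PolyMod (Fin q) F (SV F)) : Prop :=
  ∃ f : Fin n → Z, (∀ i, HasValues F (f i : ConformalModule.Maps F (SV F) (SV F) q) (v i)) ∧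
    ∃ b : Module.Basis (Fin n) F (Z ⧸ B.submoduleOf Z), ∀ i, b i = Submodule.Quotient.mk (f i)

/-- `M`, as a cochain of degree `0` -/
def f01 : (Fin 0 → Fin 3) → PolyMod (Fin 0) F (SV F) :=
  fun _ => tmul 1 (M F)

/-- `L ↦ M` -/
def f11 : (Fin 1 → Fin 3) → PolyMod (Fin 1) F (SV F) :=
  fun g => if g = ![0] then tmul 1 (M F) else 0

/-- `Y ↦ Y / 2`, `M ↦ M` -/
def f12 : (Fin 1 → Fin 3) → PolyMod (Fin 1) F (SV F) :=
  fun g => if g = ![1] then tmul 1 ((1 / 2 : F) • Y F)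
    else if g = ![2] then tmul 1 (M F) else 0

/-- `L ↦ ∂ M` -/
def f13 : (Fin 1 → Fin 3) → PolyMod (Fin 1) F (SV F) :=
  fun g => if g = ![0] then tmul 1 (D F (M F)) else 0

/-- `L ⊗ Y ↦ Y / 2`, `L ⊗ M ↦ M` -/
def f21 : (Fin 2 → Fin 3) → PolyMod (Fin 2) F (SV F) :=
  fun g => if g = ![0, 1] then tmul 1 ((1 / 2 : F) • Y F)
    else if g = ![0, 2] then tmul 1 (M F) else 0

/-- `L ⊗ L ↦ (λ_1 - λ_2) M` -/
def f22 : (Fin 2 → Fin 3) → PolyMod (Fin 2) F (SV F) :=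
  fun g => if g = ![0, 0] then tmul (.X 0 - .X 1) (M F) else 0

/-- `L ⊗ Y ↦ (∂ + λ_2) Y / 2`, `L ⊗ M ↦ (∂ + λ_2) M` -/
def f23 : (Fin 2 → Fin 3) → PolyMod (Fin 2) F (SV F) :=
  fun g => if g = ![0, 1] then
      tmul 1 ((1 / 2 : F) • D F (Y F)) + tmul (.X 1) ((1 / 2 : F) • Y F)
    else if g = ![0, 2] then tmul 1 (D F (M F)) + tmul (.X 1) (M F) else 0

/-- `L ⊗ L ⊗ Y ↦ (λ_1 - λ_2) Y / 2`, `L ⊗ L ⊗ M ↦ (λ_1 - λ_2) M` -/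
def f31 : (Fin 3 → Fin 3) → PolyMod (Fin 3) F (SV F) :=
  fun g => if g = ![0, 0, 1] then tmul (.X 0 - .X 1) ((1 / 2 : F) • Y F)
    else if g = ![0, 0, 2] then tmul (.X 0 - .X 1) (M F) else 0

variable [CharZero F]

/-- The Schrödinger–Virasoro conformal algebra. -/
def algebra : LieConformalAlgebra F (SV F) where
  D := D F
  bracket := bracket F
  bracket_D_left := bracket_D_left F
  bracket_D_right := bracket_D_right F
  skew := skew F
  jacobi := jacobi F

/-- The adjoint module of the Schrödinger–Virasoro conformal algebra. -/
abbrev adjointModule : ConformalModule (algebra F) (SV F) := (algebra F).adjoint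

end SchrodingerVirasoro

end

/-! ### Lie algebra cochains as nested linear maps -/

-- The proof replaces conformal cochains by ordinary Lie algebra cochains. Expand the value of a
-- conformal cochain on generators in the divided monomials `∏ λ_i ^ n_i / n_i!`. By conformal
-- antilinearity these coefficients determine the cochain. They form a skew-symmetric cochain of
-- finite support on the annihilation Lie algebra, which has the basis `L_(n)`, `Y_(n)`, `M_(n)` (`n
-- ≥ 0`), with coefficients in `SV`. This correspondence (`toCoch`, with inverse supplied by
-- `IsSesq.ext_toCoch` and `exists_cochain`) turns `d` into the Chevalley–Eilenberg differential
-- (`toCoch_d`) and `∂` into the action of `L_(0)` (`toCoch_partialOp`). With divided powers,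
-- substituting `λ_k + λ_l` for a variable merely adds exponents, so no binomial coefficients occur.
--
-- Write `ι_x` for insertion of `x`. Cartan's formula `ι_x d + d ι_x = x` then does most of the
-- work. For `x = L_(1)`, which acts diagonally by conformal weight, it shows that a cocycle is
-- cohomologous to its component of weight zero (`cocycle_sub_weightZero`). In doubled weights,
-- `L_(0)`, `Y_(0)`, `L_(1)`, `M_(0)`, `Y_(1)` have weights `-2, -1, 0, 0, 1`, every other basis
-- vector has weight at least `2`, and an element of `SV` has weight at least `2`. Weight zero
-- therefore forces the arguments, which are distinct by skew-symmetry, to have total weight `-2`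
-- (value a multiple of `M`) or `-3` (value a multiple of `Y`), and to lie among these five vectors.
-- This leaves spaces of dimension `1, 3, 4, 3, 1` in degrees `1` to `5` and zero elsewhere. The
-- differentials between them have ranks `0, 1, 2, 1` (`diff_one` to `diff_four`), so the basic
-- cohomology has dimensions `1, 2, 1, 0, 0`.
--
-- For the reduced complex, Cartan's formula is used with `x = L_(0)`: the action of `∂` is
-- homotopic to zero, and it is injective on cochains (`L_zero_lie_injective`). The long exact
-- sequence of `0 → C → C → C/∂C → 0` then splits into short ones, and the reduced cohomology in
-- degree `q` is the basic cohomology in degree `q` plus that in degree `q + 1`, the latter embedded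
-- by insertion of `L_(0)` (`isBasisMod_reduced`). The listed representatives are these classes,
-- with `f_13` and `f_23` adjusted by `∂ f_11` and `∂ f_21`.

universe u

/-- A bundled Lie module. -/
structure BundledLieModule (F 𝔤 : Type u) [Field F] [LieRing 𝔤] [LieAlgebra F 𝔤] where
  carrier : Type u
  [addCommGroup : AddCommGroup carrier]
  [module : Module F carrier]
  [lieRingModule : LieRingModule 𝔤 carrier]
  [lieModule : LieModule F 𝔤 carrier]

namespace LieCochain

attribute [instance] BundledLieModule.addCommGroup BundledLieModule.module
  BundledLieModule.lieRingModule BundledLieModule.lieModule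

section

variable (F 𝔤 M : Type u) [Field F] [LieRing 𝔤] [LieAlgebra F 𝔤] [AddCommGroup M] [Module F M]
  [LieRingModule 𝔤 M] [LieModule F 𝔤 M]

/-- The Lie modules `M`, `Hom(𝔤, M)`, `Hom(𝔤, Hom(𝔤, M))`, … -/
def bundled : ℕ → BundledLieModule F 𝔤
  | 0 => ⟨M⟩
  | q + 1 => ⟨𝔤 →ₗ[F] (bundled q).carrier⟩

/-- Multilinear maps `𝔤 ^ q → M`, in curried form. -/
def Coch (q : ℕ) : Type u := (bundled F 𝔤 M q).carrier

/-- The type and its Lie module structure depend on each other in the recursion, since the linear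
maps into degree `q` need the structure there. Hence they are produced together in bundled form and
separated only here. -/
instance (q : ℕ) : AddCommGroup (Coch F 𝔤 M q) := (bundled F 𝔤 M q).addCommGroup
instance (q : ℕ) : Module F (Coch F 𝔤 M q) := (bundled F 𝔤 M q).module
instance (q : ℕ) : LieRingModule 𝔤 (Coch F 𝔤 M q) := (bundled F 𝔤 M q).lieRingModule
instance (q : ℕ) : LieModule F 𝔤 (Coch F 𝔤 M q) := (bundled F 𝔤 M q).lieModule

/-- Cochains of degree `0` are elements of the module. -/
def zeroEquiv : Coch F 𝔤 M 0 ≃ₗ[F] M := LinearEquiv.refl F M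

/-- Cochains of degree `q + 1` are linear maps into cochains of degree `q`. -/
def succEquiv (q : ℕ) : Coch F 𝔤 M (q + 1) ≃ₗ[F] (𝔤 →ₗ[F] Coch F 𝔤 M q) :=
  LinearEquiv.refl F (𝔤 →ₗ[F] Coch F 𝔤 M q)

end

variable {F 𝔤 M : Type u} [Field F] [LieRing 𝔤] [LieAlgebra F 𝔤] [AddCommGroup M] [Module F M]
  [LieRingModule 𝔤 M] [LieModule F 𝔤 M]

/-- Insertion of `x` as the first argument. -/
def ins {q : ℕ} (x : 𝔤) : Coch F 𝔤 M (q + 1) →ₗ[F] Coch F 𝔤 M q :=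
  LinearMap.applyₗ x ∘ₗ (succEquiv F 𝔤 M q).toLinearMap

theorem ins_add_left {q : ℕ} (x y : 𝔤) (c : Coch F 𝔤 M (q + 1)) :
    ins (x + y) c = ins x c + ins y c := map_add (succEquiv F 𝔤 M q c) x y

theorem ins_smul_left {q : ℕ} (r : F) (x : 𝔤) (c : Coch F 𝔤 M (q + 1)) :
    ins (r • x) c = r • ins x c := map_smul (succEquiv F 𝔤 M q c) r x

theorem ins_neg_left {q : ℕ} (x : 𝔤) (c : Coch F 𝔤 M (q + 1)) :
    ins (-x) c = - ins x c := map_neg (succEquiv F 𝔤 M q c) x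

theorem ins_zero_left {q : ℕ} (c : Coch F 𝔤 M (q + 1)) :
    ins (0 : 𝔤) c = 0 := map_zero (succEquiv F 𝔤 M q c)

theorem ext_ins {q : ℕ} {c e : Coch F 𝔤 M (q + 1)} (h : ∀ x : 𝔤, ins x c = ins x e) : c = e :=
  (succEquiv F 𝔤 M q).injective (LinearMap.ext h)

/-- This is the usual action on `Hom(𝔤, N)`. It holds by definition because cochains are iterated
`Hom` spaces, which is the reason for the curried form. -/
theorem ins_lie {q : ℕ} (x y : 𝔤) (c : Coch F 𝔤 M (q + 1)) :
    ins y ⁅x, c⁆ = ⁅x, ins y c⁆ - ins ⁅x, y⁆ c := rfl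

theorem zeroEquiv_lie (x : 𝔤) (c : Coch F 𝔤 M 0) :
    zeroEquiv F 𝔤 M ⁅x, c⁆ = ⁅x, zeroEquiv F 𝔤 M c⁆ := rfl

/-- The map `x ↦ ⁅x, c⁆`. -/
def actMap (q : ℕ) : Coch F 𝔤 M q →ₗ[F] Coch F 𝔤 M (q + 1) where
  toFun c := (succEquiv F 𝔤 M q).symm
    { toFun := fun x => ⁅x, c⁆
      map_add' := fun x y => add_lie x y c
      map_smul' := fun r x => smul_lie r x c }
  map_add' c e := (succEquiv F 𝔤 M q).injective (LinearMap.ext fun x => lie_add x c e)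
  map_smul' r c := (succEquiv F 𝔤 M q).injective (LinearMap.ext fun x => lie_smul r x c)

/-- The Chevalley–Eilenberg differential, defined by Cartan's formula. -/
def diff : (q : ℕ) → Coch F 𝔤 M q →ₗ[F] Coch F 𝔤 M (q + 1)
  | 0 => actMap 0
  | q + 1 => actMap (q + 1) - (succEquiv F 𝔤 M (q + 1)).symm.toLinearMap ∘ₗ
      LinearMap.compRight F (diff q) ∘ₗ (succEquiv F 𝔤 M q).toLinearMap

theorem ins_diff_zero (x : 𝔤) (c : Coch F 𝔤 M 0) : ins x (diff 0 c) = ⁅x, c⁆ := rfl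

theorem ins_diff {q : ℕ} (x : 𝔤) (c : Coch F 𝔤 M (q + 1)) :
    ins x (diff (q + 1) c) = ⁅x, c⁆ - diff q (ins x c) := rfl

/-- After insertion of `y`, Cartan's formula reduces both sides to the identity `x y - y x = [x, y]`
for the action and to equivariance one degree lower. -/
theorem diff_lie {q : ℕ} (x : 𝔤) (c : Coch F 𝔤 M q) : diff q ⁅x, c⁆ = ⁅x, diff q c⁆ := by
  induction q with
  | zero =>
    refine ext_ins fun y => ?_
    rw [ins_lie, ins_diff_zero, ins_diff_zero, ins_diff_zero, leibniz_lie x y, lie_lie]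
    abel
  | succ q ih =>
    refine ext_ins fun y => ?_
    rw [ins_lie, ins_diff, ins_diff, ins_diff, ins_lie, map_sub, ih, lie_sub, leibniz_lie x y]
    abel

/-- By Cartan's formula twice, `ι_x d d = x d - d x + d d ι_x`. The first two terms cancel by
equivariance, the last by induction. -/
theorem diff_diff {q : ℕ} (c : Coch F 𝔤 M q) : diff (q + 1) (diff q c) = 0 := by
  induction q with
  | zero =>
    refine ext_ins fun y => ?_
    rw [ins_diff, ins_diff_zero, diff_lie, sub_self, map_zero]
  | succ q ih =>
    refine ext_ins fun y => ?_
    rw [ins_diff, ins_diff, map_sub, ih, diff_lie, sub_zero, sub_self, map_zero]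

/-- Skew-symmetry, for cochains in curried form. -/
def IsSkew : (q : ℕ) → Coch F 𝔤 M q → Prop
  | 0 => fun _ => True
  | 1 => fun _ => True
  | q + 2 => fun c => (∀ x y : 𝔤, ins y (ins x c) = - ins x (ins y c)) ∧
      ∀ x : 𝔤, IsSkew (q + 1) (ins x c)

theorem IsSkew.insert {q : ℕ} {c : Coch F 𝔤 M (q + 1)} (hc : IsSkew (q + 1) c) (x : 𝔤) :
    IsSkew q (ins x c) := by
  cases q with
  | zero => trivial
  | succ q => exact hc.2 x

theorem IsSkew.sub {q : ℕ} {c e : Coch F 𝔤 M q} (hc : IsSkew q c) (he : IsSkew q e) :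
    IsSkew q (c - e) := by
  induction q with
  | zero => trivial
  | succ q ih =>
    cases q with
    | zero => trivial
    | succ q =>
      refine ⟨fun x y => ?_, fun x => ?_⟩
      · simp only [map_sub, hc.1 x y, he.1 x y]; abel
      · rw [map_sub]; exact ih (hc.2 x) (he.2 x)

theorem IsSkew.smul {q : ℕ} {c : Coch F 𝔤 M q} (hc : IsSkew q c) (r : F) :
    IsSkew q (r • c) := by
  induction q with
  | zero => trivial
  | succ q ih =>
    cases q with
    | zero => trivial
    | succ q =>
      refine ⟨fun x y => ?_, fun x => ?_⟩
      · simp only [map_smul, hc.1 x y, smul_neg]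
      · rw [map_smul]; exact ih (hc.2 x)

theorem IsSkew.lie {q : ℕ} {c : Coch F 𝔤 M q} (hc : IsSkew q c) (x : 𝔤) :
    IsSkew q ⁅x, c⁆ := by
  induction q with
  | zero => trivial
  | succ q ih =>
    cases q with
    | zero => trivial
    | succ q =>
      refine ⟨fun y z => ?_, fun y => ?_⟩
      · simp only [ins_lie, map_sub, hc.1 y z, hc.1 y ⁅x, z⁆, hc.1 ⁅x, y⁆ z, lie_neg]; abel
      · rw [ins_lie]; exact (ih (hc.2 y)).sub (hc.2 _)

theorem IsSkew.differential {q : ℕ} {c : Coch F 𝔤 M q} (hc : IsSkew q c) :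
    IsSkew (q + 1) (diff q c) := by
  induction q with
  | zero => trivial
  | succ q ih =>
    refine ⟨fun x y => ?_, fun x => ?_⟩
    · cases q with
      | zero =>
        simp only [ins_diff, ins_diff_zero, map_sub, ins_lie]
        rw [← lie_skew x y, ins_neg_left]; abel
      | succ q =>
        simp only [ins_diff, map_sub, ins_lie]
        rw [← lie_skew x y, ins_neg_left, hc.1 x y, map_neg]; abel
    · rw [ins_diff]; exact (hc.lie x).sub (ih (hc.insert x))

/-- The multilinear map that corresponds to a cochain. -/
def ev : (q : ℕ) → Coch F 𝔤 M q →ₗ[F] MultilinearMap F (fun _ : Fin q => 𝔤) M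
  | 0 => (MultilinearMap.constLinearEquivOfIsEmpty (R := F) (S := F)
      (M₁ := fun _ : Fin 0 => 𝔤) (M₂ := M)).toLinearMap ∘ₗ
      (zeroEquiv F 𝔤 M).toLinearMap
  | q + 1 => (multilinearCurryLeftEquiv F (fun _ : Fin (q + 1) => 𝔤) M).symm.toLinearMap ∘ₗ
      LinearMap.compRight F (ev q) ∘ₗ (succEquiv F 𝔤 M q).toLinearMap

theorem ev_zero (c : Coch F 𝔤 M 0) (y : Fin 0 → 𝔤) : ev 0 c y = zeroEquiv F 𝔤 M c := rfl

theorem ev_succ {q : ℕ} (c : Coch F 𝔤 M (q + 1)) (y : Fin (q + 1) → 𝔤) :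
    ev (q + 1) c y = ev q (ins (y 0) c) (fun i => y i.succ) := rfl

theorem ev_cons {q : ℕ} (c : Coch F 𝔤 M (q + 1)) (x : 𝔤) (y : Fin q → 𝔤) :
    ev (q + 1) c (Fin.cons x y : Fin (q + 1) → 𝔤) = ev q (ins x c) y := by
  rw [ev_succ]; simp

theorem ev_lie {q : ℕ} (x : 𝔤) (c : Coch F 𝔤 M q) (y : Fin q → 𝔤) :
    ev q ⁅x, c⁆ y = ⁅x, ev q c y⁆ - ∑ i, ev q c (Function.update y i ⁅x, y i⁆) := by
  induction q with
  | zero => simp [ev_zero, zeroEquiv_lie]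
  | succ q ih =>
    rw [ev_succ, ins_lie, map_sub, sub_apply, ih, Fin.sum_univ_succ, ev_succ]
    have h0 : ev (q + 1) c (Function.update y 0 ⁅x, y 0⁆) =
        ev q (ins ⁅x, y 0⁆ c) fun i => y i.succ := by
      rw [ev_succ]; simp
    have h1 : ∀ i : Fin q, ev (q + 1) c (Function.update y i.succ ⁅x, y i.succ⁆) =
        ev q (ins (y 0) c) (Function.update (fun i => y i.succ) i ⁅x, y i.succ⁆) := by
      intro i
      rw [ev_succ]
      congr 1
      funext j
      by_cases hj : j = i
      · subst hj; simp
      · simp [hj]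
    rw [h0, Finset.sum_congr rfl fun i _ => h1 i]
    abel

/-- The argument in position `i` passes `i` others on its way to the front. -/
theorem IsSkew.ev_insertNth {q : ℕ} {c : Coch F 𝔤 M (q + 1)} (hc : IsSkew (q + 1) c)
    (i : Fin (q + 1)) (z : 𝔤) (y : Fin q → 𝔤) :
    ev (q + 1) c (i.insertNth z y : Fin (q + 1) → 𝔤) = (-1 : F) ^ (i : ℕ) • ev q (ins z c) y := by
  induction q with
  | zero =>
    obtain rfl : i = 0 := Fin.fin_one_eq_zero i
    simp [ev_cons]
  | succ q ih =>
    refine Fin.cases ?_ (fun i => ?_) i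
    · simp [ev_cons]
    · have h : (i.succ.insertNth z y : Fin (q + 2) → 𝔤) =
          Fin.cons (y 0) (i.insertNth z (fun j => y j.succ) : Fin (q + 1) → 𝔤) := by
        rw [Fin.insertNth_eq_iff]
        refine ⟨by simp, ?_⟩
        funext j
        refine Fin.cases ?_ (fun j => ?_) j
        · simp [Fin.removeNth]
        · simp [Fin.removeNth]
      rw [h, ev_cons, ih (hc.insert _), ev_succ, hc.1 z (y 0), Fin.val_succ, pow_succ]
      simp

theorem IsSkew.ev_update {q : ℕ} {c : Coch F 𝔤 M (q + 1)} (hc : IsSkew (q + 1) c)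
    (i : Fin (q + 1)) (z : 𝔤) (y : Fin (q + 1) → 𝔤) :
    ev (q + 1) c (Function.update y i z) =
      (-1 : F) ^ (i : ℕ) • ev q (ins z c) (fun j => y (i.succAbove j)) := by
  rw [← hc.ev_insertNth]
  congr 1
  rw [eq_comm, Fin.insertNth_eq_iff]
  refine ⟨by simp, ?_⟩
  funext j
  simp [Fin.removeNth]

/-- The Chevalley–Eilenberg formula. -/
theorem IsSkew.ev_diff {q : ℕ} {c : Coch F 𝔤 M (q + 1)} (hc : IsSkew (q + 1) c)
    (y : Fin (q + 2) → 𝔤) :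
    ev (q + 2) (diff (q + 1) c) y =
      ∑ k : Fin (q + 2), (-1 : F) ^ (k : ℕ) • ⁅y k, ev (q + 1) c (fun i => y (k.succAbove i))⁆ +
      ∑ l : Fin (q + 2), ∑ k : Fin (q + 1) with k.castSucc < l,
        (-1 : F) ^ ((k : ℕ) + (l : ℕ)) • ev q (ins ⁅y (l.succAbove k), y l⁆ c)
          (fun i => y (l.succAbove (k.succAbove i))) := by
  induction q with
  | zero =>
    simp [Fin.sum_univ_succ, ev_succ, ev_zero, ins_diff, ins_diff_zero, zeroEquiv_lie,
      ins_lie, Fin.succAbove, Finset.sum_filter]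
    abel
  | succ q ih =>
    -- With `y 0` inserted, Cartan's formula splits the claim. The action of `y 0` gives the terms
    -- with `k = 0` of both sums, and the induction hypothesis for `ins (y 0) c`, subtracted, gives
    -- all the others.
    rw [ev_succ, ins_diff, map_sub, sub_apply, ev_lie, ih (hc.insert _)]
    have h1 : ∀ k : Fin (q + 2), ev (q + 2) c (fun i => y (k.succ.succAbove i)) =
        ev (q + 1) (ins (y 0) c) (fun i => y (k.succAbove i).succ) := by
      intro k; rw [ev_succ]; simp
    have h2 : ∀ (l : Fin (q + 2)) (k : Fin (q + 1)) (z : 𝔤),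
        ev (q + 1) (ins z c) (fun i => y (l.succ.succAbove (k.succ.succAbove i))) =
          - ev q (ins z (ins (y 0) c)) (fun i => y (l.succAbove (k.succAbove i)).succ) := by
      intro l k z
      rw [ev_succ, hc.1 z]
      simp
    have h3 : ∀ (k : Fin (q + 1)) (l : Fin (q + 2)), k.succ.castSucc < l.succ ↔ k.castSucc < l :=
      fun k l => by simp [Fin.lt_def]
    have h4 : (∑ k : Fin (q + 2), (-1 : F) ^ ((k.succ : Fin (q + 3)) : ℕ) •
          ⁅y k.succ, ev (q + 2) c (fun i => y (k.succ.succAbove i))⁆) =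
        - ∑ k : Fin (q + 2), (-1 : F) ^ (k : ℕ) •
          ⁅y k.succ, ev (q + 1) (ins (y 0) c) (fun i => y (k.succAbove i).succ)⁆ := by
      rw [← Finset.sum_neg_distrib]
      refine Finset.sum_congr rfl fun k _ => ?_
      rw [h1, Fin.val_succ, pow_succ]
      simp
    -- The summand `k = 0` brackets `y 0` with `y l.succ`. In the others the bracket has to pass `y
    -- 0`, which accounts for the minus sign.
    have h5 : ∀ l : Fin (q + 2), (∑ k : Fin (q + 2) with k.castSucc < l.succ,
        (-1 : F) ^ ((k : ℕ) + (l.succ : Fin (q + 3)).val) •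
          ev (q + 1) (ins ⁅y (l.succ.succAbove k), y l.succ⁆ c)
            (fun i => y (l.succ.succAbove (k.succAbove i)))) =
        - ev (q + 2) c (Function.update (fun i => y i.succ) l ⁅y 0, y l.succ⁆) -
        ∑ k : Fin (q + 1) with k.castSucc < l, (-1 : F) ^ ((k : ℕ) + (l : ℕ)) •
          ev q (ins ⁅y (l.succAbove k).succ, y l.succ⁆ (ins (y 0) c))
            (fun i => y (l.succAbove (k.succAbove i)).succ) := by
      intro l
      rw [Finset.sum_filter, Finset.sum_filter, Fin.sum_univ_succ, hc.ev_update, sub_eq_add_neg,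
        ← Finset.sum_neg_distrib]
      congr 1
      · simp [pow_succ]
      · refine Finset.sum_congr rfl fun k _ => ?_
        simp only [h3, h2]
        split_ifs
        · rw [Fin.val_succ, Fin.val_succ, show (k : ℕ) + 1 + (l + 1) = k + l + 2 by ring, pow_add]
          simp
        · simp
    refine Eq.trans ?_ (congrArg₂ (· + ·) (Fin.sum_univ_succ (n := q + 2) _)
      (Fin.sum_univ_succ (n := q + 2) _)).symm
    rw [h4, Finset.sum_congr rfl fun l _ => h5 l, Finset.sum_sub_distrib, Finset.sum_neg_distrib]
    simp
    abel

end LieCochain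

/-! ### Cochains through their values on a basis; skew-symmetry as behaviour under permutations -/

noncomputable section

namespace LieCochain

variable {F 𝔤 M : Type u} [Field F] [LieRing 𝔤] [LieAlgebra F 𝔤] [AddCommGroup M] [Module F M]
  [LieRingModule 𝔤 M] [LieModule F 𝔤 M] {ι : Type*} (b : Module.Basis ι F 𝔤)

theorem basis_induction {P : 𝔤 → Prop} (zero : P 0) (basis : ∀ i, P (b i))
    (add : ∀ x y, P x → P y → P (x + y)) (smul : ∀ (r : F) x, P x → P (r • x)) (x : 𝔤) : P x :=
  Submodule.span_induction (p := fun x _ => P x) (by rintro _ ⟨i, rfl⟩; exact basis i) zero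
    (fun x y _ _ => add x y) (fun r x _ => smul r x) (b.mem_span x)

/-- The values of a cochain on tuples of basis vectors. -/
def val (q : ℕ) : Coch F 𝔤 M q →ₗ[F] (Fin q → ι) → M where
  toFun c x := ev q c fun i => b (x i)
  map_add' c e := by funext x; simp
  map_smul' r c := by funext x; simp

theorem val_zero (c : Coch F 𝔤 M 0) (x : Fin 0 → ι) : val b 0 c x = zeroEquiv F 𝔤 M c := rfl

theorem val_succ {q : ℕ} (c : Coch F 𝔤 M (q + 1)) (x : Fin (q + 1) → ι) :
    val b (q + 1) c x = val b q (ins (b (x 0)) c) fun i => x i.succ := rfl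

theorem val_cons {q : ℕ} (c : Coch F 𝔤 M (q + 1)) (i : ι) (x : Fin q → ι) :
    val b (q + 1) c (Fin.cons i x : Fin (q + 1) → ι) = val b q (ins (b i) c) x := by
  rw [val_succ]; simp

theorem ext_ins_basis {q : ℕ} {c e : Coch F 𝔤 M (q + 1)}
    (h : ∀ i, ins (b i) c = ins (b i) e) : c = e :=
  (succEquiv F 𝔤 M q).injective (b.ext h)

theorem ext_val {q : ℕ} {c e : Coch F 𝔤 M q} (h : ∀ x, val b q c x = val b q e x) : c = e := by
  induction q with
  | zero => exact (zeroEquiv F 𝔤 M).injective (h Fin.elim0)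
  | succ q ih =>
    refine ext_ins_basis b fun i => ih fun x => ?_
    rw [← val_cons, h, val_cons]

/-- The cochain with given values on tuples of basis vectors. -/
def ofVal : (q : ℕ) → ((Fin q → ι) → M) → Coch F 𝔤 M q
  | 0 => fun v => (zeroEquiv F 𝔤 M).symm (v Fin.elim0)
  | q + 1 => fun v => (succEquiv F 𝔤 M q).symm
      (b.constr F fun i => ofVal q fun x => v (Fin.cons i x : Fin (q + 1) → ι))

theorem ins_ofVal {q : ℕ} (v : (Fin (q + 1) → ι) → M) (i : ι) :
    ins (b i) (ofVal b (q + 1) v) =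
      ofVal b q fun x => v (Fin.cons i x : Fin (q + 1) → ι) :=
  b.constr_basis F _ i

@[simp] theorem val_ofVal {q : ℕ} (v : (Fin q → ι) → M) : val b q (ofVal b q v) = v := by
  induction q with
  | zero => funext x; rw [val_zero, Subsingleton.elim x Fin.elim0]; rfl
  | succ q ih =>
    funext x
    rw [val_succ, ins_ofVal, ih]
    congr 1
    funext i
    refine Fin.cases ?_ (fun i => ?_) i <;> simp

/-- The recursive definition of `IsSkew` covers the swap of the first two arguments directly; any
other adjacent swap happens inside an insertion of the first argument. -/
theorem IsSkew.ev_swap {q : ℕ} {c : Coch F 𝔤 M (q + 1)} (hc : IsSkew (q + 1) c) (i : Fin q)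
    (y : Fin (q + 1) → 𝔤) :
    ev (q + 1) c (fun j => y (Equiv.swap i.castSucc i.succ j)) = - ev (q + 1) c y := by
  induction q with
  | zero => exact i.elim0
  | succ q ih =>
    refine Fin.cases ?_ (fun i => ?_) i
    · have h : ∀ j : Fin q, Equiv.swap (0 : Fin (q + 2)) 1 j.succ.succ = j.succ.succ := fun j =>
        Equiv.swap_apply_of_ne_of_ne (by simp) (by
          rw [← Fin.succ_zero_eq_one, Ne, Fin.succ_inj]; exact Fin.succ_ne_zero j)
      simp only [ev_succ, Fin.castSucc_zero, Fin.succ_zero_eq_one, Equiv.swap_apply_left,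
        Equiv.swap_apply_right, h]
      rw [hc.1 (y 1) (y 0)]
      simp
    · have h0 : Equiv.swap i.succ.castSucc i.succ.succ (0 : Fin (q + 2)) = 0 :=
        Equiv.swap_apply_of_ne_of_ne (by rw [← Fin.succ_castSucc]; exact (Fin.succ_ne_zero _).symm)
          (Fin.succ_ne_zero _).symm
      have h : ∀ j : Fin (q + 1), Equiv.swap i.succ.castSucc i.succ.succ j.succ =
          (Equiv.swap i.castSucc i.succ j).succ := by
        intro j
        rw [← Fin.succ_castSucc]
        exact ((Fin.succ_injective _).swap_apply i.castSucc i.succ j)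
      rw [ev_succ, ev_succ, h0]
      simp only [h]
      exact ih (hc.insert _) i fun j => y j.succ

/-- Adjacent transpositions generate the symmetric group as a monoid, so `ev_swap` suffices. -/
theorem IsSkew.ev_perm {q : ℕ} {c : Coch F 𝔤 M q} (hc : IsSkew q c) (σ : Equiv.Perm (Fin q))
    (y : Fin q → 𝔤) : ev q c (fun j => y (σ j)) = (σ.sign : ℤ) • ev q c y := by
  cases q with
  | zero => rw [Subsingleton.elim σ 1]; simp
  | succ q =>
    have h := Equiv.Perm.mclosure_swap_castSucc_succ q
    have hσ : σ ∈ Submonoid.closure (Set.range fun i : Fin q => Equiv.swap i.castSucc i.succ) := by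
      rw [h]; trivial
    clear h
    induction hσ using Submonoid.closure_induction generalizing y with
    | mem σ h =>
      obtain ⟨i, rfl⟩ := h
      rw [hc.ev_swap i y, Equiv.Perm.sign_swap (Fin.castSucc_lt_succ).ne]
      simp
    | one => simp
    | mul σ τ _ _ hσ hτ =>
      have h := hτ (fun j => y (σ j))
      rw [hσ] at h
      rw [Equiv.Perm.sign_mul]
      exact h.trans (by rw [smul_smul, mul_comm]; simp)

theorem isSkew_zero {q : ℕ} : IsSkew q (0 : Coch F 𝔤 M q) := by
  induction q with
  | zero => trivial
  | succ q ih =>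
    cases q with
    | zero => trivial
    | succ q => exact ⟨fun x y => by simp, fun x => by rw [map_zero]; exact ih⟩

/-- For the converse, permutations that fix the first index make every insertion skew by induction,
and the transposition of the first two indices gives the remaining condition. Bilinearity passes
from basis vectors to all arguments. -/
theorem isSkew_iff_val {q : ℕ} (c : Coch F 𝔤 M q) :
    IsSkew q c ↔ ∀ (σ : Equiv.Perm (Fin q)) (x : Fin q → ι),
      val b q c (fun j => x (σ j)) = (σ.sign : ℤ) • val b q c x := by
  refine ⟨fun hc σ x => hc.ev_perm σ fun i => b (x i), fun h => ?_⟩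
  induction q with
  | zero => trivial
  | succ q ih =>
    have h1 : ∀ x, IsSkew q (ins x c) := by
      refine basis_induction b ?_ (fun i => ih _ fun σ x => ?_) (fun x y hx hy => ?_)
        fun r x hx => ?_
      · rw [ins_zero_left]
        exact isSkew_zero
      -- `decomposeFin.symm (0, σ)` fixes `0` and acts as `σ` on the successors, with the same sign.
      · have := h (Equiv.Perm.decomposeFin.symm (0, σ)) (Fin.cons i x)
        rw [Equiv.Perm.decomposeFin.symm_sign, val_cons] at this
        rw [← val_cons]
        simp only [if_true, one_mul] at this
        rw [← this]
        congr 1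
      · rw [ins_add_left, ← sub_neg_eq_add, ← neg_one_smul F]; exact hx.sub (hy.smul _)
      · rw [ins_smul_left]; exact hx.smul r
    cases q with
    | zero => trivial
    | succ q =>
      refine ⟨fun x y => ?_, h1⟩
      set f : 𝔤 →ₗ[F] 𝔤 →ₗ[F] Coch F 𝔤 M q :=
        (succEquiv F 𝔤 M q).toLinearMap ∘ₗ succEquiv F 𝔤 M (q + 1) c with hf
      have : f = - f.flip := by
        refine LinearMap.ext_basis b b fun i j => ext_val b fun z => ?_
        have hs := h (Equiv.swap 0 1) (Fin.cons i (Fin.cons j z : Fin (q + 1) → ι))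
        have e : (fun k => (Fin.cons i (Fin.cons j z : Fin (q + 1) → ι) : Fin (q + 2) → ι)
            (Equiv.swap 0 1 k)) = Fin.cons j (Fin.cons i z : Fin (q + 1) → ι) := by
          funext k
          refine Fin.cases ?_ (fun k => ?_) k
          · rw [Equiv.swap_apply_left, ← Fin.succ_zero_eq_one, Fin.cons_succ]; rfl
          · refine Fin.cases ?_ (fun k => ?_) k
            · rw [Fin.succ_zero_eq_one, Equiv.swap_apply_right, ← Fin.succ_zero_eq_one,
                Fin.cons_succ]; rfl
            · rw [Equiv.swap_apply_of_ne_of_ne (by simp) (by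
                rw [← Fin.succ_zero_eq_one, Ne, Fin.succ_inj]; exact Fin.succ_ne_zero k)]
              simp
        rw [e, Equiv.Perm.sign_swap (by simp), val_cons, val_cons, val_cons, val_cons] at hs
        change val b q (ins (b j) (ins (b i) c)) z = val b q (- (ins (b i) (ins (b j) c))) z
        rw [map_neg, Pi.neg_apply, hs]
        simp
      exact congrArg (fun g => g x y) this

end LieCochain

end

noncomputable section

/-! ### Divided coefficients -/

namespace PolyMod

variable {F M A : Type*} [Field F] [AddCommGroup M] [Module F M] [AddCommGroup A] [Module F A]
  {q : ℕ}

/-- The coefficient of `∏ λ_i ^ n_i / n_i!` in a polynomial in the variables `λ_i`. -/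
def mvDivCoeff (n : Fin q → ℕ) : MvPolynomial (Fin q) F →ₗ[F] F :=
  (∏ i, (Nat.factorial (n i) : F)) • MvPolynomial.lcoeff F (Finsupp.equivFunOnFinite.symm n)

theorem mvDivCoeff_apply (n : Fin q → ℕ) (p : MvPolynomial (Fin q) F) :
    mvDivCoeff n p = (∏ i, (Nat.factorial (n i) : F)) * p.coeff (Finsupp.equivFunOnFinite.symm n) := rfl

/-- Lowering of one entry. -/
def lower (n : Fin q → ℕ) (i : Fin q) : Fin q → ℕ := Function.update n i (n i - 1)

theorem mvDivCoeff_C (n : Fin q → ℕ) (a : F) :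
    mvDivCoeff n (.C a : MvPolynomial (Fin q) F) = if n = 0 then a else 0 := by
  rw [mvDivCoeff_apply, MvPolynomial.coeff_C]
  by_cases h : n = 0
  · subst h
    rw [if_pos (by ext; rfl)]
    simp
  · rw [if_neg, if_neg h, mul_zero]
    intro h'
    apply h
    funext i
    exact (DFunLike.congr_fun h' i).symm

/-- Since `λ · λ ^ m / m! = (m + 1) λ ^ (m + 1) / (m + 1)!`, multiplication by a variable lowers the
exponent with a factor. For `n i = 0` the truncated subtraction in `lower` is harmless because that
factor is zero. -/
theorem mvDivCoeff_X_mul (n : Fin q → ℕ) (i : Fin q) (p : MvPolynomial (Fin q) F) :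
    mvDivCoeff n (.X i * p) = n i * mvDivCoeff (lower n i) p := by
  rw [mvDivCoeff_apply, mvDivCoeff_apply, MvPolynomial.coeff_X_mul']
  by_cases h : n i = 0
  · simp [h]
  · have h1 : (∏ j, (Nat.factorial (n j) : F)) =
        n i * ∏ j, (Nat.factorial (lower n i j) : F) := by
      rw [← Finset.mul_prod_erase _ _ (Finset.mem_univ i),
        ← Finset.mul_prod_erase _ (fun j => (Nat.factorial (lower n i j) : F)) (Finset.mem_univ i), ← mul_assoc]
      congr 1
      · simp only [lower, Function.update_self]
        rw [← Nat.cast_mul, Nat.mul_factorial_pred h]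
      · refine Finset.prod_congr rfl fun j hj => ?_
        rw [lower, Function.update_of_ne (Finset.ne_of_mem_erase hj)]
    have h2 : Finsupp.equivFunOnFinite.symm n - Finsupp.single i 1 =
        Finsupp.equivFunOnFinite.symm (lower n i) := by
      ext j
      by_cases hj : j = i
      · subst hj; simp [lower]
      · simp [lower, hj]
    rw [if_pos (by simpa using h), h1, h2, mul_assoc]

/-- The coefficient of `λ ^ n / n!` in a polynomial in `λ`. -/
def divCoeff (n : ℕ) : F[X] →ₗ[F] F := (Nat.factorial n : F) • Polynomial.lcoeff F n

theorem divCoeff_C (n : ℕ) (a : F) :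
    divCoeff n (.C a : F[X]) = if n = 0 then a else 0 := by
  change (Nat.factorial n : F) * (Polynomial.C a).coeff n = _
  rw [Polynomial.coeff_C]
  split_ifs with h <;> simp [h]

theorem divCoeff_X_mul (n : ℕ) (p : F[X]) :
    divCoeff n (Polynomial.X * p) = n * divCoeff (n - 1) p := by
  change (Nat.factorial n : F) * (Polynomial.X * p).coeff n = n * ((Nat.factorial (n - 1) : F) * p.coeff (n - 1))
  cases n with
  | zero => simp
  | succ n => simp [Nat.factorial_succ, mul_assoc]

theorem lower_comp_of_injective {Q : ℕ} (φ : Fin q → Fin Q) (hφ : Function.Injective φ)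
    (n : Fin Q → ℕ) (i : Fin q) : (fun j => lower n (φ i) (φ j)) = lower (fun j => n (φ j)) i := by
  funext j
  by_cases h : j = i
  · subst h; simp [lower]
  · simp [lower, h, hφ.ne h]

theorem lower_comp_of_ne {Q : ℕ} (φ : Fin q → Fin Q) (k : Fin Q) (hk : ∀ i, φ i ≠ k)
    (n : Fin Q → ℕ) : (fun j => lower n k (φ j)) = fun j => n (φ j) := by
  funext j
  simp [lower, hk j]

theorem lower_self {Q : ℕ} (n : Fin Q → ℕ) (k : Fin Q) : lower n k k = n k - 1 := by
  simp [lower]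

theorem lower_of_ne {Q : ℕ} (n : Fin Q → ℕ) {k l : Fin Q} (h : l ≠ k) : lower n k l = n l := by
  simp [lower, h]

/-- The two factors involve disjoint sets of variables, so the coefficient of the product is a
product of coefficients. -/
theorem mvDivCoeff_mul_aeval (n : Fin (q + 1) → ℕ) (k : Fin (q + 1)) (p : MvPolynomial (Fin q) F)
    (r : F[X]) :
    mvDivCoeff n (MvPolynomial.aeval (fun i => .X (k.succAbove i)) p *
      Polynomial.aeval (.X k : MvPolynomial (Fin (q + 1)) F) r) =
      mvDivCoeff (fun i => n (k.succAbove i)) p * divCoeff (n k) r := by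
  induction p using MvPolynomial.induction_on generalizing n with
  | add p p' hp hp' => simp only [map_add, add_mul, hp, hp']
  | mul_X p i hp =>
    rw [map_mul (MvPolynomial.aeval _), MvPolynomial.aeval_X, mul_comm _ (MvPolynomial.X _),
      mul_assoc,
      mvDivCoeff_X_mul, hp, mul_comm p, mvDivCoeff_X_mul,
      lower_comp_of_injective _ Fin.succAbove_right_injective, lower_of_ne _ (Fin.ne_succAbove k i),
      mul_assoc]
  | C a =>
    rw [MvPolynomial.aeval_C, mvDivCoeff_C, ← Algebra.smul_def, map_smul, smul_eq_mul]
    induction r using Polynomial.induction_on' generalizing n with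
    | add r r' hr hr' => rw [map_add, map_add, map_add, mul_add, mul_add, hr, hr']
    | monomial m c =>
      induction m generalizing n with
      | zero =>
        rw [Polynomial.monomial_zero_left, Polynomial.aeval_C, divCoeff_C,
          MvPolynomial.algebraMap_eq, mvDivCoeff_C]
        have : n = 0 ↔ (n k = 0 ∧ (fun i => n (k.succAbove i)) = 0) := by
          refine ⟨fun h => by subst h; exact ⟨rfl, rfl⟩, fun h => ?_⟩
          funext i
          induction i using Fin.succAboveCases k with
          | x => exact h.1
          | p i => exact congrFun h.2 i
        split_ifs <;> simp_all
      | succ m ih =>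
        rw [← Polynomial.X_mul_monomial, map_mul, Polynomial.aeval_X, mvDivCoeff_X_mul,
          divCoeff_X_mul, mul_left_comm, ih, lower_self,
          lower_comp_of_ne _ _ (fun i => Fin.succAbove_ne k i)]
        ring

theorem mvDivCoeff_perm (n : Fin q → ℕ) (σ : Equiv.Perm (Fin q)) (p : MvPolynomial (Fin q) F) :
    mvDivCoeff n (MvPolynomial.aeval (fun i => (.X (σ i) : MvPolynomial (Fin q) F)) p) =
      mvDivCoeff (fun i => n (σ i)) p := by
  induction p using MvPolynomial.induction_on generalizing n with
  | add p p' hp hp' => simp only [map_add, hp, hp']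
  | mul_X p i hp =>
    rw [map_mul, MvPolynomial.aeval_X, mul_comm _ (MvPolynomial.X _),
      mvDivCoeff_X_mul, hp, mul_comm p, mvDivCoeff_X_mul, lower_comp_of_injective _ σ.injective]
  | C a =>
    rw [MvPolynomial.aeval_C, MvPolynomial.algebraMap_eq, mvDivCoeff_C, mvDivCoeff_C]
    congr 1
    rw [eq_iff_iff]
    refine ⟨fun h => by subst h; rfl, fun h => ?_⟩
    funext i
    have := congrFun h (σ.symm i)
    simpa using this

/-- The exponents after the substitution of `λ_k + λ_l` for one variable. -/
def mergeExp (k : Fin (q + 1)) (l : Fin (q + 2)) (n : Fin (q + 2) → ℕ) : Fin (q + 1) → ℕ :=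
  Fin.cons (n (l.succAbove k) + n l) fun i => n (l.succAbove (k.succAbove i))

theorem mergeExp_lower_left (k : Fin (q + 1)) (l : Fin (q + 2)) (n : Fin (q + 2) → ℕ)
    (h : n (l.succAbove k) ≠ 0) :
    mergeExp k l (lower n (l.succAbove k)) = lower (mergeExp k l n) 0 := by
  funext j
  refine Fin.cases ?_ (fun j => ?_) j
  · rw [lower_self, mergeExp, mergeExp, Fin.cons_zero, Fin.cons_zero, lower_self,
      lower_of_ne _ (Fin.ne_succAbove l k)]
    omega
  · rw [lower_of_ne _ (Fin.succ_ne_zero j), mergeExp, mergeExp, Fin.cons_succ, Fin.cons_succ,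
      lower_of_ne]
    exact fun h => Fin.succAbove_ne k j (Fin.succAbove_right_injective h)

theorem mergeExp_lower_right (k : Fin (q + 1)) (l : Fin (q + 2)) (n : Fin (q + 2) → ℕ)
    (h : n l ≠ 0) : mergeExp k l (lower n l) = lower (mergeExp k l n) 0 := by
  funext j
  refine Fin.cases ?_ (fun j => ?_) j
  · rw [lower_self, mergeExp, mergeExp, Fin.cons_zero, Fin.cons_zero, lower_self,
      lower_of_ne _ (Fin.succAbove_ne l k)]
    omega
  · rw [lower_of_ne _ (Fin.succ_ne_zero j), mergeExp, mergeExp, Fin.cons_succ, Fin.cons_succ,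
      lower_of_ne _ (Fin.succAbove_ne l _)]

theorem mergeExp_lower_succ (k : Fin (q + 1)) (l : Fin (q + 2)) (n : Fin (q + 2) → ℕ) (i : Fin q) :
    mergeExp k l (lower n (l.succAbove (k.succAbove i))) = lower (mergeExp k l n) i.succ := by
  funext j
  refine Fin.cases ?_ (fun j => ?_) j
  · rw [lower_of_ne _ (Fin.succ_ne_zero i).symm, mergeExp, mergeExp, Fin.cons_zero, Fin.cons_zero,
      lower_of_ne _ (Fin.ne_succAbove l _), lower_of_ne]
    exact fun h => Fin.ne_succAbove k i (Fin.succAbove_right_injective h)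
  · by_cases h : j = i
    · subst h; simp [lower, mergeExp]
    · rw [lower_of_ne _ (by simpa using h), mergeExp, mergeExp, Fin.cons_succ, Fin.cons_succ,
        lower_of_ne]
      exact fun h' => h (Fin.succAbove_right_injective (Fin.succAbove_right_injective h'))

/-- The substitution of `λ_k + λ_l` for the first variable. -/
def mergeVars (F : Type*) [Field F] (k : Fin (q + 1)) (l : Fin (q + 2)) :
    Fin (q + 1) → MvPolynomial (Fin (q + 2)) F :=
  Fin.cons (.X (l.succAbove k) + .X l) fun i => .X (l.succAbove (k.succAbove i))

/-- This is the purpose of divided powers: `(λ + μ) ^ n / n!` is the sum of all `λ ^ a / a! · μ ^ b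
/ b!` with `a + b = n`, so the substitution only adds the two exponents. -/
theorem mvDivCoeff_mergeVars (k : Fin (q + 1)) (l : Fin (q + 2)) (n : Fin (q + 2) → ℕ)
    (p : MvPolynomial (Fin (q + 1)) F) :
    mvDivCoeff n (MvPolynomial.aeval (mergeVars F k l) p) = mvDivCoeff (mergeExp k l n) p := by
  induction p using MvPolynomial.induction_on generalizing n with
  | add p p' hp hp' => simp only [map_add, hp, hp']
  | mul_X p i hp =>
    rw [map_mul, MvPolynomial.aeval_X, mul_comm _ (mergeVars F k l i), mul_comm p,
      mvDivCoeff_X_mul]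
    refine Fin.cases ?_ (fun i => ?_) i
    · rw [mergeVars, Fin.cons_zero, ← mergeVars, add_mul, map_add, mvDivCoeff_X_mul,
        mvDivCoeff_X_mul, hp, hp, show mergeExp k l n 0 = n (l.succAbove k) + n l from rfl]
      -- A zero exponent cannot be lowered, but then the corresponding summand has the factor zero.
      by_cases h : n (l.succAbove k) = 0
      · by_cases h' : n l = 0
        · simp [h, h']
        · rw [mergeExp_lower_right k l n h', h]; simp
      · rw [mergeExp_lower_left k l n h]
        by_cases h' : n l = 0
        · simp [h']
        · rw [mergeExp_lower_right k l n h']; push_cast; ring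
    · rw [mergeVars, Fin.cons_succ, ← mergeVars, mvDivCoeff_X_mul, hp, mergeExp_lower_succ]
      rw [mergeExp, Fin.cons_succ]
  | C a =>
    rw [MvPolynomial.aeval_C, MvPolynomial.algebraMap_eq, mvDivCoeff_C, mvDivCoeff_C]
    congr 1
    rw [eq_iff_iff]
    refine ⟨fun h => ?_, fun h => ?_⟩
    · subst h
      funext j
      refine Fin.cases ?_ (fun j => ?_) j <;> simp [mergeExp]
    · have h0 := congrFun h 0
      simp only [mergeExp, Fin.cons_zero, Pi.zero_apply, Nat.add_eq_zero_iff] at h0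
      funext j
      induction j using Fin.succAboveCases l with
      | x => exact h0.2
      | p j =>
        induction j using Fin.succAboveCases k with
        | x => exact h0.1
        | p j => have := congrFun h j.succ; simpa [mergeExp] using this

/-- The coefficient of `∏ λ_i ^ n_i / n_i!` in an element of `M[λ_1, …, λ_q]`. -/
def dc (n : Fin q → ℕ) : PolyMod (Fin q) F M →ₗ[F] M :=
  (TensorProduct.lid F M).toLinearMap ∘ₗ (mvDivCoeff n).rTensor M

@[simp] theorem dc_tmul (n : Fin q → ℕ) (p : MvPolynomial (Fin q) F) (m : M) :
    dc n (tmul p m) = mvDivCoeff n p • m := rfl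

/-- The coefficient of `λ ^ n / n!` in an element of `M[λ]`. -/
def dc₁ (n : ℕ) : F[X] ⊗[F] M →ₗ[F] M :=
  (TensorProduct.lid F M).toLinearMap ∘ₗ (divCoeff n).rTensor M

@[simp] theorem dc₁_tmul (n : ℕ) (p : F[X]) (m : M) : dc₁ n (p ⊗ₜ[F] m) = divCoeff n p • m := rfl

theorem dc_X_smul (n : Fin q → ℕ) (i : Fin q) (z : PolyMod (Fin q) F M) :
    dc n ((.X i : MvPolynomial (Fin q) F) • z) = (n i : F) • dc (lower n i) z := by
  induction z using PolyMod.induction_on with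
  | zero => simp
  | add x y hx hy => simp only [smul_add, map_add, hx, hy]
  | tmul p m => simp [mvDivCoeff_X_mul, mul_smul]

theorem dc_mapCoeff (n : Fin q → ℕ) (g : Module.End F M) (z : PolyMod (Fin q) F M) :
    dc n (mapCoeff (Fin q) g z) = g (dc n z) := by
  induction z using PolyMod.induction_on with
  | zero => simp
  | add x y hx hy => simp only [map_add, hx, hy]
  | tmul p m => simp

theorem dc_perm (n : Fin q → ℕ) (σ : Equiv.Perm (Fin q)) (z : PolyMod (Fin q) F M) :
    dc n (substVars M (fun i => (.X (σ i) : MvPolynomial (Fin q) F)) z) =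
      dc (fun i => n (σ i)) z := by
  induction z using PolyMod.induction_on with
  | zero => simp
  | add x y hx hy => simp only [map_add, hx, hy]
  | tmul p m => rw [substVars_tmul, dc_tmul, mvDivCoeff_perm, dc_tmul]

theorem dc_mergeVars (k : Fin (q + 1)) (l : Fin (q + 2)) (n : Fin (q + 2) → ℕ)
    (z : PolyMod (Fin (q + 1)) F M) :
    dc n (substVars M (mergeVars F k l) z) = dc (mergeExp k l n) z := by
  induction z using PolyMod.induction_on with
  | zero => simp
  | add x y hx hy => simp only [map_add, hx, hy]
  | tmul p m => rw [substVars_tmul, dc_tmul, mvDivCoeff_mergeVars, dc_tmul]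

theorem dc_actAt (act : A →ₗ[F] M →ₗ[F] F[X] ⊗[F] M) (n : Fin (q + 1) → ℕ) (k : Fin (q + 1)) (a : A)
    (z : PolyMod (Fin q) F M) :
    dc n (actAt act (.X k) a (substVars M (fun i => .X (k.succAbove i)) z)) =
      dc₁ (n k) (act a (dc (fun i => n (k.succAbove i)) z)) := by
  induction z using PolyMod.induction_on with
  | zero => simp
  | add x y hx hy => simp only [map_add, hx, hy]
  | tmul p m =>
    rw [substVars_tmul, actAt_tmul, dc_tmul, map_smul (act a), map_smul (dc₁ _)]
    induction act a m using TensorProduct.induction_on with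
    | zero => simp only [map_zero, smul_zero]
    | add x y hx hy => simp only [map_add, smul_add, map_add (dc n), hx, hy]
    | tmul r v =>
      rw [substVar_tmul, smul_tmul, dc_tmul, mvDivCoeff_mul_aeval, dc₁_tmul, mul_smul]

/-- The structure constants of the annihilation algebra arise here. When `(α ∂ + β λ_k) w` is
inserted into a conformally antilinear map, `∂` becomes `-(λ_k + λ_l)`. -/
theorem dc_merge_X_add (k : Fin (q + 1)) (l : Fin (q + 2)) (n : Fin (q + 2) → ℕ) (α β : F)
    (z : PolyMod (Fin (q + 1)) F M) :
    dc n (-α • ((.X (l.succAbove k) + .X l : MvPolynomial (Fin (q + 2)) F) •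
        substVars M (mergeVars F k l) z) +
      β • ((.X (l.succAbove k) : MvPolynomial (Fin (q + 2)) F) •
        substVars M (mergeVars F k l) z)) =
      (-α * (n (l.succAbove k) + n l) + β * n (l.succAbove k)) •
        dc (lower (mergeExp k l n) 0) z := by
  rw [add_smul, map_add, map_smul (dc n) (-α), map_smul (dc n) β, map_add, dc_X_smul, dc_X_smul,
    dc_mergeVars, dc_mergeVars]
  by_cases h : n (l.succAbove k) = 0
  · by_cases h' : n l = 0
    · simp [h, h']
    · rw [mergeExp_lower_right k l n h', h]; simp [mul_smul]
  · rw [mergeExp_lower_left k l n h]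
    by_cases h' : n l = 0
    · rw [h']; simp only [Nat.cast_zero]; module
    · rw [mergeExp_lower_right k l n h']; module

theorem dc_eq_smul (n : Fin q → ℕ) (z : PolyMod (Fin q) F M) :
    dc n z = (∏ i, (Nat.factorial (n i) : F)) •
      TensorProduct.equivFinsuppOfBasisLeft (N := M) (MvPolynomial.basisMonomials (Fin q) F)
        ((tensorEquiv (Fin q) F M).symm z) (Finsupp.equivFunOnFinite.symm n) := by
  induction z using PolyMod.induction_on with
  | zero => simp
  | add x y hx hy => rw [map_add, hx, hy, map_add, map_add, Finsupp.add_apply, smul_add]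
  | tmul p m =>
    change mvDivCoeff n p • m = _ • TensorProduct.equivFinsuppOfBasisLeft
      (MvPolynomial.basisMonomials (Fin q) F) (p ⊗ₜ m) _
    rw [TensorProduct.equivFinsuppOfBasisLeft_apply_tmul_apply, mvDivCoeff_apply, mul_smul]
    rfl

theorem prod_factorial_ne_zero [CharZero F] (n : Fin q → ℕ) :
    (∏ i, (Nat.factorial (n i) : F)) ≠ 0 :=
  Finset.prod_ne_zero_iff.2 fun _ _ => Nat.cast_ne_zero.2 (Nat.factorial_ne_zero _)

/-- In characteristic zero the factorials are invertible, so divided coefficients carry the same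
information as coefficients. -/
theorem ext_dc [CharZero F] {z w : PolyMod (Fin q) F M} (h : ∀ n, dc n z = dc n w) : z = w := by
  apply (tensorEquiv (Fin q) F M).symm.injective
  apply (TensorProduct.equivFinsuppOfBasisLeft
    (MvPolynomial.basisMonomials (Fin q) F)).injective
  ext1 n
  have := h (Finsupp.equivFunOnFinite n)
  rw [dc_eq_smul, dc_eq_smul, Equiv.symm_apply_apply] at this
  exact (smul_right_inj (prod_factorial_ne_zero _)).1 this

theorem finite_dc (z : PolyMod (Fin q) F M) : {n : Fin q → ℕ | dc n z ≠ 0}.Finite := by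
  refine ((TensorProduct.equivFinsuppOfBasisLeft (MvPolynomial.basisMonomials (Fin q) F)
    ((tensorEquiv (Fin q) F M).symm z)).support.finite_toSet.image
      Finsupp.equivFunOnFinite).subset fun n hn => ?_
  refine ⟨Finsupp.equivFunOnFinite.symm n, ?_, Equiv.apply_symm_apply _ n⟩
  rw [Finset.mem_coe, Finsupp.mem_support_iff]
  intro h
  rw [Set.mem_ofPred_eq, dc_eq_smul, h, smul_zero] at hn
  exact hn rfl

theorem exists_dc_eq [CharZero F] (v : (Fin q → ℕ) → M) (hv : {n | v n ≠ 0}.Finite) :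
    ∃ z : PolyMod (Fin q) F M, ∀ n, dc n z = v n := by
  classical
  let s : (Fin q →₀ ℕ) →₀ M := Finsupp.onFinset
    (hv.toFinset.image Finsupp.equivFunOnFinite.symm)
    (fun n => (∏ i, (Nat.factorial (n i) : F))⁻¹ • v n) (fun n hn => by
      refine Finset.mem_image.2 ⟨n, ?_, Finsupp.equivFunOnFinite.symm_apply_apply n⟩
      rw [Set.Finite.mem_toFinset, Set.mem_ofPred_eq]
      intro h
      rw [h, smul_zero] at hn
      exact hn rfl)
  refine ⟨tensorEquiv (Fin q) F M ((TensorProduct.equivFinsuppOfBasisLeft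
    (MvPolynomial.basisMonomials (Fin q) F)).symm s), fun n => ?_⟩
  rw [dc_eq_smul, LinearEquiv.symm_apply_apply, LinearEquiv.apply_symm_apply,
    Finsupp.onFinset_apply]
  exact smul_inv_smul₀ (prod_factorial_ne_zero n) _

end PolyMod

end

/-! ### The annihilation Lie algebra -/

noncomputable section

namespace SchrodingerVirasoro

open PolyMod

variable (F : Type u) [Field F]

/-- The annihilation Lie algebra of the Schrödinger–Virasoro conformal algebra; `L_(n)`, `Y_(n)` and
`M_(n)` are the monomials `t ^ n` in the three components. -/
def Ann : Type u := Fin 3 → F[X]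

instance : AddCommGroup (Ann F) := inferInstanceAs (AddCommGroup (Fin 3 → F[X]))
instance : Module F (Ann F) := inferInstanceAs (Module F (Fin 3 → F[X]))

variable {F}

open Polynomial (derivative)

/-- The components of the bracket of the annihilation Lie algebra. -/
def annBracket (x y : Fin 3 → F[X]) : Fin 3 → F[X] :=
  ![derivative (x 0) * y 0 - x 0 * derivative (y 0),
    .C (1 / 2) * (derivative (x 0) * y 1 - derivative (y 0) * x 1) - x 0 * derivative (y 1) +
      y 0 * derivative (x 1),
    y 0 * derivative (x 2) - x 0 * derivative (y 2) + derivative (x 1) * y 1 -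
      x 1 * derivative (y 1)]

instance : Bracket (Ann F) (Ann F) := ⟨annBracket⟩

theorem bracket_zero (x y : Ann F) :
    (⁅x, y⁆ : Ann F) 0 = derivative (x 0) * y 0 - x 0 * derivative (y 0) := rfl

theorem bracket_one (x y : Ann F) : (⁅x, y⁆ : Ann F) 1 =
    .C (1 / 2) * (derivative (x 0) * y 1 - derivative (y 0) * x 1) - x 0 * derivative (y 1) +
      y 0 * derivative (x 1) := rfl

theorem bracket_two (x y : Ann F) : (⁅x, y⁆ : Ann F) 2 =
    y 0 * derivative (x 2) - x 0 * derivative (y 2) + derivative (x 1) * y 1 -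
      x 1 * derivative (y 1) := rfl

theorem ann_ext {x y : Ann F} (h0 : x 0 = y 0) (h1 : x 1 = y 1) (h2 : x 2 = y 2) : x = y := by
  funext i
  fin_cases i <;> assumption

theorem ann_add (x y : Ann F) (i : Fin 3) : (x + y) i = x i + y i := rfl

theorem ann_smul (r : F) (x : Ann F) (i : Fin 3) : (r • x) i = .C r * x i :=
  Polynomial.smul_eq_C_mul r

theorem ann_zero (i : Fin 3) : (0 : Ann F) i = 0 := rfl

variable [CharZero F]

/-- The first component consists of vector fields `-f d/dt`. They act on the second as on densities
of weight `-1/2` and on the third as on functions, while two elements of the second are paired by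
their Wronskian. In this closed form the Jacobi identity is a polynomial identity in the components
and their derivatives, with no case distinction on exponents. -/
instance : LieRing (Ann F) where
  add_lie x y z := by
    apply ann_ext <;>
      simp only [bracket_zero, bracket_one, bracket_two, ann_add, map_add] <;> ring
  lie_add x y z := by
    apply ann_ext <;>
      simp only [bracket_zero, bracket_one, bracket_two, ann_add, map_add] <;> ring
  lie_self x := by
    apply ann_ext <;> simp only [bracket_zero, bracket_one, bracket_two, ann_zero] <;> ring
  leibniz_lie x y z := by
    have h2 : (2 : F[X]) * .C (1 / 2) = 1 := by
      rw [← map_ofNat (Polynomial.C : F →+* F[X]), ← map_mul]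
      norm_num
    apply ann_ext <;> simp only [bracket_zero, bracket_one, bracket_two, ann_add, map_add, map_sub,
      Polynomial.derivative_mul, Polynomial.derivative_C] <;>
    generalize (Polynomial.C (1 / 2) : F[X]) = h at * <;> grind

instance : LieAlgebra F (Ann F) where
  lie_smul r x y := by
    apply ann_ext <;> simp only [bracket_zero, bracket_one, bracket_two, ann_smul,
      Polynomial.derivative_mul, Polynomial.derivative_C] <;> ring

variable (F) in
/-- The basis of the annihilation Lie algebra. -/
def annBasis : Module.Basis (Fin 3 × ℕ) F (Ann F) :=
  (Pi.basis fun _ : Fin 3 => Polynomial.basisMonomials F).reindex (Equiv.sigmaEquivProd _ _)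

theorem annBasis_apply (i : Fin 3) (n : ℕ) (j : Fin 3) :
    annBasis F (i, n) j = if j = i then .X ^ n else 0 := by
  change ((Pi.basis fun _ : Fin 3 => Polynomial.basisMonomials F).reindex
    (Equiv.sigmaEquivProd _ _) : Module.Basis (Fin 3 × ℕ) F (Fin 3 → F[X])) (i, n) j = _
  rw [Module.Basis.reindex_apply]
  change (Pi.basis fun _ : Fin 3 => Polynomial.basisMonomials F) ⟨i, n⟩ j = _
  rw [Pi.basis_apply]
  simp [Polynomial.X_pow_eq_monomial, Pi.single_apply]

/-- The coefficient `α` in `[u_λ v] = (α ∂ + β λ) w` for generators `u`, `v`. -/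
def coefD : Fin 3 → Fin 3 → F
  | 0, _ => 1
  | 1, 0 => 1 / 2
  | 1, 1 => 1
  | _, _ => 0

/-- The coefficient `β` in `[u_λ v] = (α ∂ + β λ) w` for generators `u`, `v`. -/
def coefL : Fin 3 → Fin 3 → F
  | 0, 0 => 2
  | 0, 1 => 3 / 2
  | 0, 2 => 1
  | 1, 0 => 3 / 2
  | 1, 1 => 2
  | 2, 0 => 1
  | _, _ => 0

/-- The indices `0`, `1`, `2` of `L`, `Y`, `M` are a grading. Addition in `Fin 3` wraps around only
for pairs whose bracket is zero, and there both coefficients vanish. -/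
theorem bracketGen_eq (i j : Fin 3) :
    bracketGen F i j = lin (coefD i j) (coefL i j) (gen F (i + j)) := by
  fin_cases i <;> fin_cases j <;> simp [bracketGen, coefD, coefL, lin]

/-- The structure constants of the annihilation Lie algebra. -/
def annCoef (F : Type u) [Field F] (x y : Fin 3 × ℕ) : F :=
  -coefD x.1 y.1 * (x.2 + y.2) + coefL x.1 y.1 * x.2

/-- The basis vector that is a multiple of the bracket of two basis vectors. -/
def annMul (x y : Fin 3 × ℕ) : Fin 3 × ℕ := (x.1 + y.1, x.2 + y.2 - 1)

/-- For two exponents `0` the truncated exponent in `annMul` is meaningless, but then the structure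
constant is zero. -/
theorem annBasis_lie (x y : Fin 3 × ℕ) :
    ⁅annBasis F x, annBasis F y⁆ = annCoef F x y • annBasis F (annMul x y) := by
  obtain ⟨i, m⟩ := x
  obtain ⟨j, n⟩ := y
  obtain ⟨h, hh⟩ : ∃ h : F[X], h = .C (1 / 2) := ⟨_, rfl⟩
  have h2 : 2 * h = 1 := by
    rw [hh, ← map_ofNat (Polynomial.C : F →+* F[X]), ← map_mul]
    norm_num
  have h3 : (.C (3 / 2) : F[X]) = 3 * h := by
    rw [hh, ← map_ofNat (Polynomial.C : F →+* F[X]), ← map_mul]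
    norm_num
  have e1 : derivative (.X ^ m : F[X]) * .X ^ n = .C (m : F) * .X ^ (m + n - 1) := by
    cases m with
    | zero => simp
    | succ m => rw [Polynomial.derivative_X_pow, mul_assoc, ← pow_add]; congr 2; omega
  have e2 : (.X ^ m : F[X]) * derivative (.X ^ n : F[X]) = .C (n : F) * .X ^ (m + n - 1) := by
    cases n with
    | zero => simp
    | succ n => rw [Polynomial.derivative_X_pow, mul_left_comm, ← pow_add]; congr 2
  fin_cases i <;> fin_cases j <;> apply ann_ext <;>
    simp only [bracket_zero, bracket_one, bracket_two, ann_smul, annBasis_apply, annMul, annCoef,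
      coefD, coefL, Fin.zero_eta, Fin.mk_one, Fin.reduceFinMk, Fin.isValue,
      Fin.reduceAdd, Fin.reduceEq, if_true, if_false, map_zero, mul_zero, zero_mul, sub_zero,
      add_zero, zero_add, sub_self, mul_comm (.X ^ n : F[X]), mul_comm (derivative (.X ^ n : F[X])),
      e1, e2, map_add, map_neg, map_mul, map_one, map_ofNat, h3, ← hh] <;>
    generalize (.X ^ (m + n - 1) : F[X]) = w <;> grind

end SchrodingerVirasoro

end

/-! ### The action of the annihilation algebra on the adjoint module -/

noncomputable section

namespace PolyMod

variable {σ τ F A M : Type*} [Field F] [AddCommGroup A] [Module F A] [AddCommGroup M] [Module F M]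

theorem substVars_smul (t : σ → MvPolynomial τ F) (p : MvPolynomial σ F) (z : PolyMod σ F M) :
    substVars M t (p • z) = MvPolynomial.aeval t p • substVars M t z := by
  induction z using PolyMod.induction_on with
  | zero => simp only [smul_zero, map_zero]
  | add x y hx hy => simp only [smul_add, map_add, hx, hy]
  | tmul r m => rw [smul_tmul, substVars_tmul, substVars_tmul, smul_tmul, map_mul]

theorem actAt_smul (act : A →ₗ[F] M →ₗ[F] F[X] ⊗[F] M) (t p : MvPolynomial σ F) (a : A)
    (z : PolyMod σ F M) : actAt act t a (p • z) = p • actAt act t a z := by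
  induction z using PolyMod.induction_on with
  | zero => simp only [smul_zero, map_zero]
  | add x y hx hy => simp only [smul_add, map_add, hx, hy]
  | tmul r m => rw [smul_tmul, actAt_tmul, actAt_tmul, mul_smul]

theorem substVar_X_smul (t : MvPolynomial σ F) (z : F[X] ⊗[F] M) :
    substVar t ((Polynomial.X : F[X]) • z) = t • substVar t z := by
  induction z using TensorProduct.induction_on with
  | zero => simp only [smul_zero, map_zero]
  | add x y hx hy => simp only [smul_add, map_add, hx, hy]
  | tmul r m => simp [TensorProduct.smul_tmul']

theorem actAt_D_left {act : A →ₗ[F] M →ₗ[F] F[X] ⊗[F] M} {D : A →ₗ[F] A}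
    (h : ∀ a m, act (D a) m = -((Polynomial.X : F[X]) • act a m)) (t : MvPolynomial σ F) (a : A)
    (z : PolyMod σ F M) : actAt act t (D a) z = -(t • actAt act t a z) := by
  induction z using PolyMod.induction_on with
  | zero => simp only [smul_zero, map_zero, neg_zero]
  | add x y hx hy => simp only [smul_add, map_add, hx, hy, neg_add]
  | tmul r m =>
    rw [actAt_tmul, actAt_tmul, h, map_neg, substVar_X_smul, smul_neg, smul_comm]

theorem substVars_substVar (t : σ → MvPolynomial τ F) (s : MvPolynomial σ F) (z : F[X] ⊗[F] M) :
    substVars M t (substVar s z) = substVar (MvPolynomial.aeval t s) z := by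
  induction z using TensorProduct.induction_on with
  | zero => simp only [map_zero]
  | add x y hx hy => simp only [map_add, hx, hy]
  | tmul r m =>
    rw [substVar_tmul, substVar_tmul, substVars_tmul]
    congr 1
    exact (Polynomial.aeval_algHom_apply (MvPolynomial.aeval t) s r).symm

theorem substVars_actAt (act : A →ₗ[F] M →ₗ[F] F[X] ⊗[F] M) (t : σ → MvPolynomial τ F)
    (s : MvPolynomial σ F) (a : A) (z : PolyMod σ F M) :
    substVars M t (actAt act s a z) =
      actAt act (MvPolynomial.aeval t s) a (substVars M t z) := by
  induction z using PolyMod.induction_on with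
  | zero => simp only [map_zero]
  | add x y hx hy => simp only [map_add, hx, hy]
  | tmul r m =>
    rw [actAt_tmul, substVars_smul, substVars_substVar, substVars_tmul, actAt_tmul]

end PolyMod

namespace SchrodingerVirasoro

open PolyMod

variable {F : Type u} [Field F]

theorem substOp_lin {N : Type*} [AddCommGroup N] [Module F N] (T : Module.End F N)
    (g : SV F →ₗ[F] N) (α β : F) (v : SV F) :
    substOp T g (lin α β v) = α • g (D F v) + β • T (g v) := by
  simp [lin, substOp_tmul]

variable [CharZero F]

variable (F) in
/-- The action of the annihilation Lie algebra: `a_(n) v` is the coefficient of `λ ^ n / n!` in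
`a_λ v`. -/
def annAct : Ann F →ₗ[F] Module.End F (SV F) :=
  (annBasis F).constr F fun x => dc₁ x.2 ∘ₗ bracket F (gen F x.1)

theorem annAct_basis (x : Fin 3 × ℕ) (v : SV F) :
    annAct F (annBasis F x) v = dc₁ x.2 (bracket F (gen F x.1) v) := by
  rw [annAct, Module.Basis.constr_basis]; rfl

theorem dc_actAt_tmul (n : Fin 1 → ℕ) (a v : SV F) :
    dc n (actAt (bracket F) (.X 0 : MvPolynomial (Fin 1) F) a (tmul 1 v)) =
      dc₁ (n 0) (bracket F a v) := by
  have h := dc_actAt (bracket F) n 0 a (tmul 1 v : PolyMod (Fin 0) F (SV F))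
  have h2 : mvDivCoeff (F := F) (q := 0) (fun i => n (Fin.succAbove 0 i)) 1 = 1 := by
    rw [← MvPolynomial.C_1, mvDivCoeff_C, if_pos (Subsingleton.elim _ _)]
  rw [substVars_tmul, map_one, dc_tmul, h2, one_smul] at h
  exact h

theorem dc_actAt_actAt (n : Fin 2 → ℕ) (k j : Fin 2) (hj : j = k.succAbove 0) (a b v : SV F) :
    dc n (actAt (bracket F) (.X k : MvPolynomial (Fin 2) F) a
      (actAt (bracket F) (.X j) b (tmul 1 v))) =
      dc₁ (n k) (bracket F a (dc₁ (n j) (bracket F b v))) := by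
  have h := dc_actAt (bracket F) n k a
    (actAt (bracket F) (.X 0 : MvPolynomial (Fin 1) F) b (tmul 1 v))
  rw [dc_actAt_tmul, substVars_actAt, substVars_tmul, map_one, MvPolynomial.aeval_X, ← hj] at h
  exact h

/-- Comparison of the coefficients of `λ ^ m / m! · μ ^ n / n!` in the conformal Jacobi identity. -/
theorem annAct_lie_basis (x y : Fin 3 × ℕ) (v : SV F) :
    annAct F (annBasis F x) (annAct F (annBasis F y) v) =
      annAct F ⁅annBasis F x, annBasis F y⁆ v +
        annAct F (annBasis F y) (annAct F (annBasis F x) v) := by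
  have h := congrArg (dc ![x.2, y.2]) (jacobi F (gen F x.1) (gen F y.1) v)
  rw [map_add, dc_actAt_actAt _ _ _ (by rfl), dc_actAt_actAt _ _ _ (by rfl)] at h
  -- `Fin.succAbove 1 0` is `0`, written so as to match `dc_merge_X_add` with `k = 0` and `l = 1`.
  have h2 : substOp (mulOp F (.X 0 : MvPolynomial (Fin 2) F))
      ((actAt (bracket F) (.X 0 + .X 1)).flip (PolyMod.tmul 1 v))
        (bracket F (gen F x.1) (gen F y.1)) =
      -(coefD x.1 y.1 : F) • ((.X (Fin.succAbove 1 0) + .X 1 : MvPolynomial (Fin 2) F) •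
        substVars (SV F) (mergeVars F 0 1) (actAt (bracket F) (.X 0 : MvPolynomial (Fin 1) F)
          (gen F (x.1 + y.1)) (tmul 1 v))) +
      (coefL x.1 y.1 : F) • ((.X (Fin.succAbove 1 0) : MvPolynomial (Fin 2) F) •
        substVars (SV F) (mergeVars F 0 1) (actAt (bracket F) (.X 0 : MvPolynomial (Fin 1) F)
          (gen F (x.1 + y.1)) (tmul 1 v))) := by
    rw [bracket_gen, bracketGen_eq, substOp_lin, LinearMap.flip_apply, LinearMap.flip_apply,
      actAt_D_left (bracket_D_left F), substVars_actAt, MvPolynomial.aeval_X, substVars_tmul,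
      map_one, smul_neg, neg_smul]
    rfl
  rw [h2, dc_merge_X_add, dc_actAt_tmul] at h
  simp only [annAct_basis, annBasis_lie, map_smul, LinearMap.smul_apply]
  exact h

instance : Bracket (Ann F) (SV F) := ⟨fun x v => annAct F x v⟩

theorem annBasis_lie_apply (x : Fin 3 × ℕ) (v : SV F) :
    ⁅annBasis F x, v⁆ = dc₁ x.2 (bracket F (gen F x.1) v) := annAct_basis x v

instance : LieRingModule (Ann F) (SV F) where
  add_lie x y v := by
    change annAct F (x + y) v = _
    rw [map_add]; rfl
  lie_add x v w := map_add (annAct F x) v w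
  leibniz_lie x y v := by
    change annAct F x (annAct F y v) = annAct F ⁅x, y⁆ v + annAct F y (annAct F x v)
    refine LieCochain.basis_induction (annBasis F) (P := fun x => annAct F x (annAct F y v) =
      annAct F ⁅x, y⁆ v + annAct F y (annAct F x v)) ?_ (fun i => ?_) (fun x x' h h' => ?_)
      (fun r x h => ?_) x
    · simp
    · refine LieCochain.basis_induction (annBasis F) (P := fun y => annAct F (annBasis F i)
        (annAct F y v) = annAct F ⁅annBasis F i, y⁆ v + annAct F y (annAct F (annBasis F i) v))
        ?_ (fun j => annAct_lie_basis i j v)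
        (fun y y' h h' => ?_) (fun r y h => ?_) y
      · simp
      · simp only [map_add, lie_add, LinearMap.add_apply, h, h']; abel
      · simp only [map_smul, lie_smul, LinearMap.smul_apply, h, smul_add]
    · simp only [map_add, add_lie, LinearMap.add_apply, h, h']; abel
    · simp only [map_smul, smul_lie, LinearMap.smul_apply, h, smul_add]

instance : LieModule F (Ann F) (SV F) where
  smul_lie r x v := by
    change annAct F (r • x) v = _
    rw [map_smul]; rfl
  lie_smul r x v := map_smul (annAct F x) r v

end SchrodingerVirasoro

end

/-! ### From conformal cochains to cochains of the annihilation algebra -/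

noncomputable section

namespace SchrodingerVirasoro

open PolyMod LieCochain

variable {F : Type u} [Field F] [CharZero F]

variable (F) in
/-- Cochains of the annihilation Lie algebra. -/
abbrev Coc (q : ℕ) : Type u := Coch F (Ann F) (SV F) q

variable (F) in
/-- Cochains of the conformal algebra, without symmetry conditions. -/
abbrev Cnf (q : ℕ) : Type u := ConformalModule.Maps F (SV F) (SV F) q

/-- The divided coefficients of the values on generators. -/
def coeffs {q : ℕ} (f : Cnf F q) (x : Fin q → Fin 3 × ℕ) : SV F :=
  dc (fun i => (x i).2) (f fun i => gen F (x i).1)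

variable (F) in
/-- The cochain of the annihilation Lie algebra that corresponds to a cochain of the conformal
algebra. -/
def toCoch (q : ℕ) : Cnf F q →ₗ[F] Coc F q where
  toFun f := ofVal (annBasis F) q (coeffs f)
  map_add' f g := by
    refine ext_val (annBasis F) fun x => ?_
    rw [map_add, Pi.add_apply, val_ofVal, val_ofVal, val_ofVal, coeffs, add_apply, map_add]; rfl
  map_smul' r f := by
    refine ext_val (annBasis F) fun x => ?_
    rw [map_smul, Pi.smul_apply, val_ofVal, val_ofVal, coeffs, smul_apply, map_smul]; rfl

theorem val_toCoch {q : ℕ} (f : Cnf F q) (x : Fin q → Fin 3 × ℕ) :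
    val (annBasis F) q (toCoch F q f) x =
      dc (fun i => (x i).2) (f fun i => gen F (x i).1) :=
  congrFun (val_ofVal (annBasis F) (coeffs f)) x

/-- Conformal antilinearity in each argument. -/
def IsSesq {q : ℕ} (f : Cnf F q) : Prop :=
  ∀ (a : Fin q → SV F) (i : Fin q), f (Function.update a i (D F (a i))) =
    -((.X i : MvPolynomial (Fin q) F) • f a)

theorem IsSesq.of_mem {q : ℕ} {f : Cnf F q} (hf : f ∈ (adjointModule F).cochains q) :
    IsSesq f := hf.1

/-- Each argument is an `F[∂]`-combination of generators, and `∂` in argument `i` only multiplies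
the value by `-λ_i`. -/
theorem IsSesq.eq_zero {q : ℕ} {f : Cnf F q} (hf : IsSesq f)
    (h : ∀ g : Fin q → Fin 3, f (fun i => gen F (g i)) = 0) : f = 0 := by
  -- Arguments are freed one at a time: `s` is the set of positions at which the argument need not
  -- be a generator.
  have key : ∀ (s : Finset (Fin q)) (a : Fin q → SV F), (∀ i ∉ s, ∃ j, a i = gen F j) →
      f a = 0 := by
    intro s
    induction s using Finset.induction_on with
    | empty =>
      intro a ha
      choose g hg using fun i => ha i (Finset.notMem_empty i)
      rw [funext hg]
      exact h g
    | insert i s hi ih =>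
      intro a ha
      have : ∀ v, f (Function.update a i v) = 0 := by
        intro v
        induction v using induction with
        | hgen j =>
          refine ih _ fun k hk => ?_
          by_cases hki : k = i
          · subst hki; exact ⟨j, by simp⟩
          · obtain ⟨m, hm⟩ := ha k (by simp [hk, hki])
            exact ⟨m, by simp [hki, hm]⟩
        | hD v hv =>
          have := hf (Function.update a i v) i
          rw [hv, smul_zero, neg_zero] at this
          simpa using this
        | hadd v w hv hw => rw [f.map_update_add, hv, hw, add_zero]
        | hsmul c v hv => rw [f.map_update_smul, hv, smul_zero]
      simpa using this (a i)
  exact MultilinearMap.ext fun a => key Finset.univ a (by simp)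

theorem IsSesq.sub {q : ℕ} {f g : Cnf F q} (hf : IsSesq f) (hg : IsSesq g) : IsSesq (f - g) := by
  intro a i
  rw [sub_apply, sub_apply, hf, hg, smul_sub]; abel

theorem IsSesq.add {q : ℕ} {f g : Cnf F q} (hf : IsSesq f) (hg : IsSesq g) : IsSesq (f + g) := by
  intro a i
  rw [add_apply, add_apply, hf, hg, smul_add]; abel

theorem IsSesq.smul {q : ℕ} {f : Cnf F q} (hf : IsSesq f) (r : F) : IsSesq (r • f) := by
  intro a i
  rw [smul_apply, smul_apply, hf, smul_neg, smul_comm]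

theorem IsSesq.sum {q : ℕ} {ι : Type*} {s : Finset ι} {f : ι → Cnf F q}
    (hf : ∀ i ∈ s, IsSesq (f i)) : IsSesq (∑ i ∈ s, f i) := by
  classical
  induction s using Finset.induction_on with
  | empty => intro a i; simp
  | insert i s hi ih =>
    rw [Finset.sum_insert hi]
    exact (hf i (by simp)).add (ih fun j hj => hf j (by simp [hj]))

/-- Injectivity of `toCoch`. Skew-symmetry is not required, so this applies to `d f` and `∂ f` as
soon as they are antilinear, without a proof that they are cochains. -/
theorem IsSesq.ext_toCoch {q : ℕ} {f g : Cnf F q} (hf : IsSesq f) (hg : IsSesq g)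
    (h : toCoch F q f = toCoch F q g) : f = g := by
  rw [← sub_eq_zero]
  refine (hf.sub hg).eq_zero fun s => ?_
  rw [sub_apply, sub_eq_zero]
  refine ext_dc fun n => ?_
  rw [← val_toCoch f fun i => (s i, n i), h, val_toCoch]

theorem toCoch_isSkew {q : ℕ} {f : Cnf F q} (hf : f ∈ (adjointModule F).cochains q) :
    IsSkew q (toCoch F q f) := by
  rw [isSkew_iff_val (annBasis F)]
  intro σ x
  rw [val_toCoch, val_toCoch, ← map_zsmul, ← hf.2 σ, dc_perm]

/-- There are finitely many tuples of generators, and the value at each of them is a polynomial. -/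
theorem toCoch_finite {q : ℕ} (f : Cnf F q) :
    {x | val (annBasis F) q (toCoch F q f) x ≠ 0}.Finite := by
  refine (Set.Finite.biUnion (Set.toFinite (Set.univ : Set (Fin q → Fin 3)))
    fun g _ => (finite_dc (f fun i => gen F (g i))).image fun n i => (g i, n i)).subset
      fun x hx => ?_
  rw [Set.mem_ofPred_eq, val_toCoch] at hx
  exact Set.mem_biUnion (Set.mem_univ fun i => (x i).1) ⟨fun i => (x i).2, hx, rfl⟩

theorem dc_dAct {q : ℕ} (k : Fin (q + 1)) (f : Cnf F q) (x : Fin (q + 1) → Fin 3 × ℕ) :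
    dc (fun i => (x i).2) ((adjointModule F).dAct k f fun i => gen F (x i).1) =
      ⁅annBasis F (x k), ev q (toCoch F q f) fun i => annBasis F (x (k.succAbove i))⁆ := by
  rw [ConformalModule.dAct_apply, annBasis_lie_apply]
  change dc (fun i => (x i).2) (actAt (bracket F) _ _ _) = _
  rw [dc_actAt]
  congr 2
  exact (val_toCoch f fun i => x (k.succAbove i)).symm

/-- On generators the bracket has the form `(α ∂ + β λ) w`; antilinearity in the first argument and
`dc_merge_X_add` turn it into the structure constant `annCoef`. -/
theorem dc_dBracket {q : ℕ} (k : Fin (q + 1)) (l : Fin (q + 2)) {f : Cnf F (q + 1)}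
    (hf : IsSesq f) (x : Fin (q + 2) → Fin 3 × ℕ) :
    dc (fun i => (x i).2)
        (ConformalModule.dBracket (algebra F) k l f fun i => gen F (x i).1) =
      ev q (ins ⁅annBasis F (x (l.succAbove k)), annBasis F (x l)⁆ (toCoch F (q + 1) f))
        fun i => annBasis F (x (l.succAbove (k.succAbove i))) := by
  rw [ConformalModule.dBracket_apply]
  set y : Fin q → SV F := fun i => gen F (x (l.succAbove (k.succAbove i))).1 with hy
  have hg : ∀ v, (substVars (SV F) (mergeVars F k l) ∘ₗ f.toLinearMap (Fin.cons 0 y) 0) v =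
      substVars (SV F) (mergeVars F k l) (f (Fin.cons v y : Fin (q + 1) → SV F)) := by
    intro v
    rw [LinearMap.comp_apply, MultilinearMap.toLinearMap_apply, Fin.update_cons_zero]
  have hD : ∀ v, f (Fin.cons (D F v) y : Fin (q + 1) → SV F) =
      -((.X 0 : MvPolynomial (Fin (q + 1)) F) • f (Fin.cons v y : Fin (q + 1) → SV F)) := by
    intro v
    rw [← hf, Fin.cons_zero, Fin.update_cons_zero]
  change dc _ (substOp _ (substVars (SV F) (mergeVars F k l) ∘ₗ f.toLinearMap (Fin.cons 0 y) 0)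
    (bracket F _ _)) = _
  rw [bracket_gen, bracketGen_eq, substOp_lin, hg, hg, hD, map_neg, substVars_smul,
    MvPolynomial.aeval_X, smul_neg, ← neg_smul]
  have := dc_merge_X_add k l (fun i => (x i).2)
    (coefD (x (l.succAbove k)).1 (x l).1) (coefL (x (l.succAbove k)).1 (x l).1)
    (f (Fin.cons (gen F ((x (l.succAbove k)).1 + (x l).1)) y : Fin (q + 1) → SV F))
  refine Eq.trans this ?_
  rw [annBasis_lie, ins_smul_left, map_smul, smul_apply]
  refine congrArg (fun z => annCoef F (x (l.succAbove k)) (x l) • z) ?_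
  refine Eq.trans ?_ (val_cons (annBasis F) (toCoch F (q + 1) f) _ _)
  rw [val_toCoch]
  congr 1
  · congr 1
    funext i
    refine Fin.cases ?_ (fun i => ?_) i
    · simp [lower, mergeExp, annMul]
    · simp [lower, mergeExp]
  · congr 1
    funext i
    refine Fin.cases ?_ (fun i => ?_) i
    · simp [annMul]
    · simp [hy]

/-- The conformal differential and the Chevalley–Eilenberg formula agree term by term. Skew-symmetry
enters through that formula, antilinearity through the bracket terms. -/
theorem toCoch_d {q : ℕ} {f : Cnf F q} (hf : f ∈ (adjointModule F).cochains q) :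
    toCoch F (q + 1) ((adjointModule F).d q f) = diff q (toCoch F q f) := by
  refine ext_val (annBasis F) fun x => ?_
  rw [val_toCoch]
  cases q with
  | zero =>
    refine (dc_dAct 0 f x).trans ?_
    rfl
  | succ q =>
    have key := IsSkew.ev_diff (toCoch_isSkew hf) fun i => annBasis F (x i)
    change _ = ev (q + 2) (diff (q + 1) (toCoch F (q + 1) f)) (fun i => annBasis F (x i))
    rw [key]
    rw [ConformalModule.d, LinearMap.add_apply, add_apply, map_add]
    congr 1
    · rw [LinearMap.sum_apply, MultilinearMap.sum_apply, map_sum]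
      refine Finset.sum_congr rfl fun k _ => ?_
      rw [LinearMap.smul_apply, smul_apply, map_smul, dc_dAct]
    · rw [LinearMap.sum_apply, MultilinearMap.sum_apply, map_sum]
      refine Finset.sum_congr rfl fun l _ => ?_
      rw [LinearMap.sum_apply, MultilinearMap.sum_apply, map_sum]
      refine Finset.sum_congr rfl fun k _ => ?_
      rw [LinearMap.smul_apply, smul_apply, map_smul, dc_dBracket _ _ (IsSesq.of_mem hf)]

theorem dc₁_X_smul (n : ℕ) (z : F[X] ⊗[F] SV F) :
    dc₁ n ((Polynomial.X : F[X]) • z) = (n : F) • dc₁ (n - 1) z := by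
  induction z using TensorProduct.induction_on with
  | zero => simp
  | add x y hx hy => simp only [smul_add, map_add, hx, hy]
  | tmul p m =>
    rw [TensorProduct.smul_tmul', smul_eq_mul, dc₁_tmul, dc₁_tmul, divCoeff_X_mul, mul_smul]

theorem dc₁_lTensor (n : ℕ) (g : Module.End F (SV F)) (z : F[X] ⊗[F] SV F) :
    dc₁ n (g.lTensor F[X] z) = g (dc₁ n z) := by
  induction z using TensorProduct.induction_on with
  | zero => simp
  | add x y hx hy => simp only [map_add, hx, hy]
  | tmul p m => simp

/-- This is `[x_(n), ∂] = n x_(n-1)`, the coefficient form of `a_λ (∂ v) = (∂ + λ) a_λ v`. -/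
theorem annBasis_lie_D (i : Fin 3) (n : ℕ) (v : SV F) :
    ⁅annBasis F (i, n), D F v⁆ =
      D F ⁅annBasis F (i, n), v⁆ + (n : F) • ⁅annBasis F (i, n - 1), v⁆ := by
  simp only [annBasis_lie_apply, bracket_D_right, map_add, dc₁_X_smul, dc₁_lTensor]

theorem annBasis_lie_gen (i : Fin 3) (n : ℕ) (j : Fin 3) :
    ⁅annBasis F (i, n), gen F j⁆ =
      (if n = 0 then (coefD i j : F) else 0) • D F (gen F (i + j)) +
        (if n = 1 then (coefL i j : F) else 0) • gen F (i + j) := by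
  rw [annBasis_lie_apply, bracket_gen, bracketGen_eq, lin, map_add, dc₁_tmul, dc₁_tmul,
    ← Polynomial.C_1, divCoeff_C, ← mul_one Polynomial.X, divCoeff_X_mul, ← Polynomial.C_1,
    divCoeff_C]
  congr 1
  · split_ifs <;> simp
  · match n with
    | 0 => simp
    | 1 => simp
    | n + 2 => simp

/-- The constant term of `[L_λ v]` is `∂ v` for each generator `v`, and `L_(0)` commutes with `∂`.
-/
theorem L_zero_lie (v : SV F) : ⁅annBasis F (0, 0), v⁆ = D F v := by
  induction v using induction with
  | hgen j => rw [annBasis_lie_gen]; simp [coefD]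
  | hD v hv => rw [annBasis_lie_D, hv]; simp
  | hadd v w hv hw => rw [lie_add, hv, hw, map_add]
  | hsmul c v hv => rw [lie_smul, hv, map_smul]

/-- On values `L_(0)` acts as `∂`. On arguments `[L_(0), x_(n)] = -n x_(n-1)`, and lowering `n_i`
with the factor `n_i` is multiplication by `λ_i`. -/
theorem toCoch_partialOp {q : ℕ} (f : Cnf F q) :
    toCoch F q ((adjointModule F).partialOp q f) = ⁅annBasis F (0, 0), toCoch F q f⁆ := by
  refine ext_val (annBasis F) fun x => ?_
  refine Eq.trans ?_ (ev_lie _ _ _).symm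
  rw [val_toCoch]
  change dc (fun i => (x i).2) (mapCoeff (Fin q) (D F) (f fun i => gen F (x i).1) +
    (∑ i, .X i : MvPolynomial (Fin q) F) • (f fun i => gen F (x i).1)) = _
  rw [map_add, dc_mapCoeff, Finset.sum_smul, map_sum, sub_eq_add_neg, ← Finset.sum_neg_distrib]
  congr 1
  · exact (L_zero_lie _).symm.trans (congrArg _ (val_toCoch f x).symm)
  · refine Finset.sum_congr rfl fun i _ => ?_
    have h1 : annCoef F (0, 0) (x i) = -((x i).2 : F) := by simp [annCoef, coefD]
    have h2 : (Function.update (fun i => annBasis F (x i)) i (annBasis F (annMul (0, 0) (x i)))) =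
        fun j => annBasis F (Function.update x i (annMul (0, 0) (x i)) j) := by
      funext j
      by_cases h : j = i
      · subst h; simp
      · simp [h]
    have h3 := val_toCoch f (Function.update x i (annMul (0, 0) (x i)))
    rw [dc_X_smul, annBasis_lie, MultilinearMap.map_update_smul, h1, h2, neg_smul, neg_neg]
    refine congrArg _ (Eq.trans ?_ h3.symm)
    congr 1
    · congr 1
      funext j
      by_cases h : j = i
      · subst h; simp [lower, annMul]
      · simp [lower, h]
    · congr 1
      funext j
      by_cases h : j = i
      · subst h; simp [annMul]
      · simp [h]

end SchrodingerVirasoro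

end

/-! ### Antilinearity of `d f` and `∂ f`; reconstruction of conformal cochains -/

noncomputable section

namespace SchrodingerVirasoro

open PolyMod LieCochain

variable {F : Type u} [Field F] [CharZero F]

theorem update_comp_of_injective {α β γ : Type*} [DecidableEq α] [DecidableEq β] (e : α → β)
    (he : Function.Injective e) (a : β → γ) (i : α) (v : γ) :
    (fun j => Function.update a (e i) v (e j)) = Function.update (fun j => a (e j)) i v := by
  funext j
  by_cases h : j = i
  · subst h; simp
  · simp [h, he.ne h]

theorem update_comp_of_ne {α β γ : Type*} [DecidableEq β] (e : α → β) {k : β}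
    (hk : ∀ i, e i ≠ k) (a : β → γ) (v : γ) :
    (fun j => Function.update a k v (e j)) = fun j => a (e j) := by
  funext j
  simp [hk j]

theorem IsSesq.dAct {q : ℕ} (k : Fin (q + 1)) {f : Cnf F q} (hf : IsSesq f) :
    IsSesq ((adjointModule F).dAct k f) := by
  intro a i
  rw [ConformalModule.dAct_apply, ConformalModule.dAct_apply]
  induction i using Fin.succAboveCases k with
  | x =>
    rw [update_comp_of_ne _ (fun i => Fin.succAbove_ne k i), Function.update_self]
    exact actAt_D_left (bracket_D_left F) _ _ _
  | p j =>
    rw [update_comp_of_injective _ Fin.succAbove_right_injective,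
      Function.update_of_ne (Fin.ne_succAbove k j), hf (fun i => a (k.succAbove i)) j, map_neg,
      substVars_smul, MvPolynomial.aeval_X, map_neg, actAt_smul]

theorem commute_mulOp {σ : Type*} (s t : MvPolynomial σ F) :
    Commute (mulOp F s : Module.End F (PolyMod σ F (SV F))) (mulOp F t) :=
  LinearMap.ext fun z => smul_comm s t z

/-- `hD` and `hy` describe the effect of `∂` on the merged argument and on the untouched ones. The
three cases are `∂` in position `l`, in position `k`, and in any other position. -/
theorem IsSesq.dBracket {q : ℕ} (k : Fin (q + 1)) (l : Fin (q + 2)) {f : Cnf F (q + 1)}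
    (hf : IsSesq f) : IsSesq (ConformalModule.dBracket (algebra F) k l f) := by
  have hD : ∀ y : Fin q → SV F,
      (substVars (SV F) (mergeVars F k l) ∘ₗ f.toLinearMap (Fin.cons 0 y) 0) ∘ₗ D F =
        mulOp F (-(.X (l.succAbove k) + .X l) : MvPolynomial (Fin (q + 2)) F) ∘ₗ
          (substVars (SV F) (mergeVars F k l) ∘ₗ f.toLinearMap (Fin.cons 0 y) 0) := by
    intro y
    refine LinearMap.ext fun v => ?_
    simp only [LinearMap.comp_apply, MultilinearMap.toLinearMap_apply, Fin.update_cons_zero]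
    have := hf (Fin.cons v y : Fin (q + 1) → SV F) 0
    rw [Fin.cons_zero, Fin.update_cons_zero] at this
    rw [this, map_neg, substVars_smul, MvPolynomial.aeval_X, ← neg_smul]
    rfl
  have hy : ∀ (y : Fin q → SV F) (j : Fin q),
      substVars (SV F) (mergeVars F k l) ∘ₗ
          f.toLinearMap (Fin.cons 0 (Function.update y j (D F (y j)))) 0 =
        mulOp F (-.X (l.succAbove (k.succAbove j)) : MvPolynomial (Fin (q + 2)) F) ∘ₗ
          (substVars (SV F) (mergeVars F k l) ∘ₗ f.toLinearMap (Fin.cons 0 y) 0) := by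
    intro y j
    refine LinearMap.ext fun v => ?_
    simp only [LinearMap.comp_apply, MultilinearMap.toLinearMap_apply, Fin.update_cons_zero]
    have := hf (Fin.cons v y : Fin (q + 1) → SV F) j.succ
    rw [Fin.cons_succ, ← Fin.cons_update] at this
    rw [this, map_neg, substVars_smul, MvPolynomial.aeval_X, ← neg_smul]
    rfl
  intro a i
  rw [ConformalModule.dBracket_apply, ConformalModule.dBracket_apply]
  change substOp _ (substVars (SV F) (mergeVars F k l) ∘ₗ f.toLinearMap (Fin.cons 0 _) 0)
    (bracket F _ _) = -(_ • substOp _ (substVars (SV F) (mergeVars F k l) ∘ₗ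
      f.toLinearMap (Fin.cons 0 _) 0) (bracket F _ _))
  induction i using Fin.succAboveCases l with
  | x =>
    rw [update_comp_of_ne _ (fun i => Fin.succAbove_ne l _), Function.update_self,
      Function.update_of_ne (Fin.succAbove_ne l k)]
    -- Here `[a_k ∂ a_l] = (∂ + λ_k) [a_k a_l]`, and the outer `∂` becomes `-(λ_k + λ_l)`, which
    -- leaves `-λ_l`.
    refine Eq.trans (congrArg _ (bracket_D_right F _ _)) ?_
    rw [map_add, substOp_lTensor, hD, substOp_comp _ _ _ (commute_mulOp _ _), substOp_X_smul]
    simp only [mulOp, Algebra.lsmul_coe]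
    module
  | p i =>
    induction i using Fin.succAboveCases k with
    | x =>
      rw [update_comp_of_ne _ (fun i h => Fin.succAbove_ne k i (Fin.succAbove_right_injective h)),
        Function.update_self, Function.update_of_ne (Fin.ne_succAbove l k)]
      refine Eq.trans (congrArg _ (bracket_D_left F _ _)) ?_
      rw [map_neg, substOp_X_smul]
      rfl
    | p j =>
      rw [update_comp_of_injective (fun j => l.succAbove (k.succAbove j))
          (Fin.succAbove_right_injective.comp Fin.succAbove_right_injective),
        Function.update_of_ne (Fin.ne_succAbove l _), Function.update_of_ne
          (fun h => Fin.ne_succAbove k j (Fin.succAbove_right_injective h)),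
        hy (fun j => a (l.succAbove (k.succAbove j))) j, substOp_comp _ _ _ (commute_mulOp _ _)]
      simp only [mulOp, Algebra.lsmul_coe, neg_smul]

theorem IsSesq.d {q : ℕ} {f : Cnf F q} (hf : IsSesq f) : IsSesq ((adjointModule F).d q f) := by
  cases q with
  | zero => exact hf.dAct 0
  | succ q =>
    rw [ConformalModule.d, LinearMap.add_apply]
    refine IsSesq.add ?_ ?_
    · rw [LinearMap.sum_apply]
      exact IsSesq.sum fun k _ => (hf.dAct k).smul _
    · rw [LinearMap.sum_apply]
      refine IsSesq.sum fun l _ => ?_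
      rw [LinearMap.sum_apply]
      exact IsSesq.sum fun k _ => (hf.dBracket k l).smul _

theorem mapCoeff_smul {σ : Type*} (g : Module.End F (SV F)) (t : MvPolynomial σ F)
    (z : PolyMod σ F (SV F)) : mapCoeff σ g (t • z) = t • mapCoeff σ g z := by
  induction z using PolyMod.induction_on with
  | zero => simp
  | add x y hx hy => simp only [smul_add, map_add, hx, hy]
  | tmul p v => simp

theorem IsSesq.partialOp {q : ℕ} {f : Cnf F q} (hf : IsSesq f) :
    IsSesq ((adjointModule F).partialOp q f) := by
  intro a i
  change mapCoeff (Fin q) (D F) (f _) + (∑ i, .X i : MvPolynomial (Fin q) F) • f _ =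
    -((.X i : MvPolynomial (Fin q) F) • (mapCoeff (Fin q) (D F) (f _) +
      (∑ i, .X i : MvPolynomial (Fin q) F) • f _))
  rw [hf, map_neg, mapCoeff_smul, smul_neg, smul_comm _ (MvPolynomial.X i), smul_add, neg_add]

/-- The conformally antilinear map with the values `v` on generators. -/
def ofGen {q : ℕ} (v : (Fin q → Fin 3) → PolyMod (Fin q) F (SV F)) : Cnf F q :=
  ∑ g : Fin q → Fin 3, ((LinearMap.toSpanSingleton (MvPolynomial (Fin q) F)
    (PolyMod (Fin q) F (SV F)) (v g)).restrictScalars F).compMultilinearMap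
      ((MultilinearMap.mkPiAlgebra F (Fin q) (MvPolynomial (Fin q) F)).compLinearMap fun i =>
        (Polynomial.aeval (-.X i : MvPolynomial (Fin q) F)).toLinearMap ∘ₗ
          LinearMap.proj (R := F) (φ := fun _ : Fin 3 => F[X]) (g i))

theorem ofGen_apply {q : ℕ} (v : (Fin q → Fin 3) → PolyMod (Fin q) F (SV F)) (a : Fin q → SV F) :
    ofGen v a = ∑ g : Fin q → Fin 3,
      (∏ i, Polynomial.aeval (-.X i : MvPolynomial (Fin q) F) (a i (g i))) • v g := by
  rw [ofGen, MultilinearMap.sum_apply]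
  rfl

theorem ofGen_gen {q : ℕ} (v : (Fin q → Fin 3) → PolyMod (Fin q) F (SV F)) (g : Fin q → Fin 3) :
    ofGen v (fun i => gen F (g i)) = v g := by
  rw [ofGen_apply, Finset.sum_eq_single g]
  · simp [gen]
  · intro g' _ hg
    obtain ⟨i, hi⟩ := Function.ne_iff.1 hg
    rw [Finset.prod_eq_zero (Finset.mem_univ i), zero_smul]
    simp [gen, hi]
  · simp

theorem ofGen_isSesq {q : ℕ} (v : (Fin q → Fin 3) → PolyMod (Fin q) F (SV F)) :
    IsSesq (ofGen v) := by
  intro a i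
  rw [ofGen_apply, ofGen_apply, Finset.smul_sum, ← Finset.sum_neg_distrib]
  refine Finset.sum_congr rfl fun g _ => ?_
  rw [← Finset.mul_prod_erase _ _ (Finset.mem_univ i),
    ← Finset.mul_prod_erase Finset.univ (fun j => Polynomial.aeval _ (a j (g j)))
      (Finset.mem_univ i), ← mul_smul, ← neg_smul, Function.update_self]
  congr 1
  have h1 : (D F (a i)) (g i) = Polynomial.X * a i (g i) := rfl
  rw [h1, map_mul, Polynomial.aeval_X, Finset.prod_congr rfl fun j hj => by
    rw [Function.update_of_ne (Finset.ne_of_mem_erase hj)]]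
  ring

/-- Surjectivity of `toCoch` onto skew cochains of finite support. Finiteness lets the prescribed
coefficients be assembled into polynomials, which are values on generators of an antilinear map. -/
theorem exists_cochain {q : ℕ} {c : Coc F q} (hc : IsSkew q c)
    (hfin : {x | val (annBasis F) q c x ≠ 0}.Finite) :
    ∃ f ∈ (adjointModule F).cochains q, toCoch F q f = c := by
  have h1 : ∀ g : Fin q → Fin 3, ∃ z : PolyMod (Fin q) F (SV F),
      ∀ n, dc n z = val (annBasis F) q c fun i => (g i, n i) := by
    intro g
    refine exists_dc_eq _ (Set.Finite.preimage (f := fun n : Fin q → ℕ => fun i => (g i, n i))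
      (fun n _ n' _ h => ?_) hfin)
    funext i
    exact congrArg Prod.snd (congrFun h i)
  choose v hv using h1
  have hf : toCoch F q (ofGen v) = c := by
    refine ext_val (annBasis F) fun x => ?_
    rw [val_toCoch, ofGen_gen v fun i => (x i).1, hv]
  refine ⟨ofGen v, ⟨ofGen_isSesq v, fun σ a => ?_⟩, hf⟩
  set f := ofGen v
  -- Symmetry is checked on coefficients: `f'` is `f` with arguments and variables permuted, and it
  -- is again antilinear, so it can be compared with `sign(σ) f` by `ext_toCoch`.
  let f' : Cnf F q := (substVars (SV F) fun i => (.X (σ i) : MvPolynomial (Fin q) F)).compMultilinearMap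
    (f.domDomCongr σ)
  have hf' : IsSesq f' := by
    intro a i
    change substVars (SV F) _ (f fun j => Function.update a i _ (σ j)) = -(_ • substVars (SV F) _
      (f fun j => a (σ j)))
    obtain ⟨i, rfl⟩ := σ.surjective i
    rw [update_comp_of_injective σ σ.injective, ofGen_isSesq v (fun j => a (σ j)) i, map_neg,
      substVars_smul, MvPolynomial.aeval_X]
  have key : f' = ((σ.sign : ℤ) : F) • f := by
    refine hf'.ext_toCoch ((ofGen_isSesq v).smul _) (ext_val (annBasis F) fun x => ?_)
    rw [map_smul, hf, map_smul, val_toCoch]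
    change dc _ (substVars (SV F) _ (f fun i => gen F (x (σ i)).1)) = _
    rw [dc_perm, Pi.smul_apply, Int.cast_smul_eq_zsmul,
      ← (isSkew_iff_val (annBasis F) c).1 hc, ← hf, val_toCoch]
  have := congrArg (fun g : Cnf F q => g a) key
  refine this.trans ?_
  rw [smul_apply, Int.cast_smul_eq_zsmul]

end SchrodingerVirasoro

end

/-! ### Weights, the contracting homotopy from `L_(1)`, and injectivity of `L_(0)` -/

noncomputable section

namespace SchrodingerVirasoro

open PolyMod LieCochain

variable {F : Type u} [Field F] [CharZero F]

/-- Twice the conformal weight of `∂ ^ j v`, for the generator `v` with index `i`. -/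
def outWt (i : Fin 3) (j : ℕ) : ℤ := 4 - i.val + 2 * j

/-- Twice the weight of a basis vector of the annihilation Lie algebra. -/
def wt (x : Fin 3 × ℕ) : ℤ := 2 * x.2 - 2 + x.1.val

/-- The operator that multiplies `X ^ j` by `ψ j`. -/
def scale (ψ : ℕ → F) : Module.End F F[X] :=
  (Polynomial.basisMonomials F).constr F fun j => Polynomial.monomial j (ψ j)

theorem coeff_scale (ψ : ℕ → F) (p : F[X]) (j : ℕ) :
    (scale ψ p).coeff j = ψ j * p.coeff j := by
  induction p using Polynomial.induction_on' with
  | add p r hp hr => rw [map_add, Polynomial.coeff_add, hp, hr, Polynomial.coeff_add, mul_add]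
  | monomial n c =>
    have : scale ψ (Polynomial.monomial n 1) = Polynomial.monomial n (ψ n) := by
      have h := (Polynomial.basisMonomials F).constr_basis F
        (fun j => Polynomial.monomial j (ψ j)) n
      rwa [Polynomial.coe_basisMonomials] at h
    rw [← mul_one c, ← smul_eq_mul, ← Polynomial.smul_monomial, map_smul, this,
      Polynomial.coeff_smul, Polynomial.coeff_smul, Polynomial.coeff_monomial,
      Polynomial.coeff_monomial]
    split_ifs with h
    · subst h; simp [mul_comm]
    · simp

/-- The operator that multiplies the component of weight `w` by `φ w`. -/
def diag (φ : ℤ → F) : Module.End F (SV F) :=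
  LinearMap.pi fun i => scale (fun j => φ (outWt i j)) ∘ₗ LinearMap.proj i

theorem coeff_diag (φ : ℤ → F) (v : SV F) (i : Fin 3) (j : ℕ) :
    (diag φ v i).coeff j = φ (outWt i j) * (v i).coeff j := coeff_scale _ _ _

theorem sv_ext {v w : SV F} (h : ∀ i j, (v i).coeff j = (w i).coeff j) : v = w :=
  funext fun i => Polynomial.ext (h i)

theorem diag_diag (φ ψ : ℤ → F) (v : SV F) : diag φ (diag ψ v) = diag (fun w => φ w * ψ w) v :=
  sv_ext fun i j => by rw [coeff_diag, coeff_diag, coeff_diag, mul_assoc]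

theorem diag_add (φ ψ : ℤ → F) (v : SV F) :
    diag (fun w => φ w + ψ w) v = diag φ v + diag ψ v :=
  sv_ext fun i j => by
    rw [Pi.add_apply, Polynomial.coeff_add, coeff_diag, coeff_diag, coeff_diag, add_mul]

theorem diag_const (r : F) (v : SV F) : diag (fun _ => r) v = r • v :=
  sv_ext fun i j => by rw [coeff_diag, Pi.smul_apply, Polynomial.coeff_smul, smul_eq_mul]

theorem diag_D (φ : ℤ → F) (v : SV F) :
    diag φ (D F v) = D F (diag (fun w => φ (w + 2)) v) := by
  refine sv_ext fun i j => ?_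
  have h : ∀ u : SV F, D F u i = Polynomial.X * u i := fun u => rfl
  rw [coeff_diag, h, h]
  cases j with
  | zero => simp
  | succ j =>
    rw [Polynomial.coeff_X_mul, Polynomial.coeff_X_mul, coeff_diag]
    congr 2
    simp only [outWt]; push_cast; ring

theorem diag_gen (φ : ℤ → F) (i : Fin 3) : diag φ (gen F i) = φ (outWt i 0) • gen F i := by
  refine sv_ext fun k j => ?_
  rw [coeff_diag, Pi.smul_apply, Polynomial.coeff_smul, smul_eq_mul]
  by_cases h : k = i
  · subst h
    rw [gen, Pi.single_eq_same, Polynomial.coeff_one]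
    split_ifs with h
    · rw [h]
    · simp
  · rw [gen, Pi.single_eq_of_ne h]; simp

/-- A basis vector `x` lowers the weight in `SV` by `wt x`; in particular `L_(0) = ∂` raises it by
`2`. -/
theorem diag_lie (φ : ℤ → F) (x : Fin 3 × ℕ) (v : SV F) :
    diag φ ⁅annBasis F x, v⁆ = ⁅annBasis F x, diag (fun w => φ (w - wt x)) v⁆ := by
  obtain ⟨i, n⟩ := x
  induction v using induction generalizing φ n with
  | hgen j =>
    rw [annBasis_lie_gen, diag_gen, lie_smul, annBasis_lie_gen, map_add, map_smul, map_smul, diag_D,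
      diag_gen, diag_gen, map_smul (D F)]
    match n with
    | 0 =>
      fin_cases i <;> fin_cases j <;> simp [coefD, wt, outWt, smul_smul, mul_comm]
    | 1 =>
      fin_cases i <;> fin_cases j <;> simp [coefL, wt, outWt, smul_smul, mul_comm]
    | n + 2 => simp
  | hD v hv =>
    rw [annBasis_lie_D, map_add, map_smul, diag_D, hv, hv, diag_D, annBasis_lie_D]
    congr 1
    · congr 4; funext w; congr 1; ring
    · cases n with
      | zero => simp
      | succ n =>
        congr 5; funext w; congr 1; simp only [wt]; push_cast; ring
  | hadd v w hv hw => simp only [lie_add, map_add, hv, hw]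
  | hsmul c v hv => simp only [lie_smul, map_smul, hv]

/-- `L_(1)` acts by the conformal weight. The factor `2` removes the half-integers coming from `Y`.
-/
theorem L_one_lie (v : SV F) : (2 : F) • ⁅annBasis F (0, 1), v⁆ = diag (fun w => (w : F)) v := by
  induction v using induction with
  | hgen j =>
    rw [annBasis_lie_gen, diag_gen]
    fin_cases j <;> simp [coefL, outWt] <;> module
  | hD v hv =>
    rw [annBasis_lie_D, smul_add, diag_D, ← map_smul, hv]
    simp only [Int.cast_add]
    rw [diag_add (fun w => (w : F)), map_add, Int.cast_ofNat, diag_const, Nat.sub_self, L_zero_lie]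
    simp
  | hadd v w hv hw => simp only [lie_add, map_add, smul_add, hv, hw]
  | hsmul c v hv => rw [lie_smul, smul_comm, hv, map_smul]

/-- The operator on cochains that multiplies the component of weight `w` by `φ w`. -/
def diagC (φ : ℤ → F) {q : ℕ} (c : Coc F q) : Coc F q :=
  ofVal (annBasis F) q fun x => diag (fun w => φ (w + ∑ i, wt (x i))) (val (annBasis F) q c x)

theorem val_diagC (φ : ℤ → F) {q : ℕ} (c : Coc F q) (x : Fin q → Fin 3 × ℕ) :
    val (annBasis F) q (diagC φ c) x =
      diag (fun w => φ (w + ∑ i, wt (x i))) (val (annBasis F) q c x) := by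
  rw [diagC, val_ofVal]

theorem ins_diagC (φ : ℤ → F) {q : ℕ} (c : Coc F (q + 1)) (x : Fin 3 × ℕ) :
    ins (annBasis F x) (diagC φ c) = diagC (fun w => φ (w + wt x)) (ins (annBasis F x) c) := by
  refine ext_val (annBasis F) fun y => ?_
  rw [← val_cons, val_diagC, val_diagC, val_cons, Fin.sum_univ_succ]
  simp only [Fin.cons_zero, Fin.cons_succ, add_assoc, add_comm (wt x)]

theorem diagC_zero_deg (φ : ℤ → F) (c : Coc F 0) :
    zeroEquiv F (Ann F) (SV F) (diagC φ c) = diag φ (zeroEquiv F (Ann F) (SV F) c) := by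
  have := val_diagC φ c Fin.elim0
  rw [val_zero] at this
  rw [this]; simp [val_zero]

theorem diagC_sub (φ : ℤ → F) {q : ℕ} (c e : Coc F q) :
    diagC φ (c - e) = diagC φ c - diagC φ e := by
  refine ext_val (annBasis F) fun x => ?_
  simp only [map_sub, Pi.sub_apply, val_diagC]

theorem diagC_smul (φ : ℤ → F) {q : ℕ} (r : F) (c : Coc F q) :
    diagC φ (r • c) = r • diagC φ c := by
  refine ext_val (annBasis F) fun x => ?_
  simp only [map_smul, Pi.smul_apply, val_diagC]

theorem diagC_zero (φ : ℤ → F) {q : ℕ} : diagC φ (0 : Coc F q) = 0 := by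
  rw [← zero_smul F (0 : Coc F q), diagC_smul, zero_smul, zero_smul]

/-- Additivity could fail only through the truncated exponent or the wrap-around of the index in
`annMul`; in both situations the structure constant is zero. -/
theorem wt_annMul {x y : Fin 3 × ℕ} (h : annCoef F x y ≠ 0) : wt (annMul x y) = wt x + wt y := by
  obtain ⟨i, m⟩ := x
  obtain ⟨j, n⟩ := y
  have h1 : m + n ≠ 0 := by
    rintro h0
    obtain ⟨rfl, rfl⟩ : m = 0 ∧ n = 0 := by omega
    simp [annCoef] at h
  have h2 : ((m + n - 1 : ℕ) : ℤ) = m + n - 1 := by omega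
  fin_cases i <;> fin_cases j <;>
    first
    | (simp [annCoef, coefD, coefL] at h; done)
    | (simp only [wt, annMul, h2]; simp; ring)

theorem diagC_lie (φ : ℤ → F) {q : ℕ} (x : Fin 3 × ℕ) (c : Coc F q) :
    diagC φ ⁅annBasis F x, c⁆ = ⁅annBasis F x, diagC (fun w => φ (w - wt x)) c⁆ := by
  induction q generalizing φ with
  | zero =>
    apply (zeroEquiv F (Ann F) (SV F)).injective
    rw [diagC_zero_deg, zeroEquiv_lie, zeroEquiv_lie, diagC_zero_deg, diag_lie]
  | succ q ih =>
    refine ext_ins_basis (annBasis F) fun y => ?_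
    rw [ins_diagC, ins_lie, ins_lie, ins_diagC, diagC_sub, ih]
    congr 1
    · congr 2; funext w; congr 1; ring
    · rw [annBasis_lie, ins_smul_left, ins_smul_left, diagC_smul]
      by_cases h : annCoef F x y = 0
      · simp [h]
      · rw [ins_diagC, wt_annMul h]
        congr 2; funext w; congr 1; ring

/-- The action and the bracket respect weights, so the differential preserves the weight of a
cochain. -/
theorem diff_diagC (φ : ℤ → F) {q : ℕ} (c : Coc F q) : diff q (diagC φ c) = diagC φ (diff q c) := by
  induction q generalizing φ with
  | zero =>
    refine ext_ins_basis (annBasis F) fun y => ?_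
    rw [ins_diagC, ins_diff_zero, ins_diff_zero, diagC_lie]
    simp
  | succ q ih =>
    refine ext_ins_basis (annBasis F) fun y => ?_
    rw [ins_diagC, ins_diff, ins_diff, ins_diagC, ih, diagC_sub, diagC_lie]
    simp

theorem annCoef_L_one (y : Fin 3 × ℕ) :
    ⁅annBasis F (0, 1), annBasis F y⁆ = (-(wt y : F) / 2) • annBasis F y := by
  obtain ⟨j, n⟩ := y
  have h1 : annMul (0, 1) (j, n) = (j, n) := by simp [annMul]
  rw [annBasis_lie, h1]
  congr 1
  fin_cases j <;> simp [annCoef, coefD, coefL, wt] <;> ring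

theorem L_one_lie_coch {q : ℕ} (c : Coc F q) :
    (2 : F) • ⁅annBasis F (0, 1), c⁆ = diagC (fun w => (w : F)) c := by
  induction q with
  | zero =>
    apply (zeroEquiv F (Ann F) (SV F)).injective
    rw [diagC_zero_deg, map_smul, zeroEquiv_lie, L_one_lie]
  | succ q ih =>
    refine ext_ins_basis (annBasis F) fun y => ?_
    have h : diagC (fun w => ((w + wt y : ℤ) : F)) (ins (annBasis F y) c) =
        diagC (fun w => (w : F)) (ins (annBasis F y) c) + (wt y : F) • ins (annBasis F y) c := by
      refine ext_val (annBasis F) fun x => ?_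
      rw [map_add, Pi.add_apply, map_smul, Pi.smul_apply, val_diagC, val_diagC, ← diag_const,
        ← diag_add]
      congr 2; funext w; push_cast; ring
    rw [ins_diagC, h, map_smul, ins_lie, smul_sub, ih, annCoef_L_one, ins_smul_left, smul_smul,
      sub_eq_add_neg, ← neg_smul]
    congr 2
    ring

/-- The component of weight zero. -/
def weightZero {q : ℕ} (c : Coc F q) : Coc F q := diagC (fun w => if w = 0 then 1 else 0) c

/-- The inverse of `L_(1)` on the components of nonzero weight. -/
def greenOp {q : ℕ} (c : Coc F q) : Coc F q := diagC (fun w => 2 * (w : F)⁻¹) c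

/-- `L_(1)` multiplies weight `w` by `w / 2` and `greenOp` by `2 / w`. The convention `0⁻¹ = 0`
makes `greenOp` vanish on weight zero. -/
theorem L_one_lie_greenOp {q : ℕ} (c : Coc F q) :
    ⁅annBasis F (0, 1), greenOp c⁆ = c - weightZero c := by
  have h : (2 : F) • ⁅annBasis F (0, 1), greenOp c⁆ = (2 : F) • (c - weightZero c) := by
    rw [L_one_lie_coch]
    refine ext_val (annBasis F) fun x => ?_
    rw [map_smul, Pi.smul_apply, map_sub, Pi.sub_apply, val_diagC, greenOp, val_diagC, weightZero,
      val_diagC, diag_diag]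
    refine sv_ext fun i j => ?_
    rw [Pi.smul_apply, Polynomial.coeff_smul, Pi.sub_apply, Polynomial.coeff_sub, coeff_diag,
      coeff_diag, smul_eq_mul]
    split_ifs with h0
    · rw [h0]; simp
    · have : ((outWt i j + ∑ i, wt (x i) : ℤ) : F) ≠ 0 := Int.cast_ne_zero.2 h0
      field_simp; ring
  exact (smul_right_inj (two_ne_zero (α := F))).1 h

/-- In degree zero, multiplication by the variable of `F[X]` is injective. In higher degree,
`[L_(0), x_(n)] = -n x_(n-1)`: if the insertion of `x_(n-1)` is zero, the insertion of `x_(n)` is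
killed by `L_(0)`, hence zero by induction on the degree. For `n = 0` the bracket vanishes and
starts the induction. -/
theorem L_zero_lie_injective {q : ℕ} {c : Coc F q} (h : ⁅annBasis F (0, 0), c⁆ = 0) : c = 0 := by
  induction q with
  | zero =>
    apply (zeroEquiv F (Ann F) (SV F)).injective
    have := congrArg (zeroEquiv F (Ann F) (SV F)) h
    rw [zeroEquiv_lie, L_zero_lie, map_zero] at this
    rw [map_zero]
    funext i
    have h2 : (Polynomial.X : F[X]) * zeroEquiv F (Ann F) (SV F) c i = 0 := congrFun this i
    exact (mul_eq_zero.1 h2).resolve_left Polynomial.X_ne_zero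
  | succ q ih =>
    refine ext_ins_basis (annBasis F) fun y => ?_
    obtain ⟨i, n⟩ := y
    rw [map_zero]
    induction n with
    | zero =>
      have := congrArg (ins (annBasis F (i, 0))) h
      rw [ins_lie, annBasis_lie] at this
      exact ih (by simpa [annCoef, ins_zero_left] using this)
    | succ n ihn =>
      have := congrArg (ins (annBasis F (i, n + 1))) h
      have h2 : annMul (0, 0) (i, n + 1) = (i, n) := by simp [annMul]
      rw [ins_lie, annBasis_lie, h2, ins_smul_left, ihn] at this
      exact ih (by simpa using this)

variable (F) in
/-- The skew-symmetric cochains of finite support. -/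
def coch (q : ℕ) : Submodule F (Coc F q) where
  carrier := {c | IsSkew q c ∧ {x | val (annBasis F) q c x ≠ 0}.Finite}
  zero_mem' := ⟨isSkew_zero, by simp⟩
  add_mem' {c e} hc he := by
    refine ⟨?_, (hc.2.union he.2).subset fun x hx => ?_⟩
    · rw [← sub_neg_eq_add, ← neg_one_smul F]
      exact hc.1.sub (he.1.smul _)
    · by_contra h
      simp only [Set.mem_union, Set.mem_ofPred_eq, not_or, not_not] at h
      exact hx (by rw [map_add, Pi.add_apply, h.1, h.2, add_zero])
  smul_mem' r c hc := by
    refine ⟨hc.1.smul r, hc.2.subset fun x hx h => hx ?_⟩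
    rw [map_smul, Pi.smul_apply, h, smul_zero]

theorem ins_mem_coch {q : ℕ} {c : Coc F (q + 1)} (hc : c ∈ coch F (q + 1)) (x : Fin 3 × ℕ) :
    ins (annBasis F x) c ∈ coch F q := by
  refine ⟨hc.1.insert _, (hc.2.preimage
    (f := fun y : Fin q → Fin 3 × ℕ => (Fin.cons x y : Fin (q + 1) → Fin 3 × ℕ))
      (Fin.cons_right_injective (α := fun _ => Fin 3 × ℕ) x).injOn).subset fun y hy => ?_⟩
  rw [Set.mem_preimage, Set.mem_ofPred_eq, val_cons]
  exact hy

theorem diagC_mem_coch (φ : ℤ → F) {q : ℕ} {c : Coc F q} (hc : c ∈ coch F q) :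
    diagC φ c ∈ coch F q := by
  refine ⟨(isSkew_iff_val (annBasis F) _).2 fun σ x => ?_, hc.2.subset fun x hx h => hx ?_⟩
  · rw [val_diagC, val_diagC, (isSkew_iff_val (annBasis F) c).1 hc.1, map_zsmul,
      Equiv.sum_comp σ fun i => wt (x i)]
  · rw [val_diagC, h, map_zero]

/-- A cocycle is cohomologous to its component of weight zero. -/
theorem cocycle_sub_weightZero {q : ℕ} {c : Coc F (q + 1)} (hc : c ∈ coch F (q + 1))
    (hd : diff (q + 1) c = 0) : ∃ e ∈ coch F q, c - weightZero c = diff q e := by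
  refine ⟨_, ins_mem_coch (diagC_mem_coch (fun w => 2 * (w : F)⁻¹) hc) (0, 1), ?_⟩
  -- `greenOp` commutes with the differential, so `greenOp c` is a cocycle, and Cartan's formula for
  -- `L_(1)` exhibits `L_(1) · greenOp c` as a coboundary.
  have h := ins_diff (annBasis F (0, 1)) (greenOp c)
  rw [greenOp, diff_diagC, hd, diagC_zero, map_zero, ← greenOp, L_one_lie_greenOp, eq_comm,
    sub_eq_zero] at h
  exact h

/-- In degree zero Cartan's formula has no `d ι` term, so the cocycle equals its component of weight
zero. -/
theorem cocycle_zero_sub_weightZero {c : Coc F 0} (hd : diff 0 c = 0) : c = weightZero c := by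
  have h := ins_diff_zero (annBasis F (0, 1)) (greenOp c)
  rw [greenOp, diff_diagC, hd, diagC_zero, map_zero, ← greenOp, L_one_lie_greenOp, eq_comm,
    sub_eq_zero] at h
  exact h

end SchrodingerVirasoro

end

/-! ### Cochains of weight zero: reduction to finitely many tuples -/

noncomputable section

namespace SchrodingerVirasoro

open PolyMod LieCochain

variable {F : Type u} [Field F] [CharZero F]

theorem gen_apply_coeff (i k : Fin 3) (j : ℕ) :
    (gen F i k).coeff j = if i = k ∧ j = 0 then 1 else 0 := by
  by_cases h : k = i
  · subst h
    rw [gen, Pi.single_eq_same, Polynomial.coeff_one]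
    simp
  · rw [gen, Pi.single_eq_of_ne h, if_neg (by tauto)]; simp

/-- The skew-symmetric cochains of weight zero. -/
structure IsWeightZero {q : ℕ} (c : Coc F q) : Prop where
  skew : IsSkew q c
  coeff_eq_zero : ∀ (x : Fin q → Fin 3 × ℕ) (i : Fin 3) (j : ℕ), outWt i j + ∑ k, wt (x k) ≠ 0 →
    (val (annBasis F) q c x i).coeff j = 0

theorem isWeightZero_weightZero {q : ℕ} {c : Coc F q} (hc : IsSkew q c) :
    IsWeightZero (weightZero c) := by
  refine ⟨(isSkew_iff_val (annBasis F) _).2 fun σ x => ?_, fun x i j h => ?_⟩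
  · rw [weightZero, val_diagC, val_diagC, (isSkew_iff_val (annBasis F) c).1 hc, map_zsmul,
      Equiv.sum_comp σ fun i => wt (x i)]
  · rw [weightZero, val_diagC, coeff_diag, if_neg h, zero_mul]

theorem IsWeightZero.weightZero_eq {q : ℕ} {c : Coc F q} (hc : IsWeightZero c) :
    weightZero c = c := by
  refine ext_val (annBasis F) fun x => sv_ext fun i j => ?_
  rw [weightZero, val_diagC, coeff_diag]
  split_ifs with h
  · rw [one_mul]
  · rw [hc.coeff_eq_zero x i j h, zero_mul]

theorem IsWeightZero.differential {q : ℕ} {c : Coc F q} (hc : IsWeightZero c) :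
    IsWeightZero (diff q c) := by
  rw [← hc.weightZero_eq, weightZero, diff_diagC]
  exact isWeightZero_weightZero hc.skew.differential

theorem IsWeightZero.sub {q : ℕ} {c e : Coc F q} (hc : IsWeightZero c) (he : IsWeightZero e) :
    IsWeightZero (c - e) := by
  refine ⟨hc.skew.sub he.skew, fun x i j h => ?_⟩
  rw [map_sub, Pi.sub_apply, Pi.sub_apply, Polynomial.coeff_sub, hc.coeff_eq_zero x i j h,
    he.coeff_eq_zero x i j h, sub_zero]

theorem IsWeightZero.smul {q : ℕ} {c : Coc F q} (hc : IsWeightZero c) (r : F) :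
    IsWeightZero (r • c) := by
  refine ⟨hc.skew.smul r, fun x i j h => ?_⟩
  rw [map_smul, Pi.smul_apply, Pi.smul_apply, Polynomial.coeff_smul, hc.coeff_eq_zero x i j h,
    smul_zero]

/-- All weights in `SV` are at least `2`. The weight `2` occurs only for `M` and the weight `3` only
for `Y`, which gives the two lemmas that follow. -/
theorem IsWeightZero.val_eq_zero {q : ℕ} {c : Coc F q} (hc : IsWeightZero c)
    {x : Fin q → Fin 3 × ℕ} (h : -2 < ∑ k, wt (x k)) : val (annBasis F) q c x = 0 :=
  sv_ext fun i j => by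
    rw [hc.coeff_eq_zero x i j (by simp only [outWt]; omega)]; rfl

theorem IsWeightZero.val_eq_M {q : ℕ} {c : Coc F q} (hc : IsWeightZero c)
    {x : Fin q → Fin 3 × ℕ} (h : ∑ k, wt (x k) = -2) :
    val (annBasis F) q c x = (val (annBasis F) q c x 2).coeff 0 • gen F 2 :=
  sv_ext fun i j => by
    rw [Pi.smul_apply, Polynomial.coeff_smul, gen_apply_coeff]
    split_ifs with h2
    · rw [← h2.1, h2.2]; simp
    · rw [hc.coeff_eq_zero x i j, smul_zero]
      rw [h, outWt]
      intro h3
      exact h2 ⟨Fin.ext (by simp; omega), by omega⟩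

theorem IsWeightZero.val_eq_Y {q : ℕ} {c : Coc F q} (hc : IsWeightZero c)
    {x : Fin q → Fin 3 × ℕ} (h : ∑ k, wt (x k) = -3) :
    val (annBasis F) q c x = (val (annBasis F) q c x 1).coeff 0 • gen F 1 :=
  sv_ext fun i j => by
    rw [Pi.smul_apply, Polynomial.coeff_smul, gen_apply_coeff]
    split_ifs with h2
    · rw [← h2.1, h2.2]; simp
    · rw [hc.coeff_eq_zero x i j, smul_zero]
      rw [h, outWt]
      intro h3
      exact h2 ⟨Fin.ext (by simp; omega), by omega⟩

theorem injective_of_val_ne_zero {q : ℕ} {c : Coc F q} (hc : IsSkew q c)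
    {x : Fin q → Fin 3 × ℕ} (h : val (annBasis F) q c x ≠ 0) : Function.Injective x := by
  intro i j hij
  by_contra hne
  have h1 := (isSkew_iff_val (annBasis F) c).1 hc (Equiv.swap i j) x
  rw [Equiv.Perm.sign_swap hne] at h1
  have h2 : (fun k => x (Equiv.swap i j k)) = x := by
    funext k
    rw [Equiv.swap_apply_def]
    split_ifs with h3 h4
    · rw [h3, hij]
    · rw [h4, hij]
    · rfl
  rw [h2] at h1
  simp only [Units.val_neg, Units.val_one, neg_smul, one_smul] at h1
  have h4 : (2 : F) • val (annBasis F) q c x = 0 := by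
    rw [two_smul]; nth_rw 1 [h1]; simp
  exact h ((smul_eq_zero.1 h4).resolve_left two_ne_zero)

/-- The basis vectors of the annihilation algebra of weight at most `1`. -/
def core : Finset (Fin 3 × ℕ) := {(0, 0), (0, 1), (1, 0), (1, 1), (2, 0)}

/-- Only `L_(0)` and `Y_(0)` have negative weight, namely `-2` and `-1`, and each occurs at most
once in a set. -/
theorem sum_wt_ge (S : Finset (Fin 3 × ℕ)) : -3 ≤ ∑ x ∈ S, wt x := by
  have h : ∑ x ∈ S, ((if x = (0, 0) then -2 else 0) + (if x = (1, 0) then -1 else 0) : ℤ) ≤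
      ∑ x ∈ S, wt x := by
    refine Finset.sum_le_sum fun x _ => ?_
    obtain ⟨i, n⟩ := x
    fin_cases i <;> simp only [Prod.mk.injEq, wt] <;> split_ifs <;> simp_all <;> omega
  rw [Finset.sum_add_distrib, Finset.sum_ite_eq', Finset.sum_ite_eq'] at h
  refine le_trans ?_ h
  split_ifs <;> norm_num

/-- The other elements of `S` contribute at least `-3`, so each single element has weight at most
`1`. -/
theorem mem_core {S : Finset (Fin 3 × ℕ)} (hS : ∑ x ∈ S, wt x ≤ -2) : S ⊆ core := by
  intro x hx
  have h1 := Finset.add_sum_erase S wt hx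
  have h2 := sum_wt_ge (S.erase x)
  obtain ⟨i, n⟩ := x
  have h3 : wt (i, n) ≤ 1 := by omega
  simp only [wt] at h3
  have h4 : n = 0 ∨ n = 1 := by omega
  rcases h4 with rfl | rfl <;> fin_cases i <;> simp [core] at h3 ⊢

theorem exists_perm {α : Type*} [DecidableEq α] {q : ℕ} {x t : Fin q → α}
    (hx : Function.Injective x) (h : Finset.univ.image x = Finset.univ.image t) :
    ∃ σ : Equiv.Perm (Fin q), ∀ i, x i = t (σ i) := by
  have h1 : ∀ i, ∃ j, x i = t j := fun i => by
    have : x i ∈ Finset.univ.image t := by rw [← h]; simp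
    obtain ⟨j, -, hj⟩ := Finset.mem_image.1 this
    exact ⟨j, hj.symm⟩
  choose f hf using h1
  have hinj : Function.Injective f := fun i j hij => hx (by rw [hf, hf, hij])
  exact ⟨Equiv.ofBijective f (Finite.injective_iff_bijective.1 hinj), hf⟩

/-- A nonzero value needs distinct arguments of total weight at most `-2`. The list contains an
ordering of each such set, so that its completeness in a given degree is a finite check, and
skew-symmetry covers the other orderings. -/
theorem IsWeightZero.eq_zero {q : ℕ} {c : Coc F q} (hc : IsWeightZero c)
    (L : List (Fin q → Fin 3 × ℕ))
    (hL : ∀ S ∈ core.powersetCard q, ∑ x ∈ S, wt x ≤ -2 →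
      ∃ t ∈ L, S = Finset.univ.image t)
    (h : ∀ t ∈ L, val (annBasis F) q c t = 0) : c = 0 := by
  refine ext_val (annBasis F) fun x => ?_
  rw [map_zero, Pi.zero_apply]
  by_contra hx
  have hinj := injective_of_val_ne_zero hc.skew hx
  have hsum : ∑ a ∈ Finset.univ.image x, wt a = ∑ i, wt (x i) :=
    Finset.sum_image fun i _ j _ hij => hinj hij
  have hle : ∑ a ∈ Finset.univ.image x, wt a ≤ -2 := by
    by_contra hlt
    exact hx (hc.val_eq_zero (by rw [← hsum]; exact not_le.1 hlt))
  obtain ⟨t, ht, hSt⟩ := hL (Finset.univ.image x) (Finset.mem_powersetCard.2 ⟨mem_core hle, by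
    rw [Finset.card_image_of_injective _ hinj, Finset.card_fin]⟩) hle
  obtain ⟨σ, hσ⟩ := exists_perm hinj hSt
  have := (isSkew_iff_val (annBasis F) c).1 hc.skew σ t
  rw [h t ht, smul_zero, ← funext hσ] at this
  exact hx this

theorem IsWeightZero.eq_zero_deg_zero {c : Coc F 0} (hc : IsWeightZero c) : c = 0 :=
  hc.eq_zero [] (by decide) (by simp)

/-- `core` has only five elements. -/
theorem IsWeightZero.eq_zero_deg_ge {q : ℕ} (hq : 6 ≤ q) {c : Coc F q} (hc : IsWeightZero c) :
    c = 0 :=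
  hc.eq_zero [] (by
    rw [Finset.powersetCard_eq_empty.2 (lt_of_lt_of_le (by decide) hq)]; simp) (by simp)

theorem IsWeightZero.eq_zero_deg_one {c : Coc F 1} (hc : IsWeightZero c)
    (h : val (annBasis F) 1 c ![(0, 0)] = 0) : c = 0 :=
  hc.eq_zero [![(0, 0)]] (by decide) (by simpa using h)

theorem IsWeightZero.eq_zero_deg_two {c : Coc F 2} (hc : IsWeightZero c)
    (h1 : val (annBasis F) 2 c ![(0, 0), (2, 0)] = 0)
    (h2 : val (annBasis F) 2 c ![(0, 0), (1, 0)] = 0)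
    (h3 : val (annBasis F) 2 c ![(0, 0), (0, 1)] = 0) : c = 0 :=
  hc.eq_zero [![(0, 0), (2, 0)], ![(0, 0), (1, 0)], ![(0, 0), (0, 1)]] (by decide)
    (by simp [h1, h2, h3])

theorem IsWeightZero.eq_zero_deg_three {c : Coc F 3} (hc : IsWeightZero c)
    (h1 : val (annBasis F) 3 c ![(0, 0), (1, 0), (1, 1)] = 0)
    (h2 : val (annBasis F) 3 c ![(0, 0), (1, 0), (2, 0)] = 0)
    (h3 : val (annBasis F) 3 c ![(0, 0), (0, 1), (2, 0)] = 0)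
    (h4 : val (annBasis F) 3 c ![(0, 0), (0, 1), (1, 0)] = 0) : c = 0 :=
  hc.eq_zero [![(0, 0), (1, 0), (1, 1)], ![(0, 0), (1, 0), (2, 0)], ![(0, 0), (0, 1), (2, 0)],
    ![(0, 0), (0, 1), (1, 0)]] (by decide) (by simp [h1, h2, h3, h4])

theorem IsWeightZero.eq_zero_deg_four {c : Coc F 4} (hc : IsWeightZero c)
    (h1 : val (annBasis F) 4 c ![(0, 0), (1, 0), (1, 1), (2, 0)] = 0)
    (h2 : val (annBasis F) 4 c ![(0, 0), (0, 1), (1, 0), (1, 1)] = 0)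
    (h3 : val (annBasis F) 4 c ![(0, 0), (0, 1), (1, 0), (2, 0)] = 0) : c = 0 :=
  hc.eq_zero [![(0, 0), (1, 0), (1, 1), (2, 0)], ![(0, 0), (0, 1), (1, 0), (1, 1)],
    ![(0, 0), (0, 1), (1, 0), (2, 0)]] (by decide) (by simp [h1, h2, h3])

theorem IsWeightZero.eq_zero_deg_five {c : Coc F 5} (hc : IsWeightZero c)
    (h : val (annBasis F) 5 c ![(0, 0), (0, 1), (1, 0), (1, 1), (2, 0)] = 0) : c = 0 :=
  hc.eq_zero [![(0, 0), (0, 1), (1, 0), (1, 1), (2, 0)]] (by decide) (by simp [h])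

/-- The skew-symmetric cochain with value `v` on the tuple `t`. -/
def altDelta {q : ℕ} (t : Fin q → Fin 3 × ℕ) (v : SV F) : Coc F q :=
  ofVal (annBasis F) q fun x =>
    (Matrix.of fun i j => if x i = t j then (1 : F) else 0).det • v

/-- For injective `t` the determinant is the sign of the reordering when `x` permutes `t`, and zero
otherwise. Skew-symmetry is thus the behaviour of a determinant under row permutations. -/
theorem val_altDelta {q : ℕ} (t : Fin q → Fin 3 × ℕ) (v : SV F) (x : Fin q → Fin 3 × ℕ) :
    val (annBasis F) q (altDelta t v) x =
      (Matrix.of fun i j => if x i = t j then (1 : F) else 0).det • v := by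
  rw [altDelta, val_ofVal]

theorem val_altDelta_self {q : ℕ} {t : Fin q → Fin 3 × ℕ} (ht : Function.Injective t) (v : SV F) :
    val (annBasis F) q (altDelta t v) t = v := by
  have : (Matrix.of fun i j => if t i = t j then (1 : F) else 0) = 1 := by
    ext i j
    simp [Matrix.one_apply, ht.eq_iff]
  rw [val_altDelta, this, Matrix.det_one, one_smul]

theorem val_altDelta_of_notMem {q : ℕ} {t : Fin q → Fin 3 × ℕ} (v : SV F) {x : Fin q → Fin 3 × ℕ}
    (j : Fin q) (h : ∀ i, x i ≠ t j) : val (annBasis F) q (altDelta t v) x = 0 := by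
  rw [val_altDelta, Matrix.det_eq_zero_of_column_eq_zero j, zero_smul]
  intro i
  simp [h i]

theorem altDelta_skew {q : ℕ} (t : Fin q → Fin 3 × ℕ) (v : SV F) : IsSkew q (altDelta t v) := by
  refine (isSkew_iff_val (annBasis F) _).2 fun σ x => ?_
  rw [val_altDelta, val_altDelta, ← Int.cast_smul_eq_zsmul F, smul_smul, ← Matrix.det_permute]
  rfl

theorem altDelta_mem_coch {q : ℕ} (t : Fin q → Fin 3 × ℕ) (v : SV F) :
    altDelta t v ∈ coch F q := by
  refine ⟨altDelta_skew t v, (Set.Finite.pi' fun _ : Fin q => Set.finite_range t).subset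
    fun x hx i => ?_⟩
  by_contra h
  refine hx ?_
  rw [val_altDelta, Matrix.det_eq_zero_of_row_eq_zero i, zero_smul]
  intro j
  simp only [Matrix.of_apply, ite_eq_right_iff, one_ne_zero, imp_false]
  exact fun e => h ⟨j, e.symm⟩

theorem altDelta_isWeightZero {q : ℕ} {t : Fin q → Fin 3 × ℕ} {i : Fin 3}
    (ht : outWt i 0 + ∑ k, wt (t k) = 0) (r : F) : IsWeightZero (altDelta t (r • gen F i)) := by
  refine ⟨altDelta_skew t _, fun x k j h => ?_⟩
  by_cases hx : val (annBasis F) q (altDelta t (r • gen F i)) x = 0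
  · rw [hx]; simp
  have hinj := injective_of_val_ne_zero (altDelta_skew _ _) hx
  have h1 : ∀ j, ∃ i, t j = x i := by
    intro j
    by_contra h2
    simp only [not_exists] at h2
    exact hx (val_altDelta_of_notMem _ j fun i e => h2 i e.symm)
  choose f hf using h1
  -- If `f` is injective, `x` is a reordering of `t` and has the same total weight. Otherwise `t`
  -- has a repeated entry and the determinant two equal columns.
  by_cases hfinj : Function.Injective f
  · have hb := Finite.injective_iff_bijective.1 hfinj
    have hs : ∑ k, wt (t k) = ∑ k, wt (x k) := by
      simp only [hf]
      exact (Equiv.ofBijective f hb).sum_comp fun k => wt (x k)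
    rw [val_altDelta, Pi.smul_apply, Pi.smul_apply, Polynomial.coeff_smul, Polynomial.coeff_smul,
      gen_apply_coeff, if_neg, smul_zero, smul_zero]
    rintro ⟨rfl, rfl⟩
    exact h (by rw [← hs, ht])
  · exfalso
    refine hx ?_
    simp only [Function.Injective, not_forall] at hfinj
    obtain ⟨a, b, hab, hne⟩ := hfinj
    rw [val_altDelta, Matrix.det_zero_of_column_eq hne, zero_smul]
    intro i
    simp [hf, hab]

end SchrodingerVirasoro

end

/-! ### The differential on cochains of weight zero -/

noncomputable section

/-- The vectors `w i` of `Z` form a basis modulo `B`. -/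
structure IsBasisMod {F V : Type*} [Field F] [AddCommGroup V] [Module F V] {n : ℕ}
    (Z B : Submodule F V) (w : Fin n → V) : Prop where
  mem : ∀ i, w i ∈ Z
  span : ∀ z ∈ Z, ∃ k : Fin n → F, z - ∑ i, k i • w i ∈ B
  indep : ∀ k : Fin n → F, ∑ i, k i • w i ∈ B → k = 0

namespace SchrodingerVirasoro

open PolyMod LieCochain

variable {F : Type u} [Field F] [CharZero F]

theorem val_one (c : Coc F 1) (x : Fin 3 × ℕ) :
    zeroEquiv F (Ann F) (SV F) (ins (annBasis F x) c) = val (annBasis F) 1 c ![x] := by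
  simp [val_succ, val_zero]

theorem val_two (c : Coc F 2) (x y : Fin 3 × ℕ) :
    zeroEquiv F (Ann F) (SV F) (ins (annBasis F y) (ins (annBasis F x) c)) =
      val (annBasis F) 2 c ![x, y] := by
  simp [val_succ, val_zero]

theorem val_three (c : Coc F 3) (x y z : Fin 3 × ℕ) :
    zeroEquiv F (Ann F) (SV F) (ins (annBasis F z) (ins (annBasis F y) (ins (annBasis F x) c))) =
      val (annBasis F) 3 c ![x, y, z] := by
  simp [val_succ, val_zero]

theorem val_four (c : Coc F 4) (x y z w : Fin 3 × ℕ) :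
    zeroEquiv F (Ann F) (SV F)
        (ins (annBasis F w) (ins (annBasis F z) (ins (annBasis F y) (ins (annBasis F x) c)))) =
      val (annBasis F) 4 c ![x, y, z, w] := by
  simp [val_succ, val_zero]

theorem val_eq_zero_of_not_injective {q : ℕ} {c : Coc F q} (hc : IsSkew q c)
    {x : Fin q → Fin 3 × ℕ} (h : ¬ Function.Injective x) : val (annBasis F) q c x = 0 :=
  by_contra fun h2 => h (injective_of_val_ne_zero hc h2)

/-- The coefficient of the generator with index `i` in the value of a cochain at the tuple `t`. -/
def coefAt {q : ℕ} (t : Fin q → Fin 3 × ℕ) (i : Fin 3) : Coc F q →ₗ[F] F :=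
  Polynomial.lcoeff F 0 ∘ₗ LinearMap.proj i ∘ₗ LinearMap.proj t ∘ₗ val (annBasis F) q

theorem coefAt_apply {q : ℕ} (t : Fin q → Fin 3 × ℕ) (i : Fin 3) (c : Coc F q) :
    coefAt t i c = (val (annBasis F) q c t i).coeff 0 := rfl

theorem coefAt_altDelta_self {q : ℕ} {t : Fin q → Fin 3 × ℕ} (ht : Function.Injective t)
    (i : Fin 3) (r : F) : coefAt t i (altDelta t (r • gen F i)) = r := by
  rw [coefAt_apply, val_altDelta_self ht, Pi.smul_apply, Polynomial.coeff_smul, gen_apply_coeff]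
  simp

theorem coefAt_altDelta_of_notMem {q : ℕ} {t x : Fin q → Fin 3 × ℕ} (i : Fin 3) (v : SV F)
    (h : ∃ j, ∀ i, x i ≠ t j) : coefAt x i (altDelta t v) = 0 := by
  obtain ⟨j, hj⟩ := h
  rw [coefAt_apply, val_altDelta_of_notMem v j hj]
  simp

theorem smul_gen_eq_zero {r : F} {i : Fin 3} : r • gen F i = 0 ↔ r = 0 := by
  refine ⟨fun h => ?_, fun h => by rw [h, zero_smul]⟩
  have := congrArg (fun v : SV F => (v i).coeff 0) h
  rw [Pi.smul_apply, Polynomial.coeff_smul, gen_apply_coeff] at this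
  simpa using this

/-- In the names of this and the following lemmas, `l`, `h`, `y`, `z`, `m` stand for `L_(0)`,
`L_(1)`, `Y_(0)`, `Y_(1)`, `M_(0)`. Total weight `-2` gives a multiple of `M`, and `-3`, where `y`
occurs without `z`, a multiple of `Y`. -/
theorem IsWeightZero.val_l {c : Coc F 1} (hc : IsWeightZero c) :
    val (annBasis F) 1 c ![(0, 0)] = coefAt ![(0, 0)] 2 c • gen F 2 :=
  hc.val_eq_M (by simp [wt])

theorem IsWeightZero.val_lm {c : Coc F 2} (hc : IsWeightZero c) :
    val (annBasis F) 2 c ![(0, 0), (2, 0)] = coefAt ![(0, 0), (2, 0)] 2 c • gen F 2 :=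
  hc.val_eq_M (by simp [wt])

theorem IsWeightZero.val_lh {c : Coc F 2} (hc : IsWeightZero c) :
    val (annBasis F) 2 c ![(0, 0), (0, 1)] = coefAt ![(0, 0), (0, 1)] 2 c • gen F 2 :=
  hc.val_eq_M (by simp [wt])

theorem IsWeightZero.val_ly {c : Coc F 2} (hc : IsWeightZero c) :
    val (annBasis F) 2 c ![(0, 0), (1, 0)] = coefAt ![(0, 0), (1, 0)] 1 c • gen F 1 :=
  hc.val_eq_Y (by simp [wt])

theorem IsWeightZero.val_lyz {c : Coc F 3} (hc : IsWeightZero c) :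
    val (annBasis F) 3 c ![(0, 0), (1, 0), (1, 1)] =
      coefAt ![(0, 0), (1, 0), (1, 1)] 2 c • gen F 2 :=
  hc.val_eq_M (by simp [wt, Fin.sum_univ_three])

theorem IsWeightZero.val_lhm {c : Coc F 3} (hc : IsWeightZero c) :
    val (annBasis F) 3 c ![(0, 0), (0, 1), (2, 0)] =
      coefAt ![(0, 0), (0, 1), (2, 0)] 2 c • gen F 2 :=
  hc.val_eq_M (by simp [wt, Fin.sum_univ_three])

theorem IsWeightZero.val_lym {c : Coc F 3} (hc : IsWeightZero c) :
    val (annBasis F) 3 c ![(0, 0), (1, 0), (2, 0)] =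
      coefAt ![(0, 0), (1, 0), (2, 0)] 1 c • gen F 1 :=
  hc.val_eq_Y (by simp [wt, Fin.sum_univ_three])

theorem IsWeightZero.val_lhy {c : Coc F 3} (hc : IsWeightZero c) :
    val (annBasis F) 3 c ![(0, 0), (0, 1), (1, 0)] =
      coefAt ![(0, 0), (0, 1), (1, 0)] 1 c • gen F 1 :=
  hc.val_eq_Y (by simp [wt, Fin.sum_univ_three])

theorem IsWeightZero.val_lyzm {c : Coc F 4} (hc : IsWeightZero c) :
    val (annBasis F) 4 c ![(0, 0), (1, 0), (1, 1), (2, 0)] =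
      coefAt ![(0, 0), (1, 0), (1, 1), (2, 0)] 2 c • gen F 2 :=
  hc.val_eq_M (by simp [wt, Fin.sum_univ_four])

theorem IsWeightZero.val_lhyz {c : Coc F 4} (hc : IsWeightZero c) :
    val (annBasis F) 4 c ![(0, 0), (0, 1), (1, 0), (1, 1)] =
      coefAt ![(0, 0), (0, 1), (1, 0), (1, 1)] 2 c • gen F 2 :=
  hc.val_eq_M (by simp [wt, Fin.sum_univ_four])

theorem IsWeightZero.val_lhym {c : Coc F 4} (hc : IsWeightZero c) :
    val (annBasis F) 4 c ![(0, 0), (0, 1), (1, 0), (2, 0)] =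
      coefAt ![(0, 0), (0, 1), (1, 0), (2, 0)] 1 c • gen F 1 :=
  hc.val_eq_Y (by simp [wt, Fin.sum_univ_four])

theorem IsWeightZero.val_lhyzm {c : Coc F 5} (hc : IsWeightZero c) :
    val (annBasis F) 5 c ![(0, 0), (0, 1), (1, 0), (1, 1), (2, 0)] =
      coefAt ![(0, 0), (0, 1), (1, 0), (1, 1), (2, 0)] 2 c • gen F 2 :=
  hc.val_eq_M (by simp [wt, Fin.sum_univ_five])

/-- The only term in need of cancellation is at `(l, h)`: `L_(1) M = M` is offset by `[L_(0), L_(1)]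
= -L_(0)`. -/
theorem IsWeightZero.diff_one {c : Coc F 1} (hc : IsWeightZero c) : diff 1 c = 0 := by
  have h1 : ∀ x, -2 < wt x → val (annBasis F) 1 c ![x] = 0 := fun x hx =>
    hc.val_eq_zero (by simpa using hx)
  refine hc.differential.eq_zero_deg_two ?_ ?_ ?_ <;>
  · simp [val_succ, val_zero, ins_diff, ins_diff_zero, ins_lie, zeroEquiv_lie, annBasis_lie,
      annCoef, annMul, coefD, coefL, ins_smul_left, ins_zero_left, ins_neg_left]
    simp [val_one, h1, wt, hc.val_l, annBasis_lie_gen, coefD, coefL]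

/-- The one nonzero entry comes from `Y_(1) Y = 2 M` and `[Y_(0), Y_(1)] = -M_(0)`. The same two
relations produce the nonzero entries in degrees three and four. -/
theorem IsWeightZero.diff_two {c : Coc F 2} (hc : IsWeightZero c) :
    val (annBasis F) 3 (diff 2 c) ![(0, 0), (1, 0), (1, 1)] =
      (2 * coefAt ![(0, 0), (1, 0)] 1 c - coefAt ![(0, 0), (2, 0)] 2 c) • gen F 2 ∧
    val (annBasis F) 3 (diff 2 c) ![(0, 0), (1, 0), (2, 0)] = 0 ∧
    val (annBasis F) 3 (diff 2 c) ![(0, 0), (0, 1), (2, 0)] = 0 ∧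
    val (annBasis F) 3 (diff 2 c) ![(0, 0), (0, 1), (1, 0)] = 0 := by
  have h1 : ∀ x y, -2 < wt x + wt y → val (annBasis F) 2 c ![x, y] = 0 := fun x y hx =>
    hc.val_eq_zero (by simpa using hx)
  -- Repeated arguments arise from brackets such as `[L_(0), Y_(1)] = -Y_(0)`.
  have h2 := val_eq_zero_of_not_injective hc.skew (x := ![(1, 0), (1, 0)]) (by decide)
  refine ⟨?_, ?_, ?_, ?_⟩ <;>
  · simp [val_succ, val_zero, ins_diff, ins_diff_zero, ins_lie, zeroEquiv_lie, annBasis_lie,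
      annCoef, annMul, coefD, coefL, ins_smul_left, ins_zero_left, ins_neg_left]
    simp [val_two, h1, wt, h2, hc.val_lm, hc.val_lh, hc.val_ly, annBasis_lie_gen, coefD, coefL]
    try module

theorem IsWeightZero.diff_three {c : Coc F 3} (hc : IsWeightZero c) :
    val (annBasis F) 4 (diff 3 c) ![(0, 0), (1, 0), (1, 1), (2, 0)] =
      (2 * coefAt ![(0, 0), (1, 0), (2, 0)] 1 c) • gen F 2 ∧
    val (annBasis F) 4 (diff 3 c) ![(0, 0), (0, 1), (1, 0), (1, 1)] =
      (coefAt ![(0, 0), (0, 1), (2, 0)] 2 c - 2 * coefAt ![(0, 0), (0, 1), (1, 0)] 1 c) •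
        gen F 2 ∧
    val (annBasis F) 4 (diff 3 c) ![(0, 0), (0, 1), (1, 0), (2, 0)] = 0 := by
  have h1 : ∀ x y z, -2 < wt x + wt y + wt z → val (annBasis F) 3 c ![x, y, z] = 0 :=
    fun x y z hx => hc.val_eq_zero (by simpa [Fin.sum_univ_three] using hx)
  have h2 := val_eq_zero_of_not_injective hc.skew (x := ![(1, 0), (1, 0), (2, 0)]) (by decide)
  have h3 := val_eq_zero_of_not_injective hc.skew (x := ![(0, 0), (2, 0), (2, 0)]) (by decide)
  have h4 := val_eq_zero_of_not_injective hc.skew (x := ![(0, 1), (1, 0), (1, 0)]) (by decide)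
  refine ⟨?_, ?_, ?_⟩ <;>
  · simp [val_succ, val_zero, ins_diff, ins_diff_zero, ins_lie, zeroEquiv_lie, annBasis_lie,
      annCoef, annMul, coefD, coefL, ins_smul_left, ins_zero_left, ins_neg_left]
    simp [val_three, h1, wt, h2, h3, h4, hc.val_lyz, hc.val_lhm, hc.val_lym, hc.val_lhy,
      annBasis_lie_gen, coefD, coefL]
    try module

theorem IsWeightZero.diff_four {c : Coc F 4} (hc : IsWeightZero c) :
    val (annBasis F) 5 (diff 4 c) ![(0, 0), (0, 1), (1, 0), (1, 1), (2, 0)] =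
      (-2 * coefAt ![(0, 0), (0, 1), (1, 0), (2, 0)] 1 c) • gen F 2 := by
  have h1 : ∀ x y z w, -2 < wt x + wt y + wt z + wt w →
      val (annBasis F) 4 c ![x, y, z, w] = 0 :=
    fun x y z w hx => hc.val_eq_zero (by simpa [Fin.sum_univ_four] using hx)
  have h2 := val_eq_zero_of_not_injective hc.skew (x := ![(0, 1), (1, 0), (1, 0), (2, 0)])
    (by decide)
  have h3 := val_eq_zero_of_not_injective hc.skew (x := ![(0, 0), (0, 1), (2, 0), (2, 0)])
    (by decide)
  simp [val_succ, val_zero, ins_diff, ins_diff_zero, ins_lie, zeroEquiv_lie, annBasis_lie,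
    annCoef, annMul, coefD, coefL, ins_smul_left, ins_zero_left, ins_neg_left]
  simp [val_four, h1, h2, h3, wt, hc.val_lyzm, hc.val_lhyz, hc.val_lhym, annBasis_lie_gen, coefD,
    coefL]
  module

end SchrodingerVirasoro

end

/-! ### The basic cohomology, computed in weight zero -/

noncomputable section

namespace SchrodingerVirasoro

open PolyMod LieCochain

variable {F : Type u} [Field F] [CharZero F]

variable (F) in
/-- The skew-symmetric cochains of finite support and of weight zero. -/
def cochZero (q : ℕ) : Submodule F (Coc F q) where
  carrier := {c | c ∈ coch F q ∧ IsWeightZero c}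
  zero_mem' := ⟨zero_mem _, isSkew_zero, by simp⟩
  add_mem' {c e} hc he := by
    refine ⟨add_mem hc.1 he.1, ?_⟩
    rw [← sub_neg_eq_add, ← neg_one_smul F]
    exact hc.2.sub (he.2.smul _)
  smul_mem' r c hc := ⟨Submodule.smul_mem _ r hc.1, hc.2.smul r⟩

theorem weightZero_mem_cochZero {q : ℕ} {c : Coc F q} (hc : c ∈ coch F q) :
    weightZero c ∈ cochZero F q :=
  ⟨diagC_mem_coch _ hc, isWeightZero_weightZero hc.1⟩

theorem altDelta_mem_cochZero {q : ℕ} {t : Fin q → Fin 3 × ℕ} {i : Fin 3}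
    (ht : outWt i 0 + ∑ k, wt (t k) = 0) (r : F) : altDelta t (r • gen F i) ∈ cochZero F q :=
  ⟨altDelta_mem_coch _ _, altDelta_isWeightZero ht r⟩

theorem finite_support_of_isWeightZero {q : ℕ} {c : Coc F q} (hc : IsWeightZero c) :
    {x | val (annBasis F) q c x ≠ 0}.Finite := by
  refine (Set.Finite.pi' fun _ : Fin q => core.finite_toSet).subset fun x hx i => ?_
  have hinj := injective_of_val_ne_zero hc.skew hx
  have hsum : ∑ a ∈ Finset.univ.image x, wt a = ∑ i, wt (x i) :=
    Finset.sum_image fun i _ j _ hij => hinj hij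
  refine mem_core (S := Finset.univ.image x) ?_ (Finset.mem_image_of_mem x (Finset.mem_univ i))
  by_contra hlt
  exact hx (hc.val_eq_zero (by rw [← hsum]; exact not_le.1 hlt))

theorem diff_mem_cochZero {q : ℕ} {c : Coc F q} (hc : c ∈ cochZero F q) :
    diff q c ∈ cochZero F (q + 1) :=
  ⟨⟨hc.2.skew.differential, finite_support_of_isWeightZero hc.2.differential⟩, hc.2.differential⟩

variable (F) in
/-- The cocycles. -/
def cocycles (q : ℕ) : Submodule F (Coc F q) := coch F q ⊓ LinearMap.ker (diff q)

variable (F) in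
/-- The coboundaries. -/
def coboundaries : (q : ℕ) → Submodule F (Coc F q)
  | 0 => ⊥
  | q + 1 => (coch F q).map (diff q)

/-- Reduction to weight zero: cocycles may be replaced by their components of weight zero, and a
primitive of a cochain of weight zero by its own such component, as the differential preserves
weight. -/
theorem isBasisMod_succ {q n : ℕ} {w : Fin n → Coc F (q + 1)}
    (hw : ∀ i, w i ∈ cochZero F (q + 1)) (hd : ∀ i, diff (q + 1) (w i) = 0)
    (hspan : ∀ c ∈ cochZero F (q + 1), diff (q + 1) c = 0 →
      ∃ k : Fin n → F, ∃ e ∈ cochZero F q, c - ∑ i, k i • w i = diff q e)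
    (hindep : ∀ k : Fin n → F, ∀ e ∈ cochZero F q, ∑ i, k i • w i = diff q e → k = 0) :
    IsBasisMod (cocycles F (q + 1)) (coboundaries F (q + 1)) w := by
  refine ⟨fun i => ⟨(hw i).1, hd i⟩, fun z hz => ?_, fun k hk => ?_⟩
  · obtain ⟨e, he, h1⟩ := cocycle_sub_weightZero hz.1 hz.2
    obtain ⟨k, e', he', h2⟩ := hspan (weightZero z) (weightZero_mem_cochZero hz.1) (by
      rw [weightZero, diff_diagC, LinearMap.mem_ker.1 hz.2, diagC_zero])
    refine ⟨k, e + e', add_mem he he'.1, ?_⟩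
    rw [map_add, ← h1, ← h2]
    abel
  · obtain ⟨e, he, h⟩ := hk
    refine hindep k (weightZero e) (weightZero_mem_cochZero he) ?_
    rw [weightZero, diff_diagC, h, ← weightZero, IsWeightZero.weightZero_eq]
    exact (sum_mem fun i _ => Submodule.smul_mem _ _ (hw i)).2

theorem isBasisMod_zero :
    IsBasisMod (cocycles F 0) (coboundaries F 0) (![] : Fin 0 → Coc F 0) := by
  refine ⟨fun i => i.elim0, fun z hz => ⟨0, ?_⟩, fun k _ => Subsingleton.elim _ _⟩
  rw [cocycle_zero_sub_weightZero (LinearMap.mem_ker.1 hz.2),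
    (isWeightZero_weightZero hz.1.1).eq_zero_deg_zero]
  simp

theorem isBasisMod_of_ge {q : ℕ} (hq : 5 ≤ q) :
    IsBasisMod (cocycles F (q + 1)) (coboundaries F (q + 1)) (![] : Fin 0 → Coc F (q + 1)) := by
  refine isBasisMod_succ (fun i => i.elim0) (fun i => i.elim0) (fun c hc _ => ⟨0, 0, zero_mem _, ?_⟩)
    fun k _ _ _ => Subsingleton.elim _ _
  rw [hc.2.eq_zero_deg_ge (by omega)]
  simp

variable (F) in
/-- `L ↦ M` -/
def coc11 : Coc F 1 := altDelta ![(0, 0)] ((1 : F) • gen F 2)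

variable (F) in
/-- `L ⊗ Y ↦ Y / 2`, `L ⊗ M ↦ M` -/
def coc21 : Coc F 2 := altDelta ![(0, 0), (2, 0)] ((1 : F) • gen F 2) +
  altDelta ![(0, 0), (1, 0)] ((1 / 2 : F) • gen F 1)

variable (F) in
/-- `L ⊗ L ↦ (λ_1 - λ_2) M` -/
def coc22 : Coc F 2 := altDelta ![(0, 0), (0, 1)] ((-1 : F) • gen F 2)

variable (F) in
/-- `L ⊗ L ⊗ Y ↦ (λ_1 - λ_2) Y / 2`, `L ⊗ L ⊗ M ↦ (λ_1 - λ_2) M` -/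
def coc31 : Coc F 3 := altDelta ![(0, 0), (0, 1), (2, 0)] ((-1 : F) • gen F 2) +
  altDelta ![(0, 0), (0, 1), (1, 0)] ((-1 / 2 : F) • gen F 1)

theorem coc11_mem : coc11 F ∈ cochZero F 1 := altDelta_mem_cochZero (by decide) _

theorem coc21_mem : coc21 F ∈ cochZero F 2 :=
  add_mem (altDelta_mem_cochZero (by decide) _) (altDelta_mem_cochZero (by decide) _)

theorem coc22_mem : coc22 F ∈ cochZero F 2 := altDelta_mem_cochZero (by decide) _

theorem coc31_mem : coc31 F ∈ cochZero F 3 :=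
  add_mem (altDelta_mem_cochZero (by decide) _) (altDelta_mem_cochZero (by decide) _)

theorem coefAt_coc11 : coefAt ![(0, 0)] 2 (coc11 F) = 1 :=
  coefAt_altDelta_self (by decide) _ _

theorem coefAt_coc21_lm : coefAt ![(0, 0), (2, 0)] 2 (coc21 F) = 1 := by
  rw [coc21, map_add, coefAt_altDelta_self (by decide), coefAt_altDelta_of_notMem _ _ (by decide),
    add_zero]

theorem coefAt_coc21_ly : coefAt ![(0, 0), (1, 0)] 1 (coc21 F) = 1 / 2 := by
  rw [coc21, map_add, coefAt_altDelta_self (by decide), coefAt_altDelta_of_notMem _ _ (by decide),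
    zero_add]

theorem coefAt_coc21_lh : coefAt ![(0, 0), (0, 1)] 2 (coc21 F) = 0 := by
  rw [coc21, map_add, coefAt_altDelta_of_notMem _ _ (by decide),
    coefAt_altDelta_of_notMem _ _ (by decide), zero_add]

theorem coefAt_coc22_lm : coefAt ![(0, 0), (2, 0)] 2 (coc22 F) = 0 :=
  coefAt_altDelta_of_notMem _ _ (by decide)

theorem coefAt_coc22_ly : coefAt ![(0, 0), (1, 0)] 1 (coc22 F) = 0 :=
  coefAt_altDelta_of_notMem _ _ (by decide)

theorem coefAt_coc22_lh : coefAt ![(0, 0), (0, 1)] 2 (coc22 F) = -1 :=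
  coefAt_altDelta_self (by decide) _ _

theorem coefAt_coc31_lhm : coefAt ![(0, 0), (0, 1), (2, 0)] 2 (coc31 F) = -1 := by
  rw [coc31, map_add, coefAt_altDelta_self (by decide), coefAt_altDelta_of_notMem _ _ (by decide),
    add_zero]

theorem coefAt_coc31_lhy : coefAt ![(0, 0), (0, 1), (1, 0)] 1 (coc31 F) = -1 / 2 := by
  rw [coc31, map_add, coefAt_altDelta_self (by decide), coefAt_altDelta_of_notMem _ _ (by decide),
    zero_add]

theorem coefAt_coc31_lym : coefAt ![(0, 0), (1, 0), (2, 0)] 1 (coc31 F) = 0 := by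
  rw [coc31, map_add, coefAt_altDelta_of_notMem _ _ (by decide),
    coefAt_altDelta_of_notMem _ _ (by decide), zero_add]

theorem coefAt_coc31_lyz : coefAt ![(0, 0), (1, 0), (1, 1)] 2 (coc31 F) = 0 := by
  rw [coc31, map_add, coefAt_altDelta_of_notMem _ _ (by decide),
    coefAt_altDelta_of_notMem _ _ (by decide), zero_add]

theorem isBasisMod_one : IsBasisMod (cocycles F 1) (coboundaries F 1) ![coc11 F] := by
  refine isBasisMod_succ (fun i => ?_) (fun i => ?_) (fun c hc hd => ?_) fun k e he h => ?_
  · fin_cases i; exact coc11_mem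
  · fin_cases i; exact coc11_mem.2.diff_one
  · have hm : c - coefAt ![(0, 0)] 2 c • coc11 F ∈ cochZero F 1 :=
      sub_mem hc (Submodule.smul_mem _ _ coc11_mem)
    refine ⟨![coefAt ![(0, 0)] 2 c], 0, zero_mem _, ?_⟩
    rw [map_zero]
    simp only [Fin.sum_univ_one, Matrix.cons_val_zero]
    refine hm.2.eq_zero_deg_one ?_
    rw [hm.2.val_l, map_sub, map_smul, coefAt_coc11]
    simp
  · rw [he.2.eq_zero_deg_zero, map_zero] at h
    have := congrArg (coefAt ![(0, 0)] 2) h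
    ext i
    fin_cases i
    simpa [coefAt_coc11] using this

theorem coefAt_eq_of_val_eq {q : ℕ} {c : Coc F q} {t : Fin q → Fin 3 × ℕ} {i : Fin 3} {r : F}
    (h : val (annBasis F) q c t = r • gen F i) : coefAt t i c = r := by
  rw [coefAt_apply, h, Pi.smul_apply, Polynomial.coeff_smul, gen_apply_coeff]
  simp

theorem coefAt_eq_zero {q : ℕ} {c : Coc F q} {t : Fin q → Fin 3 × ℕ} (i : Fin 3)
    (h : val (annBasis F) q c t = 0) : coefAt t i c = 0 := by
  rw [coefAt_apply, h]
  simp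

theorem diff_coc21 : diff 2 (coc21 F) = 0 := by
  have h := coc21_mem (F := F) |>.2
  obtain ⟨h1, h2, h3, h4⟩ := h.diff_two
  refine h.differential.eq_zero_deg_three ?_ h2 h3 h4
  rw [h1, coefAt_coc21_lm, coefAt_coc21_ly]
  simp

theorem diff_coc22 : diff 2 (coc22 F) = 0 := by
  have h := coc22_mem (F := F) |>.2
  obtain ⟨h1, h2, h3, h4⟩ := h.diff_two
  refine h.differential.eq_zero_deg_three ?_ h2 h3 h4
  rw [h1, coefAt_coc22_lm, coefAt_coc22_ly]
  simp

theorem diff_coc31 : diff 3 (coc31 F) = 0 := by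
  have h := coc31_mem (F := F) |>.2
  obtain ⟨h1, h2, h3⟩ := h.diff_three
  refine h.differential.eq_zero_deg_four ?_ ?_ h3
  · rw [h1, coefAt_coc31_lym]; simp
  · rw [h2, coefAt_coc31_lhm, coefAt_coc31_lhy, smul_gen_eq_zero]; ring

theorem isBasisMod_two : IsBasisMod (cocycles F 2) (coboundaries F 2) ![coc21 F, coc22 F] := by
  refine isBasisMod_succ (fun i => ?_) (fun i => ?_) (fun c hc hd => ?_) fun k e he h => ?_
  · fin_cases i
    exacts [coc21_mem, coc22_mem]
  · fin_cases i
    exacts [diff_coc21, diff_coc22]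
  · set r := coefAt ![(0, 0), (2, 0)] 2 c with hr
    set s := coefAt ![(0, 0), (0, 1)] 2 c with hs
    have hm : c - (r • coc21 F + (-s) • coc22 F) ∈ cochZero F 2 :=
      sub_mem hc (add_mem (Submodule.smul_mem _ _ coc21_mem) (Submodule.smul_mem _ _ coc22_mem))
    -- Closedness at `(l, y, z)` says that the coefficient at `(l, y)` is half of that at `(l, m)`.
    -- Hence the coefficients at `(l, m)` and `(l, h)` determine the cocycle, and the sign in `-s`
    -- is the value `-1` of `coc22`.
    have h1 := hc.2.diff_two.1
    rw [hd, map_zero, Pi.zero_apply, eq_comm, smul_gen_eq_zero, ← hr] at h1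
    refine ⟨![r, -s], 0, zero_mem _, ?_⟩
    rw [map_zero]
    simp only [Fin.sum_univ_two, Matrix.cons_val_zero, Matrix.cons_val_one]
    refine hm.2.eq_zero_deg_two ?_ ?_ ?_
    · rw [hm.2.val_lm, smul_gen_eq_zero]
      simp only [map_sub, map_add, map_smul, coefAt_coc21_lm, coefAt_coc22_lm, smul_eq_mul, ← hr]
      ring
    · rw [hm.2.val_ly, smul_gen_eq_zero]
      simp only [map_sub, map_add, map_smul, coefAt_coc21_ly, coefAt_coc22_ly, smul_eq_mul]
      linear_combination h1 / 2
    · rw [hm.2.val_lh, smul_gen_eq_zero]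
      simp only [map_sub, map_add, map_smul, coefAt_coc21_lh, coefAt_coc22_lh, smul_eq_mul, ← hs]
      ring
  · rw [he.2.diff_one, Fin.sum_univ_two] at h
    have h1 := congrArg (coefAt ![(0, 0), (2, 0)] 2) h
    have h2 := congrArg (coefAt ![(0, 0), (0, 1)] 2) h
    simp [coefAt_coc21_lm, coefAt_coc22_lm] at h1
    simp [coefAt_coc21_lh, coefAt_coc22_lh] at h2
    ext i
    fin_cases i
    exacts [h1, h2]

theorem isBasisMod_three : IsBasisMod (cocycles F 3) (coboundaries F 3) ![coc31 F] := by
  refine isBasisMod_succ (fun i => ?_) (fun i => ?_) (fun c hc hd => ?_) fun k e he h => ?_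
  · fin_cases i
    exact coc31_mem
  · fin_cases i
    exact diff_coc31
  · set r := coefAt ![(0, 0), (0, 1), (2, 0)] 2 c with hr
    set s := coefAt ![(0, 0), (1, 0), (1, 1)] 2 c with hs
    -- By `diff_two`, the coefficient `-s` at `(l, m)` gives `diff 2 e` the coefficient `s` at `(l,
    -- y, z)`, which removes that coefficient of `c`.
    set e := altDelta ![(0, 0), (2, 0)] ((-s) • gen F 2) with he
    have hem : e ∈ cochZero F 2 := altDelta_mem_cochZero (by decide) _
    have hm : c - (-r) • coc31 F - diff 2 e ∈ cochZero F 3 :=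
      sub_mem (sub_mem hc (Submodule.smul_mem _ _ coc31_mem)) (diff_mem_cochZero hem)
    -- Closedness makes the coefficient at `(l, y, m)` zero and the one at `(l, h, m)` twice the one
    -- at `(l, h, y)`.
    obtain ⟨h1, h2, -⟩ := hc.2.diff_three
    rw [hd, map_zero, Pi.zero_apply, eq_comm, smul_gen_eq_zero] at h1 h2
    obtain ⟨e1, e2, e3, e4⟩ := hem.2.diff_two
    have e1 := coefAt_eq_of_val_eq e1
    rw [he, coefAt_altDelta_self (by decide), coefAt_altDelta_of_notMem _ _ (by decide),
      ← he] at e1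
    refine ⟨![-r], e, hem, ?_⟩
    rw [← sub_eq_zero]
    simp only [Fin.sum_univ_one, Matrix.cons_val_zero]
    refine hm.2.eq_zero_deg_three ?_ ?_ ?_ ?_
    · rw [hm.2.val_lyz, smul_gen_eq_zero]
      simp only [map_sub, map_smul, coefAt_coc31_lyz, e1, smul_eq_mul, ← hs]
      ring
    · rw [hm.2.val_lym, smul_gen_eq_zero]
      simp only [map_sub, map_smul, coefAt_coc31_lym, coefAt_eq_zero 1 e2, smul_eq_mul]
      linear_combination h1 / 2
    · rw [hm.2.val_lhm, smul_gen_eq_zero]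
      simp only [map_sub, map_smul, coefAt_coc31_lhm, coefAt_eq_zero 2 e3, smul_eq_mul, ← hr]
      ring
    · rw [hm.2.val_lhy, smul_gen_eq_zero]
      simp only [map_sub, map_smul, coefAt_coc31_lhy, coefAt_eq_zero 1 e4, smul_eq_mul]
      rw [← hr] at h2
      linear_combination - h2 / 2
  -- Coboundaries of weight zero vanish at `(l, h, m)`, while `coc31` does not.
  · have h1 := congrArg (coefAt ![(0, 0), (0, 1), (2, 0)] 2) h
    rw [coefAt_eq_zero 2 he.2.diff_two.2.2.1] at h1
    ext i
    fin_cases i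
    simpa [coefAt_coc31_lhm] using h1

theorem isBasisMod_four :
    IsBasisMod (cocycles F 4) (coboundaries F 4) (![] : Fin 0 → Coc F 4) := by
  refine isBasisMod_succ (fun i => i.elim0) (fun i => i.elim0) (fun c hc hd => ?_)
    fun k _ _ _ => Subsingleton.elim _ _
  set r := coefAt ![(0, 0), (1, 0), (1, 1), (2, 0)] 2 c with hr
  set s := coefAt ![(0, 0), (0, 1), (1, 0), (1, 1)] 2 c with hs
  -- The first summand produces `r` at `(l, y, z, m)`, where `diff_three` has a factor `2`; the
  -- second produces `s` at `(l, h, y, z)`. The remaining coefficient, at `(l, h, y, m)`, is zero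
  -- because `c` is closed.
  set e := altDelta ![(0, 0), (1, 0), (2, 0)] ((r / 2) • gen F 1) +
    altDelta ![(0, 0), (0, 1), (2, 0)] (s • gen F 2) with he
  have hem : e ∈ cochZero F 3 :=
    add_mem (altDelta_mem_cochZero (by decide) _) (altDelta_mem_cochZero (by decide) _)
  have hm : c - diff 3 e ∈ cochZero F 4 := sub_mem hc (diff_mem_cochZero hem)
  have h1 := hc.2.diff_four
  rw [hd, map_zero, Pi.zero_apply, eq_comm, smul_gen_eq_zero] at h1
  have h1 : coefAt ![(0, 0), (0, 1), (1, 0), (2, 0)] 1 c = 0 := by simpa using h1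
  obtain ⟨e1, e2, e3⟩ := hem.2.diff_three
  have e1 := coefAt_eq_of_val_eq e1
  have e2 := coefAt_eq_of_val_eq e2
  have f1 : coefAt ![(0, 0), (1, 0), (2, 0)] 1 e = r / 2 := by
    rw [he, map_add, coefAt_altDelta_self (by decide), coefAt_altDelta_of_notMem _ _ (by decide),
      add_zero]
  have f2 : coefAt ![(0, 0), (0, 1), (2, 0)] 2 e = s := by
    rw [he, map_add, coefAt_altDelta_self (by decide), coefAt_altDelta_of_notMem _ _ (by decide),
      zero_add]
  have f3 : coefAt ![(0, 0), (0, 1), (1, 0)] 1 e = 0 := by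
    rw [he, map_add, coefAt_altDelta_of_notMem _ _ (by decide),
      coefAt_altDelta_of_notMem _ _ (by decide), zero_add]
  rw [f1] at e1
  rw [f2, f3] at e2
  refine ⟨0, e, hem, ?_⟩
  rw [Fin.sum_univ_zero, sub_zero, ← sub_eq_zero]
  refine hm.2.eq_zero_deg_four ?_ ?_ ?_
  · rw [hm.2.val_lyzm, smul_gen_eq_zero, map_sub, e1, ← hr]
    ring
  · rw [hm.2.val_lhyz, smul_gen_eq_zero, map_sub, e2, ← hs]
    ring
  · rw [hm.2.val_lhym, smul_gen_eq_zero, map_sub, h1, coefAt_eq_zero 1 e3, sub_zero]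

theorem isBasisMod_five :
    IsBasisMod (cocycles F 5) (coboundaries F 5) (![] : Fin 0 → Coc F 5) := by
  refine isBasisMod_succ (fun i => i.elim0) (fun i => i.elim0) (fun c hc hd => ?_)
    fun k _ _ _ => Subsingleton.elim _ _
  set r := coefAt ![(0, 0), (0, 1), (1, 0), (1, 1), (2, 0)] 2 c with hr
  -- The factor `-2` in `diff_four` turns `-r / 2` into `r`.
  set e := altDelta ![(0, 0), (0, 1), (1, 0), (2, 0)] ((-r / 2) • gen F 1) with he
  have hem : e ∈ cochZero F 4 := altDelta_mem_cochZero (by decide) _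
  have hm : c - diff 4 e ∈ cochZero F 5 := sub_mem hc (diff_mem_cochZero hem)
  have e1 := coefAt_eq_of_val_eq hem.2.diff_four
  rw [he, coefAt_altDelta_self (by decide), ← he] at e1
  refine ⟨0, e, hem, ?_⟩
  rw [Fin.sum_univ_zero, sub_zero, ← sub_eq_zero]
  refine hm.2.eq_zero_deg_five ?_
  rw [hm.2.val_lhyzm, smul_gen_eq_zero, map_sub, e1, ← hr]
  ring

end SchrodingerVirasoro

end

/-! ### Bases of a subspace modulo another -/

noncomputable section

section

variable {F V W : Type*} [Field F] [AddCommGroup V] [Module F V] [AddCommGroup W] [Module F W]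
  {n : ℕ} {Z B : Submodule F V} {w : Fin n → V}

theorem IsBasisMod.congr (h : IsBasisMod Z B w) {w' : Fin n → V} (hw : ∀ i, w' i ∈ Z)
    (hb : ∀ i, w i - w' i ∈ B) : IsBasisMod Z B w' := by
  have key : ∀ k : Fin n → F, ∑ i, k i • w i - ∑ i, k i • w' i ∈ B := fun k => by
    rw [← Finset.sum_sub_distrib]
    exact sum_mem fun i _ => by rw [← smul_sub]; exact B.smul_mem _ (hb i)
  refine ⟨hw, fun z hz => ?_, fun k hk => h.indep k ?_⟩
  · obtain ⟨k, hk⟩ := h.span z hz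
    exact ⟨k, by simpa using add_mem hk (key k)⟩
  · simpa using add_mem (key k) hk

/-- Neither injectivity nor surjectivity of `T` is assumed: `T` has to detect membership in `B` for
elements of `Z`, and the images `T (w i)` already span. -/
theorem IsBasisMod.of_linearMap {Z' B' : Submodule F W} (T : V →ₗ[F] W)
    (h : IsBasisMod Z' B' (T ∘ w)) (hw : ∀ i, w i ∈ Z) (hZ : ∀ v ∈ Z, T v ∈ Z')
    (hB : ∀ v ∈ Z, T v ∈ B' → v ∈ B) (hB' : ∀ v ∈ B, T v ∈ B') : IsBasisMod Z B w := by
  have hT : ∀ k : Fin n → F, T (∑ i, k i • w i) = ∑ i, k i • (T ∘ w) i := fun k => by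
    simp [map_sum]
  refine ⟨hw, fun z hz => ?_, fun k hk => h.indep k ?_⟩
  · obtain ⟨k, hk⟩ := h.span (T z) (hZ z hz)
    refine ⟨k, hB _ (sub_mem hz (sum_mem fun i _ => Z.smul_mem _ (hw i))) ?_⟩
    rwa [map_sub, hT]
  · rw [← hT]; exact hB' _ hk

theorem IsBasisMod.exists_basis (h : IsBasisMod Z B w) :
    ∃ b : Module.Basis (Fin n) F (Z ⧸ B.submoduleOf Z),
      ∀ i, b i = Submodule.Quotient.mk ⟨w i, h.mem i⟩ := by
  set e : Fin n → Z ⧸ B.submoduleOf Z := fun i => (B.submoduleOf Z).mkQ ⟨w i, h.mem i⟩ with he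
  have hsum : ∀ k : Fin n → F, ∑ i, k i • e i =
      (B.submoduleOf Z).mkQ (∑ i, k i • ⟨w i, h.mem i⟩) := fun k => by
    simp only [he, map_sum, map_smul]
  refine ⟨Module.Basis.mk (v := e) ?_ ?_, fun i => ?_⟩
  · rw [Fintype.linearIndependent_iff]
    intro k hk i
    rw [hsum, Submodule.mkQ_apply, Submodule.Quotient.mk_eq_zero] at hk
    have hk : ((∑ i, k i • ⟨w i, h.mem i⟩ : Z) : V) ∈ B := hk
    exact congrFun (h.indep k (by simpa using hk)) i
  · rintro x -
    obtain ⟨z, rfl⟩ := (B.submoduleOf Z).mkQ_surjective x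
    obtain ⟨k, hk⟩ := h.span z z.2
    have : (B.submoduleOf Z).mkQ z = ∑ i, k i • e i := by
      rw [hsum, ← sub_eq_zero, ← map_sub, Submodule.mkQ_apply, Submodule.Quotient.mk_eq_zero]
      change ((z - ∑ i, k i • ⟨w i, h.mem i⟩ : Z) : V) ∈ B
      simpa using hk
    rw [this]
    exact sum_mem fun i _ => Submodule.smul_mem _ _ (Submodule.subset_span ⟨i, rfl⟩)
  · rw [Module.Basis.mk_apply]
    rfl

theorem IsBasisMod.rank_eq (h : IsBasisMod Z B w) :
    Module.rank F (Z ⧸ B.submoduleOf Z) = n := by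
  obtain ⟨b, -⟩ := h.exists_basis
  rw [rank_eq_card_basis b, Fintype.card_fin]

end

/-! ### Reduced cohomology from basic cohomology, and transfer back to conformal cochains -/

namespace SchrodingerVirasoro

open PolyMod LieCochain

variable {F : Type u} [Field F] [CharZero F]

/-- Finite support is read off on the conformal side, where the action of `L_(0)` is that of `∂` and
the values are polynomials. -/
theorem lie_mem_coch {q : ℕ} {c : Coc F q} (hc : c ∈ coch F q) :
    ⁅annBasis F (0, 0), c⁆ ∈ coch F q := by
  obtain ⟨f, -, rfl⟩ := exists_cochain hc.1 hc.2
  refine ⟨hc.1.lie _, ?_⟩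
  rw [← toCoch_partialOp]
  exact toCoch_finite _

variable (F) in
/-- The cochains that are divisible by `∂`. -/
def partials (q : ℕ) : Submodule F (Coc F q) :=
  (coch F q).map (LieModule.toEnd F (Ann F) (Coc F q) (annBasis F (0, 0)))

variable (F) in
/-- The cocycles modulo `∂`. -/
def redCocycles (q : ℕ) : Submodule F (Coc F q) :=
  coch F q ⊓ (partials F (q + 1)).comap (diff q)

variable (F) in
/-- The coboundaries modulo `∂`. -/
def redCoboundaries (q : ℕ) : Submodule F (Coc F q) := coboundaries F q ⊔ partials F q

theorem diff_ins {q : ℕ} {c : Coc F (q + 1)} (hc : diff (q + 1) c = 0) (x : Ann F) :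
    diff q (ins x c) = ⁅x, c⁆ := by
  have h := ins_diff x c
  rw [hc, map_zero, eq_comm, sub_eq_zero] at h
  exact h.symm

theorem diff_eq_zero_of_mem_coboundaries {q : ℕ} {c : Coc F q} (hc : c ∈ coboundaries F q) :
    diff q c = 0 := by
  cases q with
  | zero => rw [(Submodule.mem_bot F).1 hc, map_zero]
  | succ q =>
    obtain ⟨e, -, rfl⟩ := hc
    exact diff_diff e

/-- By Cartan's formula `∂` acts as zero on cohomology: `L_(0) · c` is the differential of the
insertion of `L_(0)`. -/
theorem lie_mem_coboundaries {q : ℕ} {c : Coc F q} (hc : c ∈ coch F q) (hd : diff q c = 0) :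
    ⁅annBasis F (0, 0), c⁆ ∈ coboundaries F q := by
  cases q with
  | zero =>
    rw [← ins_diff_zero, hd, map_zero]
    exact zero_mem _
  | succ q => exact ⟨_, ins_mem_coch hc _, diff_ins hd _⟩

/-- This is the split short exact sequence from `H^q` to reduced `H^q` to `H^(q+1)`. The connecting
map sends `f` with `d f = ∂ g` to the class of `g`, and insertion of `L_(0)` is a section of it,
because `d ι g = ∂ g` for a cocycle `g`. -/
theorem isBasisMod_reduced {q n m : ℕ} {u : Fin n → Coc F q} {v : Fin m → Coc F (q + 1)}
    (hu : IsBasisMod (cocycles F q) (coboundaries F q) u)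
    (hv : IsBasisMod (cocycles F (q + 1)) (coboundaries F (q + 1)) v) :
    IsBasisMod (redCocycles F q) (redCoboundaries F q)
      (Fin.append u fun j => ins (annBasis F (0, 0)) (v j)) := by
  have hsum : ∀ k : Fin m → F, ∑ j, k j • v j ∈ cocycles F (q + 1) := fun k =>
    sum_mem fun j _ => Submodule.smul_mem _ _ (hv.mem j)
  refine ⟨fun i => ?_, fun f hf => ?_, fun k hk => ?_⟩
  · refine Fin.addCases (fun i => ?_) (fun j => ?_) i
    · rw [Fin.append_left]
      refine ⟨(hu.mem i).1, ?_⟩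
      change diff q (u i) ∈ partials F (q + 1)
      rw [LinearMap.mem_ker.1 (hu.mem i).2]
      exact zero_mem (partials F (q + 1))
    · rw [Fin.append_right]
      refine ⟨ins_mem_coch (hv.mem j).1 _, v j, (hv.mem j).1, ?_⟩
      exact (diff_ins (hv.mem j).2 _).symm
  · obtain ⟨hf, g, hg, hgf⟩ := hf
    have hgf : ⁅annBasis F (0, 0), g⁆ = diff q f := hgf
    -- `∂ d g = d ∂ g = d d f = 0`, and `∂` is injective.
    have hdg : diff (q + 1) g = 0 := L_zero_lie_injective (by rw [← diff_lie, hgf, diff_diff])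
    obtain ⟨k, h, hh, hk⟩ := hv.span g ⟨hg, hdg⟩
    set s := ∑ j, k j • v j with hs
    -- If `g = s + d h`, then `d f = ∂ g = d (ι s) + d (∂ h)`, so this difference is a basic
    -- cocycle.
    obtain ⟨k', hk'⟩ := hu.span (f - ins (annBasis F (0, 0)) s - ⁅annBasis F (0, 0), h⁆) ⟨
      sub_mem (sub_mem hf (ins_mem_coch (hsum k).1 _)) (lie_mem_coch hh), by
        change diff q _ = 0
        rw [map_sub, map_sub, diff_ins (hsum k).2, diff_lie, hk, lie_sub, hgf]
        abel⟩
    refine ⟨Fin.append k' k, Submodule.mem_sup.2 ⟨_, hk', ⁅annBasis F (0, 0), h⁆,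
      ⟨h, hh, rfl⟩, ?_⟩⟩
    rw [Fin.sum_univ_add]
    simp only [Fin.append_left, Fin.append_right, hs, map_sum, map_smul]
    abel
  · obtain ⟨b, hb, c, ⟨h, hh, rfl⟩, hbc⟩ := Submodule.mem_sup.1 hk
    have hbc : b + ⁅annBasis F (0, 0), h⁆ = _ := hbc
    rw [Fin.sum_univ_add] at hbc
    simp only [Fin.append_left, Fin.append_right] at hbc
    set s := ∑ j, k (Fin.natAdd n j) • v j with hs
    have hins : ∑ j, k (Fin.natAdd n j) • ins (annBasis F (0, 0)) (v j) =
        ins (annBasis F (0, 0)) s := by simp [hs, map_sum]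
    rw [hins] at hbc
    have hu0 : diff q (∑ i, k (Fin.castAdd m i) • u i) = 0 :=
      LinearMap.mem_ker.1
        (sum_mem fun i _ => Submodule.smul_mem _ _ (hu.mem i) : _ ∈ cocycles F q).2
    have h1 := congrArg (diff q) hbc
    rw [map_add, map_add, diff_eq_zero_of_mem_coboundaries hb, hu0, diff_ins (hsum _).2, diff_lie,
      zero_add, zero_add, ← sub_eq_zero, ← lie_sub] at h1
    -- Applying `d` to the relation gives `∂ d h = ∂ s`, so `s = d h` by injectivity, and
    -- independence of the `v j` makes their coefficients zero.
    have h2 := sub_eq_zero.1 (L_zero_lie_injective h1)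
    have hk2 := hv.indep _ ⟨h, hh, h2⟩
    have hs0 : s = 0 := by
      rw [hs]
      exact Finset.sum_eq_zero fun j _ => by rw [congrFun hk2 j, Pi.zero_apply, zero_smul]
    rw [hs0, map_zero, add_zero] at hbc
    rw [← hs, hs0] at h2
    -- Now `d h = s = 0`, so `∂ h` is itself a coboundary and the relation holds in basic
    -- cohomology.
    have hk1 := hu.indep (fun i => k (Fin.castAdd m i)) (by
      rw [← hbc]
      exact add_mem hb (lie_mem_coboundaries hh h2))
    funext i
    refine Fin.addCases (fun i => ?_) (fun j => ?_) i
    · exact congrFun hk1 i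
    · exact congrFun hk2 j

theorem exists_cochain_toCoch_eq {q : ℕ} {c : Coc F q} (hc : c ∈ coch F q) :
    ∃ f ∈ (adjointModule F).cochains q, toCoch F q f = c := exists_cochain hc.1 hc.2

theorem toCoch_mem_coch {q : ℕ} {f : Cnf F q} (hf : f ∈ (adjointModule F).cochains q) :
    toCoch F q f ∈ coch F q := ⟨toCoch_isSkew hf, toCoch_finite f⟩

theorem mem_basicCocycles_iff {q : ℕ} {f : Cnf F q} (hf : f ∈ (adjointModule F).cochains q) :
    f ∈ (adjointModule F).basicCocycles q ↔ toCoch F q f ∈ cocycles F q := by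
  refine ⟨fun h => ⟨toCoch_mem_coch hf, ?_⟩, fun h => ⟨hf, ?_⟩⟩
  · change diff q _ = 0
    rw [← toCoch_d hf, LinearMap.mem_ker.1 h.2, map_zero]
  · refine LinearMap.mem_ker.2 ((IsSesq.of_mem hf).d.ext_toCoch
      (IsSesq.of_mem (zero_mem _)) ?_)
    rw [toCoch_d hf, LinearMap.mem_ker.1 h.2, map_zero]

/-- A primitive lifts by surjectivity of `toCoch`, and its differential is then identified with `f`
by injectivity on antilinear maps, so `f` itself need not be known to be skew. -/
theorem mem_basicCoboundaries_iff {q : ℕ} {f : Cnf F q} (hf : IsSesq f) :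
    f ∈ (adjointModule F).basicCoboundaries q ↔ toCoch F q f ∈ coboundaries F q := by
  cases q with
  | zero =>
    refine ⟨fun h => ?_, fun h => ?_⟩
    · rw [(Submodule.mem_bot F).1 h, map_zero]; exact zero_mem _
    · refine (Submodule.mem_bot F).2 (hf.ext_toCoch (IsSesq.of_mem (zero_mem _)) ?_)
      rw [(Submodule.mem_bot F).1 h, map_zero]
  | succ q =>
    refine ⟨?_, ?_⟩
    · rintro ⟨g, hg, rfl⟩
      exact ⟨_, toCoch_mem_coch hg, (toCoch_d hg).symm⟩
    · rintro ⟨e, he, hef⟩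
      obtain ⟨g, hg, rfl⟩ := exists_cochain_toCoch_eq he
      exact ⟨g, hg, (IsSesq.of_mem hg).d.ext_toCoch hf (by rw [toCoch_d hg, hef])⟩

theorem mem_partialCochains_iff {q : ℕ} {f : Cnf F q} (hf : IsSesq f) :
    f ∈ (adjointModule F).partialCochains q ↔ toCoch F q f ∈ partials F q := by
  refine ⟨?_, ?_⟩
  · rintro ⟨g, hg, rfl⟩
    exact ⟨_, toCoch_mem_coch hg, (toCoch_partialOp g).symm⟩
  · rintro ⟨e, he, hef⟩
    obtain ⟨g, hg, rfl⟩ := exists_cochain_toCoch_eq he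
    exact ⟨g, hg, (IsSesq.of_mem hg).partialOp.ext_toCoch hf (by
      rw [toCoch_partialOp, ← hef]; rfl)⟩

theorem mem_reducedCocycles_iff {q : ℕ} {f : Cnf F q} (hf : f ∈ (adjointModule F).cochains q) :
    f ∈ (adjointModule F).reducedCocycles q ↔ toCoch F q f ∈ redCocycles F q := by
  have h : (adjointModule F).d q f ∈ (adjointModule F).partialCochains (q + 1) ↔
      diff q (toCoch F q f) ∈ partials F (q + 1) := by
    rw [mem_partialCochains_iff (IsSesq.of_mem hf).d, toCoch_d hf]
  exact ⟨fun h2 => ⟨toCoch_mem_coch hf, h.1 h2.2⟩, fun h2 => ⟨hf, h.2 h2.2⟩⟩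

theorem isSesq_of_mem_basicCoboundaries {q : ℕ} {f : Cnf F q}
    (hf : f ∈ (adjointModule F).basicCoboundaries q) : IsSesq f := by
  cases q with
  | zero => rw [(Submodule.mem_bot F).1 hf]; exact IsSesq.of_mem (zero_mem _)
  | succ q =>
    obtain ⟨e, he, rfl⟩ := hf
    exact (IsSesq.of_mem he).d

theorem isSesq_of_mem_partialCochains {q : ℕ} {f : Cnf F q}
    (hf : f ∈ (adjointModule F).partialCochains q) : IsSesq f := by
  obtain ⟨e, he, rfl⟩ := hf
  exact (IsSesq.of_mem he).partialOp

theorem isSesq_of_mem_reducedCoboundaries {q : ℕ} {f : Cnf F q}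
    (hf : f ∈ (adjointModule F).reducedCoboundaries q) : IsSesq f := by
  obtain ⟨b, hb, c, hc, rfl⟩ := Submodule.mem_sup.1 hf
  exact (isSesq_of_mem_basicCoboundaries hb).add (isSesq_of_mem_partialCochains hc)

theorem mem_reducedCoboundaries_iff {q : ℕ} {f : Cnf F q} (hf : IsSesq f) :
    f ∈ (adjointModule F).reducedCoboundaries q ↔ toCoch F q f ∈ redCoboundaries F q := by
  refine ⟨fun h => ?_, fun h => ?_⟩
  · obtain ⟨b, hb, c, hc, rfl⟩ := Submodule.mem_sup.1 h
    rw [map_add]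
    exact Submodule.add_mem_sup ((mem_basicCoboundaries_iff (isSesq_of_mem_basicCoboundaries hb)).1 hb)
      ((mem_partialCochains_iff (isSesq_of_mem_partialCochains hc)).1 hc)
  · obtain ⟨b, hb, c, ⟨e, he, rfl⟩, hbc⟩ := Submodule.mem_sup.1 h
    obtain ⟨g, hg, rfl⟩ := exists_cochain_toCoch_eq he
    have hp := (IsSesq.of_mem hg).partialOp
    -- Only the `∂` part is lifted; the difference is antilinear and has the remaining part as
    -- image, so the basic statement applies to it.
    have h2 : f - (adjointModule F).partialOp q g ∈ (adjointModule F).basicCoboundaries q := by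
      rw [mem_basicCoboundaries_iff (hf.sub hp), map_sub, toCoch_partialOp, ← hbc]
      have : b + ⁅annBasis F (0, 0), toCoch F q g⁆ - ⁅annBasis F (0, 0), toCoch F q g⁆ ∈
        coboundaries F q := by rwa [add_sub_cancel_right]
      exact this
    rw [← sub_add_cancel f ((adjointModule F).partialOp q g)]
    exact Submodule.add_mem_sup h2 ⟨g, hg, rfl⟩

theorem isBasisMod_basic {q n : ℕ} {w : Fin n → Coc F q}
    (h : IsBasisMod (cocycles F q) (coboundaries F q) w) {f : Fin n → Cnf F q}
    (hf : ∀ i, f i ∈ (adjointModule F).cochains q) (hfw : ∀ i, toCoch F q (f i) = w i) :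
    IsBasisMod ((adjointModule F).basicCocycles q) ((adjointModule F).basicCoboundaries q) f := by
  have e : w = toCoch F q ∘ f := funext fun i => (hfw i).symm
  subst e
  exact h.of_linearMap (toCoch F q) (fun i => (mem_basicCocycles_iff (hf i)).2 (h.mem i))
    (fun v hv => (mem_basicCocycles_iff hv.1).1 hv)
    (fun v hv => (mem_basicCoboundaries_iff (IsSesq.of_mem hv.1)).2) fun v hv =>
      (mem_basicCoboundaries_iff (isSesq_of_mem_basicCoboundaries hv)).1 hv

theorem isBasisMod_reducedCochains {q n : ℕ} {w : Fin n → Coc F q}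
    (h : IsBasisMod (redCocycles F q) (redCoboundaries F q) w) {f : Fin n → Cnf F q}
    (hf : ∀ i, f i ∈ (adjointModule F).cochains q) (hfw : ∀ i, toCoch F q (f i) = w i) :
    IsBasisMod ((adjointModule F).reducedCocycles q) ((adjointModule F).reducedCoboundaries q)
      f := by
  have e : w = toCoch F q ∘ f := funext fun i => (hfw i).symm
  subst e
  exact h.of_linearMap (toCoch F q) (fun i => (mem_reducedCocycles_iff (hf i)).2 (h.mem i))
    (fun v hv => (mem_reducedCocycles_iff hv.1).1 hv)
    (fun v hv => (mem_reducedCoboundaries_iff (IsSesq.of_mem hv.1)).2) fun v hv =>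
      (mem_reducedCoboundaries_iff (isSesq_of_mem_reducedCoboundaries hv)).1 hv

end SchrodingerVirasoro

end

/-! ### Values of the representatives on generators -/

noncomputable section

namespace SchrodingerVirasoro

open PolyMod LieCochain

variable {F : Type u} [Field F] [CharZero F]

theorem mvDivCoeff_one {q : ℕ} (n : Fin q → ℕ) :
    mvDivCoeff n (1 : MvPolynomial (Fin q) F) = if ∀ j, n j = 0 then 1 else 0 := by
  rw [← map_one MvPolynomial.C, mvDivCoeff_C]
  simp only [funext_iff, Pi.zero_apply]

theorem mvDivCoeff_X {q : ℕ} (n : Fin q → ℕ) (k : Fin q) :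
    mvDivCoeff n (.X k : MvPolynomial (Fin q) F) =
      if ∀ j, n j = if j = k then 1 else 0 then 1 else 0 := by
  rw [← mul_one (MvPolynomial.X k), mvDivCoeff_X_mul, mvDivCoeff_one]
  by_cases h : ∀ j, n j = if j = k then 1 else 0
  · rw [if_pos h, if_pos, h k]
    · simp
    · intro j
      rw [lower, Function.update_apply]
      split_ifs with hj
      · rw [h k]; simp
      · rw [h j, if_neg hj]
  · rw [if_neg h]
    by_cases h2 : ∀ j, lower n k j = 0
    · rw [if_pos h2, mul_one, Nat.cast_eq_zero]
      by_contra h3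
      refine h fun j => ?_
      have := h2 j
      rw [lower, Function.update_apply] at this
      split_ifs with hj
      · subst hj
        rw [if_pos rfl] at this
        omega
      · rwa [if_neg hj] at this
    · rw [if_neg h2, mul_zero]

/-- Divided coefficients determine the values, so each representative reduces to a comparison of
small determinants with coefficients of polynomials of degree at most one. -/
theorem hasValues_of_dc {q : ℕ} {f : Cnf F q} {v : (Fin q → Fin 3) → PolyMod (Fin q) F (SV F)}
    (h : ∀ g n, Monotone g →
      val (annBasis F) q (toCoch F q f) (fun i => (g i, n i)) = dc n (v g)) : HasValues F f v :=
  fun g hg => ext_dc fun n => by rw [← h g n hg, val_toCoch]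

theorem val_ins {q : ℕ} (c : Coc F (q + 1)) (x : Fin 3 × ℕ) (y : Fin q → Fin 3 × ℕ) :
    val (annBasis F) q (ins (annBasis F x) c) y =
      val (annBasis F) (q + 1) c (Fin.cons x y : Fin (q + 1) → Fin 3 × ℕ) :=
  (val_cons (annBasis F) c x y).symm

theorem hasValues_f11 {f : Cnf F 1} (hf : toCoch F 1 f = coc11 F) : HasValues F f (f11 F) := by
  refine hasValues_of_dc fun g n _ => ?_
  obtain ⟨a, rfl⟩ : ∃ a, g = ![a] := ⟨g 0, by ext i; fin_cases i; rfl⟩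
  obtain ⟨i, rfl⟩ : ∃ a, n = ![a] := ⟨n 0, by ext i; fin_cases i; rfl⟩
  rw [hf, coc11, val_altDelta, f11]
  fin_cases a <;> simp [mvDivCoeff_one, M]

theorem hasValues_f21 {f : Cnf F 2} (hf : toCoch F 2 f = coc21 F) : HasValues F f (f21 F) := by
  refine hasValues_of_dc fun g n hg => ?_
  obtain ⟨a, b, rfl⟩ : ∃ a b, g = ![a, b] := ⟨g 0, g 1, by ext i; fin_cases i <;> rfl⟩
  obtain ⟨i, j, rfl⟩ : ∃ a b, n = ![a, b] := ⟨n 0, n 1, by ext i; fin_cases i <;> rfl⟩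
  have h1 : a ≤ b := hg (Fin.zero_le 1)
  rw [hf, coc21, map_add, Pi.add_apply, val_altDelta, val_altDelta, f21]
  fin_cases a <;> fin_cases b <;> simp at h1 <;>
    simp [mvDivCoeff_one, M, Y, Matrix.det_fin_two, ← ite_and, and_comm]

theorem hasValues_f22 {f : Cnf F 2} (hf : toCoch F 2 f = coc22 F) : HasValues F f (f22 F) := by
  refine hasValues_of_dc fun g n hg => ?_
  obtain ⟨a, b, rfl⟩ : ∃ a b, g = ![a, b] := ⟨g 0, g 1, by ext i; fin_cases i <;> rfl⟩
  obtain ⟨i, j, rfl⟩ : ∃ a b, n = ![a, b] := ⟨n 0, n 1, by ext i; fin_cases i <;> rfl⟩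
  have h1 : a ≤ b := hg (Fin.zero_le 1)
  rw [hf, coc22, val_altDelta, f22]
  fin_cases a <;> fin_cases b <;> simp at h1 <;>
    simp [mvDivCoeff_X, M, Matrix.det_fin_two, ← ite_and, and_comm]
  module

theorem hasValues_f31 {f : Cnf F 3} (hf : toCoch F 3 f = coc31 F) : HasValues F f (f31 F) := by
  refine hasValues_of_dc fun g n hg => ?_
  obtain ⟨a, b, c, rfl⟩ : ∃ a b c, g = ![a, b, c] :=
    ⟨g 0, g 1, g 2, by ext i; fin_cases i <;> rfl⟩
  obtain ⟨i, j, k, rfl⟩ : ∃ a b c, n = ![a, b, c] :=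
    ⟨n 0, n 1, n 2, by ext i; fin_cases i <;> rfl⟩
  have h1 : a ≤ b := hg (Fin.zero_le 1)
  have h2 : b ≤ c := hg (show (1 : Fin 3) ≤ 2 by decide)
  rw [hf, coc31, map_add, Pi.add_apply, val_altDelta, val_altDelta, f31]
  fin_cases a <;> fin_cases b <;> simp at h1 <;> fin_cases c <;> simp at h2 <;>
    simp [mvDivCoeff_X, M, Y, Matrix.det_fin_three, ← ite_and, smul_smul,
      Fin.forall_fin_succ, Fin.succ_ne_zero, and_comm, and_assoc, and_left_comm] <;>
    congr 1 <;> split_ifs <;> first | omega | norm_num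

theorem hasValues_f01 {f : Cnf F 0} (hf : toCoch F 0 f = ins (annBasis F (0, 0)) (coc11 F)) :
    HasValues F f (f01 F) := by
  refine hasValues_of_dc fun g n _ => ?_
  rw [hf, val_ins, coc11, val_altDelta, f01]
  simp [mvDivCoeff_one, M]

theorem hasValues_f12 {f : Cnf F 1} (hf : toCoch F 1 f = ins (annBasis F (0, 0)) (coc21 F)) :
    HasValues F f (f12 F) := by
  refine hasValues_of_dc fun g n _ => ?_
  obtain ⟨a, rfl⟩ : ∃ a, g = ![a] := ⟨g 0, by ext i; fin_cases i; rfl⟩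
  obtain ⟨i, rfl⟩ : ∃ a, n = ![a] := ⟨n 0, by ext i; fin_cases i; rfl⟩
  rw [hf, val_ins, coc21, map_add, Pi.add_apply, val_altDelta, val_altDelta, f12]
  fin_cases a <;> simp [mvDivCoeff_one, M, Y, Matrix.det_fin_two]

theorem hasValues_ins_coc22 {f : Cnf F 1} (hf : toCoch F 1 f = ins (annBasis F (0, 0)) (coc22 F)) :
    HasValues F f fun g => if g = ![0] then tmul (-.X 0) (M F) else 0 := by
  refine hasValues_of_dc fun g n _ => ?_
  obtain ⟨a, rfl⟩ : ∃ a, g = ![a] := ⟨g 0, by ext i; fin_cases i; rfl⟩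
  obtain ⟨i, rfl⟩ : ∃ a, n = ![a] := ⟨n 0, by ext i; fin_cases i; rfl⟩
  rw [hf, val_ins, coc22, val_altDelta]
  fin_cases a <;> simp [mvDivCoeff_X, M, Matrix.det_fin_two]

theorem hasValues_ins_coc31 {f : Cnf F 2} (hf : toCoch F 2 f = ins (annBasis F (0, 0)) (coc31 F)) :
    HasValues F f fun g => if g = ![0, 1] then tmul (-.X 0) ((1 / 2 : F) • Y F)
      else if g = ![0, 2] then tmul (-.X 0) (M F) else 0 := by
  refine hasValues_of_dc fun g n hg => ?_
  obtain ⟨a, b, rfl⟩ : ∃ a b, g = ![a, b] := ⟨g 0, g 1, by ext i; fin_cases i <;> rfl⟩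
  obtain ⟨i, j, rfl⟩ : ∃ a b, n = ![a, b] := ⟨n 0, n 1, by ext i; fin_cases i <;> rfl⟩
  have h1 : a ≤ b := hg (Fin.zero_le 1)
  have h2 : (Fin.cons (0, 0) fun k => (![a, b] k, ![i, j] k) : Fin 3 → Fin 3 × ℕ) =
      ![(0, 0), (a, i), (b, j)] := by
    ext k <;> fin_cases k <;> rfl
  rw [hf, val_ins, h2, coc31, map_add, Pi.add_apply, val_altDelta, val_altDelta]
  clear h2
  fin_cases a <;> fin_cases b <;> simp at h1 <;>
    simp [mvDivCoeff_X, M, Y, Matrix.det_fin_three, ← ite_and, smul_smul, and_comm] <;>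
    split_ifs <;> norm_num

theorem tmul_eq_smul {q : ℕ} (p : MvPolynomial (Fin q) F) (v : SV F) :
    tmul p v = p • tmul 1 v := by
  rw [smul_tmul, mul_one]

theorem partialOp_apply {q : ℕ} (f : Cnf F q) (a : Fin q → SV F) :
    (adjointModule F).partialOp q f a =
      mapCoeff (Fin q) (D F) (f a) + (∑ i, .X i : MvPolynomial (Fin q) F) • f a := rfl

/-- Insertion of `L_(0)` into `f_22` gives `L ↦ -λ M`, and `∂ f_11` is `L ↦ (∂ + λ) M`; the sum is
`L ↦ ∂ M`. -/
theorem hasValues_f13 {f g : Cnf F 1} (hf : toCoch F 1 f = coc11 F)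
    (hg : toCoch F 1 g = ins (annBasis F (0, 0)) (coc22 F)) :
    HasValues F (g + (adjointModule F).partialOp 1 f) (f13 F) := by
  intro a ha
  rw [add_apply, partialOp_apply, hasValues_f11 hf a ha, hasValues_ins_coc22 hg a ha, f11, f13]
  dsimp only
  split_ifs
  · simp only [mapCoeff_tmul, map_smul, Fin.sum_univ_succ, Fin.sum_univ_zero, Fin.succ_zero_eq_one,
      tmul_eq_smul (F := F) (-.X 0), tmul_eq_smul (F := F) (.X 1)]
    module
  · simp

/-- Insertion of `L_(0)` into `f_31` contributes the factor `-λ_1`, and `∂ f_21` the factor `∂ + λ_1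
+ λ_2`; together they give `∂ + λ_2`. -/
theorem hasValues_f23 {f g : Cnf F 2} (hf : toCoch F 2 f = coc21 F)
    (hg : toCoch F 2 g = ins (annBasis F (0, 0)) (coc31 F)) :
    HasValues F (g + (adjointModule F).partialOp 2 f) (f23 F) := by
  intro a ha
  rw [add_apply, partialOp_apply, hasValues_f21 hf a ha, hasValues_ins_coc31 hg a ha, f21, f23]
  dsimp only
  split_ifs
  · simp only [mapCoeff_tmul, map_smul, Fin.sum_univ_succ, Fin.sum_univ_zero, Fin.succ_zero_eq_one,
      tmul_eq_smul (F := F) (-.X 0), tmul_eq_smul (F := F) (.X 1)]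
    module
  · simp only [mapCoeff_tmul, map_smul, Fin.sum_univ_succ, Fin.sum_univ_zero, Fin.succ_zero_eq_one,
      tmul_eq_smul (F := F) (-.X 0), tmul_eq_smul (F := F) (.X 1)]
    module
  · simp

end SchrodingerVirasoro

end

/-! ### Dimensions and bases -/

noncomputable section

namespace SchrodingerVirasoro

open PolyMod LieCochain

variable {F : Type u} [Field F] [CharZero F]

theorem hasBasis_of_isBasisMod {q n : ℕ} {Z B : Submodule F (Cnf F q)} {f : Fin n → Cnf F q}
    {v : Fin n → (Fin q → Fin 3) → PolyMod (Fin q) F (SV F)} (h : IsBasisMod Z B f)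
    (hv : ∀ i, HasValues F (f i) (v i)) : HasBasis F Z B v :=
  ⟨fun i => ⟨f i, h.mem i⟩, hv, h.exists_basis⟩

theorem rank_basicCohomology {q n : ℕ} {w : Fin n → Coc F q}
    (h : IsBasisMod (cocycles F q) (coboundaries F q) w) :
    Module.rank F ((adjointModule F).BasicCohomology q) = n := by
  choose f hf hfw using fun i => exists_cochain_toCoch_eq (h.mem i).1
  exact (isBasisMod_basic h hf hfw).rank_eq

theorem rank_reducedCohomology {q n : ℕ} {w : Fin n → Coc F q}
    (h : IsBasisMod (redCocycles F q) (redCoboundaries F q) w) :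
    Module.rank F ((adjointModule F).ReducedCohomology q) = n := by
  choose f hf hfw using fun i => exists_cochain_toCoch_eq (h.mem i).1
  exact (isBasisMod_reducedCochains h hf hfw).rank_eq

/-- Skew-symmetry is inherited from the Lie algebra side: `∂ f` is antilinear and has the same image
under `toCoch` as a genuine cochain, hence equals it. -/
theorem partialOp_mem_cochains {q : ℕ} {f : Cnf F q} (hf : f ∈ (adjointModule F).cochains q) :
    (adjointModule F).partialOp q f ∈ (adjointModule F).cochains q := by
  obtain ⟨g, hg, hgf⟩ := exists_cochain_toCoch_eq (lie_mem_coch (toCoch_mem_coch hf))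
  have : (adjointModule F).partialOp q f = g :=
    (IsSesq.of_mem hf).partialOp.ext_toCoch (IsSesq.of_mem hg) (by rw [toCoch_partialOp, hgf])
  rwa [this]

theorem lie_mem_redCocycles {q : ℕ} {c : Coc F q} (hc : c ∈ cocycles F q) :
    ⁅annBasis F (0, 0), c⁆ ∈ redCocycles F q := by
  refine ⟨lie_mem_coch hc.1, ?_⟩
  change diff q ⁅annBasis F (0, 0), c⁆ ∈ partials F (q + 1)
  rw [diff_lie, LinearMap.mem_ker.1 hc.2, lie_zero]
  exact zero_mem _

theorem isBasisMod_red_zero : IsBasisMod (redCocycles F 0) (redCoboundaries F 0)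
    ![ins (annBasis F (0, 0)) (coc11 F)] := by
  have h := isBasisMod_reduced (isBasisMod_zero (F := F)) isBasisMod_one
  convert h using 1
  funext i
  fin_cases i
  rfl

theorem lie_mem_redCoboundaries {q : ℕ} {c : Coc F q} (hc : c ∈ coch F q) :
    ⁅annBasis F (0, 0), c⁆ ∈ redCoboundaries F q :=
  Submodule.mem_sup_right ⟨c, hc, rfl⟩

theorem isBasisMod_red_one : IsBasisMod (redCocycles F 1) (redCoboundaries F 1)
    ![coc11 F, ins (annBasis F (0, 0)) (coc21 F),
      ins (annBasis F (0, 0)) (coc22 F) + ⁅annBasis F (0, 0), coc11 F⁆] := by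
  have h := isBasisMod_reduced (isBasisMod_one (F := F)) isBasisMod_two
  refine IsBasisMod.congr h (fun i => ?_) fun i => ?_
  · fin_cases i
    · exact h.mem 0
    · exact h.mem 1
    -- The correction by `L_(0) · coc11`, that is by `∂ f_11`, does not change the class and brings
    -- the representative into the form of `f_13`.
    · exact add_mem (h.mem 2) (lie_mem_redCocycles (isBasisMod_one.mem 0))
  · fin_cases i
    · change coc11 F - coc11 F ∈ _
      rw [sub_self]; exact zero_mem _
    · change ins (annBasis F (0, 0)) (coc21 F) - ins (annBasis F (0, 0)) (coc21 F) ∈ _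
      rw [sub_self]; exact zero_mem _
    · change ins (annBasis F (0, 0)) (coc22 F) -
        (ins (annBasis F (0, 0)) (coc22 F) + ⁅annBasis F (0, 0), coc11 F⁆) ∈ _
      rw [sub_add_cancel_left]
      exact neg_mem (lie_mem_redCoboundaries coc11_mem.1)

theorem isBasisMod_red_two : IsBasisMod (redCocycles F 2) (redCoboundaries F 2)
    ![coc21 F, coc22 F, ins (annBasis F (0, 0)) (coc31 F) + ⁅annBasis F (0, 0), coc21 F⁆] := by
  have h := isBasisMod_reduced (isBasisMod_two (F := F)) isBasisMod_three
  refine IsBasisMod.congr h (fun i => ?_) fun i => ?_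
  · fin_cases i
    · exact h.mem 0
    · exact h.mem 1
    · exact add_mem (h.mem 2) (lie_mem_redCocycles (isBasisMod_two.mem 0))
  · fin_cases i
    · change coc21 F - coc21 F ∈ _
      rw [sub_self]; exact zero_mem _
    · change coc22 F - coc22 F ∈ _
      rw [sub_self]; exact zero_mem _
    · change ins (annBasis F (0, 0)) (coc31 F) -
        (ins (annBasis F (0, 0)) (coc31 F) + ⁅annBasis F (0, 0), coc21 F⁆) ∈ _
      rw [sub_add_cancel_left]
      exact neg_mem (lie_mem_redCoboundaries coc21_mem.1)

theorem isBasisMod_red_three : IsBasisMod (redCocycles F 3) (redCoboundaries F 3) ![coc31 F] := by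
  have h := isBasisMod_reduced (isBasisMod_three (F := F)) isBasisMod_four
  convert h using 1
  funext i
  fin_cases i
  rfl

theorem isBasisMod_high {q : ℕ} (hq : 3 ≤ q) :
    IsBasisMod (cocycles F (q + 1)) (coboundaries F (q + 1)) (![] : Fin 0 → Coc F (q + 1)) := by
  obtain rfl | rfl | h : q = 3 ∨ q = 4 ∨ 5 ≤ q := by omega
  exacts [isBasisMod_four, isBasisMod_five, isBasisMod_of_ge h]

theorem rank_basicCohomology_eq (q : ℕ) : Module.rank F ((adjointModule F).BasicCohomology q) =
    if q = 1 then 1 else if q = 2 then 2 else if q = 3 then 1 else 0 :=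
  match q with
  | 0 => by simpa using rank_basicCohomology (isBasisMod_zero (F := F))
  | 1 => by simpa using rank_basicCohomology (isBasisMod_one (F := F))
  | 2 => by simpa using rank_basicCohomology (isBasisMod_two (F := F))
  | 3 => by simpa using rank_basicCohomology (isBasisMod_three (F := F))
  | q + 4 => by simpa using rank_basicCohomology (isBasisMod_high (F := F) (q := q + 3) (by omega))

theorem rank_reducedCohomology_eq (q : ℕ) :
    Module.rank F ((adjointModule F).ReducedCohomology q) =
      if q = 0 then 1 else if q = 1 then 3 else if q = 2 then 3 else if q = 3 then 1 else 0 :=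
  match q with
  | 0 => by simpa using rank_reducedCohomology (isBasisMod_red_zero (F := F))
  | 1 => by simpa using rank_reducedCohomology (isBasisMod_red_one (F := F))
  | 2 => by simpa using rank_reducedCohomology (isBasisMod_red_two (F := F))
  | 3 => by simpa using rank_reducedCohomology (isBasisMod_red_three (F := F))
  | q + 4 => by
    simpa using rank_reducedCohomology (isBasisMod_reduced
      (isBasisMod_high (F := F) (q := q + 3) (by omega))
      (isBasisMod_high (F := F) (q := q + 4) (by omega)))

end SchrodingerVirasoro

end

open SchrodingerVirasoro in
theorem mainTheorem5 (F : Type*) [Field F] [CharZero F] :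
    (∀ q : ℕ, Module.rank F ((adjointModule F).BasicCohomology q) =
      if q = 1 then 1 else if q = 2 then 2 else if q = 3 then 1 else 0) ∧
    (∀ q : ℕ, Module.rank F ((adjointModule F).ReducedCohomology q) =
      if q = 0 then 1 else if q = 1 then 3 else if q = 2 then 3 else if q = 3 then 1 else 0) ∧
    HasBasis F ((adjointModule F).basicCocycles 1) ((adjointModule F).basicCoboundaries 1)
      ![f11 F] ∧
    HasBasis F ((adjointModule F).basicCocycles 2) ((adjointModule F).basicCoboundaries 2)
      ![f21 F, f22 F] ∧
    HasBasis F ((adjointModule F).basicCocycles 3) ((adjointModule F).basicCoboundaries 3)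
      ![f31 F] ∧
    HasBasis F ((adjointModule F).reducedCocycles 0) ((adjointModule F).reducedCoboundaries 0)
      ![f01 F] ∧
    HasBasis F ((adjointModule F).reducedCocycles 1) ((adjointModule F).reducedCoboundaries 1)
      ![f11 F, f12 F, f13 F] ∧
    HasBasis F ((adjointModule F).reducedCocycles 2) ((adjointModule F).reducedCoboundaries 2)
      ![f21 F, f22 F, f23 F] ∧
    HasBasis F ((adjointModule F).reducedCocycles 3) ((adjointModule F).reducedCoboundaries 3)
      ![f31 F] := by
  obtain ⟨g11, m11, h11⟩ := exists_cochain_toCoch_eq (coc11_mem (F := F)).1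
  obtain ⟨g21, m21, h21⟩ := exists_cochain_toCoch_eq (coc21_mem (F := F)).1
  obtain ⟨g22, m22, h22⟩ := exists_cochain_toCoch_eq (coc22_mem (F := F)).1
  obtain ⟨g31, m31, h31⟩ := exists_cochain_toCoch_eq (coc31_mem (F := F)).1
  obtain ⟨i11, n11, k11⟩ := exists_cochain_toCoch_eq (ins_mem_coch (coc11_mem (F := F)).1 (0, 0))
  obtain ⟨i21, n21, k21⟩ := exists_cochain_toCoch_eq (ins_mem_coch (coc21_mem (F := F)).1 (0, 0))
  obtain ⟨i22, n22, k22⟩ := exists_cochain_toCoch_eq (ins_mem_coch (coc22_mem (F := F)).1 (0, 0))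
  obtain ⟨i31, n31, k31⟩ := exists_cochain_toCoch_eq (ins_mem_coch (coc31_mem (F := F)).1 (0, 0))
  -- The conformal counterparts of the corrected representatives `f_13` and `f_23`.
  have n13 := add_mem n22 (partialOp_mem_cochains m11)
  have n23 := add_mem n31 (partialOp_mem_cochains m21)
  refine ⟨rank_basicCohomology_eq, rank_reducedCohomology_eq, ?_, ?_, ?_, ?_, ?_, ?_, ?_⟩
  · refine hasBasis_of_isBasisMod (f := ![g11]) (isBasisMod_basic isBasisMod_one ?_ ?_) ?_ <;>
      intro i <;> fin_cases i
    exacts [m11, h11, hasValues_f11 h11]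
  · refine hasBasis_of_isBasisMod (f := ![g21, g22]) (isBasisMod_basic isBasisMod_two ?_ ?_) ?_ <;>
      intro i <;> fin_cases i
    exacts [m21, m22, h21, h22, hasValues_f21 h21, hasValues_f22 h22]
  · refine hasBasis_of_isBasisMod (f := ![g31]) (isBasisMod_basic isBasisMod_three ?_ ?_) ?_ <;>
      intro i <;> fin_cases i
    exacts [m31, h31, hasValues_f31 h31]
  · refine hasBasis_of_isBasisMod (f := ![i11])
      (isBasisMod_reducedCochains isBasisMod_red_zero ?_ ?_) ?_ <;> intro i <;> fin_cases i
    exacts [n11, k11, hasValues_f01 k11]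
  · refine hasBasis_of_isBasisMod (f := ![g11, i21, i22 + (adjointModule F).partialOp 1 g11])
      (isBasisMod_reducedCochains isBasisMod_red_one ?_ ?_) ?_ <;> intro i <;> fin_cases i
    · exact m11
    · exact n21
    · exact n13
    · exact h11
    · exact k21
    · exact (map_add _ _ _).trans (by rw [k22, toCoch_partialOp, h11]; rfl)
    · exact hasValues_f11 h11
    · exact hasValues_f12 k21
    · exact hasValues_f13 h11 k22
  · refine hasBasis_of_isBasisMod (f := ![g21, g22, i31 + (adjointModule F).partialOp 2 g21])
      (isBasisMod_reducedCochains isBasisMod_red_two ?_ ?_) ?_ <;> intro i <;> fin_cases i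
    · exact m21
    · exact m22
    · exact n23
    · exact h21
    · exact h22
    · exact (map_add _ _ _).trans (by rw [k31, toCoch_partialOp, h21]; rfl)
    · exact hasValues_f21 h21
    · exact hasValues_f22 h22
    · exact hasValues_f23 h21 k31
  · refine hasBasis_of_isBasisMod (f := ![g31])
      (isBasisMod_reducedCochains isBasisMod_red_three ?_ ?_) ?_ <;> intro i <;> fin_cases i
    exacts [m31, h31, hasValues_f31 h31]
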